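/- Let $M>0$, $|a|\le M$, $\Delta=r^2-2Mr+a^2$, $r_H=M+\sqrt{M^2-a^2}$, and let $(\mathcal M,g)$ be the equatorial plane of the Kerr exterior, with coordinates $t\in\mathbb R$, $\varphi\in\mathbb R/2\pi\mathbb Z$, $r>r_H$ and metric $$g=-dt^2+\frac{2M}{r}(dt-a\,d\varphi)^2+(r^2+a^2)\,d\varphi^2+\frac{r^2}{\Delta}dr^2 .$$ On $T^*\mathcal M$ put $\mathcal H=\frac12 g^{\mu\nu}p_\mu p_\nu=-\frac{m^2}{2}$ with $m>0$, $E=-p_t$, $L=p_\varphi$, $\hat L=L-aE$ and $$R(r)=(Er^2-a\hat L)^2-\Delta(m^2r^2+\hat L^2),$$ so that $(\Delta p_r)^2=R(r)$. Let $\Gamma_{bound}\subset T^*\mathcal M$ be the open set of points on future-directed, non-circular bound orbits: $E^2<m^2$, the nonzero roots of $R$ are simple and satisfy $0<r_0<r_1<r_2$ with $r_H<r_1$, $r_1\le r\le r_2$, and $Er^2-a\hat L>0$ on $[r_1,r_2]$. Let $\mathrm{dvol}_\Gamma=dt\,d\varphi\,dr\,dp_t\,dp_\varphi\,dp_r$.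 Define the area function $$A_m(E,L)=\oint p_r\,dr=2\int_{r_1}^{r_2}\frac{\sqrt{R(r)}}{\Delta}\,dr,$$ the actions $J_0=E$, $J_1=L$, $J_2=A_m(E,L)/2\pi$, the generating function $\mathcal S=-Et+L\varphi+\int_{(r_1,0)}^{(r,p_r)}p_r\,dr$ (line integral along the curve $(\Delta p_r)^2=R(r)$), the variables $Q^\alpha=\partial\mathcal S/\partial J_\alpha$ ($\alpha=0,1,2$; $Q^1,Q^2$ are angles modulo $2\pi$), and the frequencies $\omega^A=\frac{\partial\mathcal H}{\partial J_A}\big/\frac{\partial\mathcal H}{\partial J_0}$, $A=1,2$. Let $F\in L^1(S^1\times S^1\times\mathbb R\times\mathbb R\times(0,\infty))$ be real-valued, where $S^1=\mathbb R/2\pi\mathbb Z$, and let $$f=F(Q^1-\omega^1Q^0,\;Q^2-\omega^2Q^0,\;J_0,J_1,J_2)$$ be the corresponding solution on $\Gamma_{bound}$ of the collisionless Boltzmann equation. Let $\bar F(J_0,J_1,J_2)=\frac1{(2\pi)^2}\int_0^{2\pi}\!\int_0^{2\pi}F(q^1,q^2,J_0,J_1,J_2)\,dq^1dq^2$ and $\bar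 f=\bar F(J_0,J_1,J_2)$. Let $\phi\in C_0^\infty(\Gamma_{bound})$ be a real-valued test function, let $\Omega\in\mathbb R$, let $\psi^t$ be the flow on $\Gamma_{bound}$ of the complete lift of $\partial_t+\Omega\,\partial_\varphi$ (the case $\Omega=0$ being the lift of $\partial_t$), and put $\phi_t=\phi\circ\psi^{-t}$. Suppose that $\det(D^2A_m(E,L))\ne0$ at every point of the support of $\phi$, where $D^2A_m$ is the Hessian matrix of $(E,L)\mapsto A_m(E,L)$. Then $f\phi_t$ (for every $t\in\mathbb R$) and $\bar f\phi$ are integrable over $\Gamma_{bound}$, and $$\lim_{t\to\infty}\int_{\Gamma_{bound}}f\,\phi_t\,\mathrm{dvol}_\Gamma=\int_{\Gamma_{bound}}\bar f\,\phi\,\mathrm{dvol}_\Gamma .$$ -/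

import Mathlib

open MeasureTheory

noncomputable section

namespace KerrMixing

/-! ### The equatorial plane of the Kerr exterior -/

/-- The circle `ℝ / 2πℤ`; its `volume` has total mass `2π`. -/
abbrev S1 : Type := AddCircle (2 * Real.pi)

instance fact_two_pi_pos : Fact (0 < 2 * Real.pi) := ⟨Real.two_pi_pos⟩

/-- `Δ = r² - 2Mr + a²`. -/
def Del (M a r : ℝ) : ℝ := r ^ 2 - 2 * M * r + a ^ 2

/-- Radius of the event horizon. -/
def rH (M a : ℝ) : ℝ := M + Real.sqrt (M ^ 2 - a ^ 2)

/-- Components of the metric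
`-dt² + (2M/r) (dt - a dφ)² + (r² + a²) dφ² + (r²/Δ) dr²` in the coordinates `(t, φ, r)`. -/
def metric (M a r : ℝ) : Matrix (Fin 3) (Fin 3) ℝ :=
  !![-1 + 2 * M / r, -(2 * M * a / r), 0;
     -(2 * M * a / r), r ^ 2 + a ^ 2 + 2 * M * a ^ 2 / r, 0;
     0, 0, r ^ 2 / Del M a r]

/-- Points `(t, φ, r, p_t, p_φ, p_r)` of the cotangent bundle in coordinates (the exterior is the
part `r > r_H`). Its `volume` is `dt dφ dr dp_t dp_φ dp_r`. -/
abbrev Phase : Type := ℝ × S1 × ℝ × ℝ × ℝ × ℝ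

/-- The free-particle Hamiltonian `½ g^{μν} p_μ p_ν`. -/
def hamiltonian (M a r pt pphi pr : ℝ) : ℝ :=
  1 / 2 * (![pt, pphi, pr] ⬝ᵥ ((metric M a r)⁻¹.mulVec ![pt, pphi, pr]))

/-- The rest mass `m = √(-2H)` (used where `H < 0`). -/
def mass (M a r pt pphi pr : ℝ) : ℝ := Real.sqrt (-2 * hamiltonian M a r pt pphi pr)

/-! ### Radial motion and bound orbits -/

/-- `R(r) = (E r² - a L̂)² - Δ (m² r² + L̂²)` with `L̂ = L - a E`; the radial motion with constants
`m, E, L` obeys `(Δ p_r)² = R(r)`. -/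
def R (M a m E L r : ℝ) : ℝ :=
  (E * r ^ 2 - a * (L - a * E)) ^ 2 - Del M a r * (m ^ 2 * r ^ 2 + (L - a * E) ^ 2)

/-- The constants `(m, E, L)` are those of a bound, non-circular, future-directed timelike orbit
outside the horizon: `E² < m²`, the roots of `R` are `0 < r₀ < r₁ < r₂` (all simple, besides the
root `0`), `r_H < r₁`, and momenta on the curve `(Δ p_r)² = R(r)`, `r₁ ≤ r ≤ r₂`, are
future-directed, which for `r > r_H` and `R ≥ 0` means `E r² - a L̂ > 0`. In other words, the
effective potential for angular momentum `L` has a stable circular orbit and `E` lies strictly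
between its energy `E_min(L)` and the top `E_max(L) ≤ m` of the potential well. -/
def IsBound (M a m E L : ℝ) : Prop :=
  0 < m ∧ E ^ 2 < m ^ 2 ∧
  ∃ r₀ r₁ r₂ : ℝ, 0 < r₀ ∧ r₀ < r₁ ∧ r₁ < r₂ ∧ rH M a < r₁ ∧
    (∀ r, R M a m E L r = (m ^ 2 - E ^ 2) * r * (r - r₀) * (r - r₁) * (r₂ - r)) ∧
    (∀ r ∈ Set.Icc r₁ r₂, 0 < E * r ^ 2 - a * (L - a * E))

/-- Outer turning point `r₂`: the largest root of `R`. -/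
def rOut (M a m E L : ℝ) : ℝ := sSup {r | R M a m E L r = 0}

/-- Inner turning point `r₁`: the second largest root of `R`. -/
def rIn (M a m E L : ℝ) : ℝ := sSup {r | r < rOut M a m E L ∧ R M a m E L r = 0}

/-- The phase space of bound trajectories. -/
def GammaBound (M a : ℝ) : Set Phase :=
  {z | match z with
    | (_, _, r, pt, pphi, pr) =>
      rH M a < r ∧ hamiltonian M a r pt pphi pr < 0 ∧
      IsBound M a (mass M a r pt pphi pr) (-pt) pphi ∧
      r ∈ Set.Icc (rIn M a (mass M a r pt pphi pr) (-pt) pphi)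
        (rOut M a (mass M a r pt pphi pr) (-pt) pphi)}

/-! ### Action-angle variables

`J₀ = E`, `J₁ = L`, `J₂ = A_m(E,L) / 2π`, and `Q^α = ∂S/∂J_α`. -/

/-- The area function `A_m(E,L) = ∮ p_r dr = 2 ∫_{r₁}^{r₂} √R / Δ dr`. -/
def area (M a m E L : ℝ) : ℝ :=
  2 * ∫ r in (rIn M a m E L)..(rOut M a m E L), Real.sqrt (R M a m E L r) / Del M a r

/-- The Hessian matrix of `(E, L) ↦ A_m(E, L)`. -/
def areaHessian (M a m E L : ℝ) : Matrix (Fin 2) (Fin 2) ℝ :=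
  !![deriv (fun E' => deriv (fun E'' => area M a m E'' L) E') E,
     deriv (fun E' => deriv (fun L' => area M a m E' L') L) E;
     deriv (fun L' => deriv (fun E' => area M a m E' L') E) L,
     deriv (fun L' => deriv (fun L'' => area M a m E L'') L') L]

/-- `∂G/∂J₀` at fixed `J₁, J₂`, for `G` a function of `(m, E, L)`: since `J₀ = E`, `J₁ = L` and
`J₂ = A_m(E,L)/2π`, the coordinate vector field is `∂_E - (∂_E A / ∂_m A) ∂_m`. -/
def dJ0 (M a : ℝ) (G : ℝ → ℝ → ℝ → ℝ) (m E L : ℝ) : ℝ :=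
  deriv (fun E' => G m E' L) E -
    deriv (fun E' => area M a m E' L) E / deriv (fun m' => area M a m' E L) m *
      deriv (fun m' => G m' E L) m

/-- `∂G/∂J₁` at fixed `J₀, J₂`, for `G` a function of `(m, E, L)`. -/
def dJ1 (M a : ℝ) (G : ℝ → ℝ → ℝ → ℝ) (m E L : ℝ) : ℝ :=
  deriv (fun L' => G m E L') L -
    deriv (fun L' => area M a m E L') L / deriv (fun m' => area M a m' E L) m *
      deriv (fun m' => G m' E L) m

/-- `∂G/∂J₂` at fixed `J₀, J₁`, for `G` a function of `(m, E, L)`. -/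
def dJ2 (M a : ℝ) (G : ℝ → ℝ → ℝ → ℝ) (m E L : ℝ) : ℝ :=
  2 * Real.pi / deriv (fun m' => area M a m' E L) m * deriv (fun m' => G m' E L) m

/-- Radial part of the generating function `S = -E t + L φ + ∫ p_r dr`: the line integral of
`p_r dr` along `(Δ p_r)² = R(r)` from `(r₁, 0)` to the point over `r` with sign `σ` of `p_r`.
The integral is multivalued; the branch is the one that does not pass through `r₂`. Another branch
differs by a multiple of `A_m`, which leaves `Q⁰`, `Q¹` and `Q² mod 2π` unchanged. -/
def radialAction (M a r σ m E L : ℝ) : ℝ :=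
  σ * ∫ s in (rIn M a m E L)..r, Real.sqrt (R M a m E L s) / Del M a s

/-- `Q⁰ = ∂S/∂J₀`. (The turning points `p_r = 0`, a null set, are the caustic of `S`, where the
values of the `Q`s below carry no meaning.) -/
def Q0 (M a : ℝ) : Phase → ℝ
  | (t, _, r, pt, pphi, pr) =>
    -t + dJ0 M a (radialAction M a r (Real.sign pr)) (mass M a r pt pphi pr) (-pt) pphi

/-- `Q¹ = ∂S/∂J₁`, an angle. -/
def Q1 (M a : ℝ) : Phase → S1
  | (_, phi, r, pt, pphi, pr) =>
    phi + ((dJ1 M a (radialAction M a r (Real.sign pr)) (mass M a r pt pphi pr) (-pt) pphi : ℝ) :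
      S1)

/-- `Q² = ∂S/∂J₂`, an angle. -/
def Q2 (M a : ℝ) : Phase → S1
  | (_, _, r, pt, pphi, pr) =>
    ((dJ2 M a (radialAction M a r (Real.sign pr)) (mass M a r pt pphi pr) (-pt) pphi : ℝ) : S1)

/-- `ω¹ = Ω¹/Ω⁰` with `Ω^α = ∂H/∂J_α`, `H = -m²/2`. -/
def omega1 (M a m E L : ℝ) : ℝ :=
  dJ1 M a (fun m' _ _ => -(m' ^ 2) / 2) m E L / dJ0 M a (fun m' _ _ => -(m' ^ 2) / 2) m E L

/-- `ω² = Ω²/Ω⁰` with `Ω^α = ∂H/∂J_α`, `H = -m²/2`. -/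
def omega2 (M a m E L : ℝ) : ℝ :=
  dJ2 M a (fun m' _ _ => -(m' ^ 2) / 2) m E L / dJ0 M a (fun m' _ _ => -(m' ^ 2) / 2) m E L

/-! ### Distribution functions, averages, time translation -/

/-- Angle and action variables `(Q¹, Q², J₀, J₁, J₂)`. -/
abbrev AngleAction : Type := S1 × S1 × ℝ × ℝ × ℝ

/-- The region `S¹ × S¹ × ℝ × ℝ × (0, ∞)`. -/
def angleActionDomain : Set AngleAction := {y | 0 < y.2.2.2.2}

/-- The distribution function
`f = F(Q¹ - ω¹ Q⁰, Q² - ω² Q⁰, J₀, J₁, J₂)` determined by `F`. -/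
def distribution (M a : ℝ) (F : AngleAction → ℝ) : Phase → ℝ
  | (t, phi, r, pt, pphi, pr) =>
    let z : Phase := (t, phi, r, pt, pphi, pr)
    let m := mass M a r pt pphi pr
    F (Q1 M a z - ((omega1 M a m (-pt) pphi * Q0 M a z : ℝ) : S1),
       Q2 M a z - ((omega2 M a m (-pt) pphi * Q0 M a z : ℝ) : S1),
       -pt, pphi, area M a m (-pt) pphi / (2 * Real.pi))

/-- The average of `F` over the angles, as a function on the same space. -/
def angleAverage (F : AngleAction → ℝ) : AngleAction → ℝ
  | (_, _, j0, j1, j2) =>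
    1 / (2 * Real.pi) ^ 2 * ∫ q1 : S1, ∫ q2 : S1, F (q1, q2, j0, j1, j2)

/-- The flow `ψ^s` of the complete lift of `∂_t + Ω ∂_φ` to the cotangent bundle. As the components
of this vector field are constant, the lift has no components along the momenta. -/
def timeFlow (Ω s : ℝ) : Phase → Phase
  | (t, phi, r, pt, pphi, pr) => (t + s, phi + ((Ω * s : ℝ) : S1), r, pt, pphi, pr)

/-- `φ_s = φ ∘ ψ^{-s}`. -/
def timeTranslate (Ω s : ℝ) (φ : Phase → ℝ) : Phase → ℝ := fun z => φ (timeFlow Ω (-s) z)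

/-- `φ ∈ C_0^∞(Γ_bound)`. Smoothness is tested after lifting the angle to the real line. -/
def IsTestFunction (M a : ℝ) (φ : Phase → ℝ) : Prop :=
  ContDiff ℝ (⊤ : ℕ∞)
      (fun y : ℝ × ℝ × ℝ × ℝ × ℝ × ℝ => φ (y.1, ((y.2.1 : ℝ) : S1), y.2.2)) ∧
    HasCompactSupport φ ∧ tsupport φ ⊆ GammaBound M a

/-- The Hessian of the area function is non-degenerate at the constants of motion of `z`. -/
def NonDegenerateAt (M a : ℝ) : Phase → Prop
  | (_, _, r, pt, pphi, pr) => (areaHessian M a (mass M a r pt pphi pr) (-pt) pphi).det ≠ 0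

/-- `N[φ] = ∫_{Γ_bound} f φ dvol`. -/
def observable (M a : ℝ) (f φ : Phase → ℝ) : ℝ := ∫ z in GammaBound M a, f z * φ z

end KerrMixing

end

namespace KerrMixing

open Set Filter Topology

/-! Transfer the translation from the test function to `f`. Since `Q⁰` contains `-t`, the angles `Q¹
- ω¹Q⁰` and `Q² - ω²Q⁰` then advance linearly in the time `s`, with speeds `ω¹ + Ω` and `ω²`, while
the actions stay fixed (`distribution_eq`, `exists_torusFlow`). If `F` is a character
`e^{i(kq¹+lq²)}` times an indicator of the actions, the observable is an oscillatory integral with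
phase `s (k(ω¹+Ω) + lω²)`. For `(k,l) ≠ 0` it tends to zero by the Riemann–Lebesgue lemma, provided
that the law of `k(ω¹+Ω) + lω²` on the support of `φ` is absolutely continuous. For `(k,l) = 0`
nothing depends on `s`. Characters, continuous functions, rectangles, measurable sets and finally
integrable `F` are reached by approximation in `L¹` (`TorusFlow.mixes_of_integrable`). The
approximation requires a bound uniform in `s`: the image of the measure on the support under (angles
at time `s`, actions) must be at most a constant times Lebesgue measure.

Absolute continuity comes from the Hessian. One finds `ω¹ = A_L/A_E` and `ω² = -2π/A_E`, so at fixed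
`m` the `(E,L)`-gradient of the resonance is the Hessian of `A_m` applied to a nonzero vector,
divided by `A_E` (`deriv_resonance_ne_zero`). A function of one variable with nonvanishing
derivative pulls null sets back to null sets, and Fubini does the rest (`volume_resonance_eq_zero`).

The density bound does not use that the action-angle map is symplectic. With the radius and momenta
frozen, `t` and `φ` alone spread the angles over the torus with bounded density, because `ω² ≠ 0`
(`map_angles_le`). The momentum `p_r` is exchanged for `m`; the Jacobian `m r²/√R` has only inverse
square root singularities at the turning points, which are integrable in `r` (`map_constants_le`).
Then `m` is exchanged for `J₂`, which is possible because `∂A/∂m ≠ 0` (`map_actions_le`).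

Regularity of `A` rests on two remarks: the turning points are simple roots, hence smooth in
`(m,E,L)` by the implicit function theorem, and an angular parametrization of `[r₁,r₂]` removes the
square root singularities. The signs of `∂A/∂m` and `∂A/∂E` follow from monotonicity of `R`
(`area_deriv_pos`), which avoids any formula for the derivatives. -/

/-! ### Smooth dependence of integrals on parameters -/

theorem contDiffOn_intervalIntegral_param_aux {H : Type} [NormedAddCommGroup H] [NormedSpace ℝ H]
    [ProperSpace H] {U : Set H} (hU : IsOpen U) (a b : ℝ) (n : ℕ) :
    ∀ {E : Type} [NormedAddCommGroup E] [NormedSpace ℝ E] [CompleteSpace E] {g : H × ℝ → E},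
      ContDiffOn ℝ n g (U ×ˢ univ) → ContDiffOn ℝ n (fun x => ∫ t in a..b, g (x, t)) U := by
  have bdd : ∀ {E : Type} [NormedAddCommGroup E] {g : H × ℝ → E},
      ContinuousOn g (U ×ˢ univ) → ∀ x ∈ U, ∃ s ∈ 𝓝 x, s ⊆ U ∧ ∃ C : ℝ,
        ∀ y ∈ s, ∀ t ∈ uIcc a b, ‖g (y, t)‖ ≤ C := by
    intro E _ g hg x hx
    obtain ⟨k, hk, hkU, hkc⟩ := local_compact_nhds (hU.mem_nhds hx)
    obtain ⟨C, hC⟩ := (hkc.prod (isCompact_uIcc (a := a) (b := b))).exists_bound_of_continuousOn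
      (hg.mono (prod_mono hkU (subset_univ _)))
    exact ⟨k, hk, hkU, C, fun y hy t ht => hC (y, t) ⟨hy, ht⟩⟩
  have slice : ∀ {E : Type} [NormedAddCommGroup E] {g : H × ℝ → E},
      ContinuousOn g (U ×ˢ univ) → ∀ x ∈ U, Continuous fun t => g (x, t) := by
    intro E _ g hg x hx
    rw [← continuousOn_univ]
    exact hg.comp (by fun_prop) (fun t _ => ⟨hx, mem_univ _⟩)
  -- The codomain stays quantified inside the induction, because the successor step applies the
  -- hypothesis to the partial derivative in the parameter, which takes values in a space of linear
  -- maps.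
  induction n with
  | zero =>
    intro E _ _ _ g hg
    simp only [CharP.cast_eq_zero, contDiffOn_zero] at hg ⊢
    intro x hx
    apply ContinuousAt.continuousWithinAt
    obtain ⟨s, hs, hsU, C, hC⟩ := bdd hg x hx
    apply intervalIntegral.continuousAt_of_dominated_interval (bound := fun _ => C)
    · filter_upwards [hs] with y hy
      exact (slice hg y (hsU hy)).aestronglyMeasurable
    · filter_upwards [hs] with y hy
      exact ae_of_all _ fun t ht => hC y hy t (uIoc_subset_uIcc ht)
    · exact intervalIntegrable_const
    · refine ae_of_all _ fun t _ => ?_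
      have : ContinuousAt g (x, t) :=
        hg.continuousAt ((hU.prod isOpen_univ).mem_nhds ⟨hx, mem_univ _⟩)
      exact this.comp (f := fun y => (y, t)) (by fun_prop)
  | succ n ih =>
    intro E _ _ _ g hg
    have hO : IsOpen (U ×ˢ (univ : Set ℝ)) := hU.prod isOpen_univ
    have hg' : ContDiffOn ℝ n (fun z => (fderiv ℝ g z).comp (ContinuousLinearMap.inl ℝ H ℝ))
        (U ×ˢ univ) := by
      have := hg.fderiv_of_isOpen hO (m := n) (by norm_cast)
      exact this.clm_comp contDiffOn_const
    have hd : ∀ x ∈ U, HasFDerivAt (fun x => ∫ t in a..b, g (x, t))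
        (∫ t in a..b, (fderiv ℝ g (x, t)).comp (ContinuousLinearMap.inl ℝ H ℝ)) x := by
      intro x hx
      obtain ⟨s, hs, hsU, C, hC⟩ := bdd hg'.continuousOn x hx
      apply intervalIntegral.hasFDerivAt_integral_of_dominated_of_fderiv_le (s := s)
        (bound := fun _ => C) (F := fun x t => g (x, t))
        (F' := fun x t => (fderiv ℝ g (x, t)).comp (ContinuousLinearMap.inl ℝ H ℝ)) hs
      · filter_upwards [hs] with y hy
        exact (slice hg.continuousOn y (hsU hy)).aestronglyMeasurable
      · exact (slice hg.continuousOn x hx).intervalIntegrable _ _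
      · exact (slice hg'.continuousOn x hx).aestronglyMeasurable
      · exact ae_of_all _ fun t ht y hy => hC y hy t (uIoc_subset_uIcc ht)
      · exact intervalIntegrable_const
      · refine ae_of_all _ fun t _ y hy => ?_
        have h1 : HasFDerivAt g (fderiv ℝ g (y, t)) (y, t) :=
          ((hg.differentiableOn (by simp)).differentiableAt
            (hO.mem_nhds ⟨hsU hy, mem_univ _⟩)).hasFDerivAt
        exact h1.comp y (hasFDerivAt_prodMk_left y t)
    have key : ContDiffOn ℝ ((n : WithTop ℕ∞) + 1) (fun x => ∫ t in a..b, g (x, t)) U := by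
      rw [contDiffOn_succ_iff_fderiv_of_isOpen hU]
      refine ⟨fun x hx => (hd x hx).differentiableAt.differentiableWithinAt, by simp, ?_⟩
      exact (ih hg').congr fun x hx => (hd x hx).fderiv
    exact_mod_cast key

theorem contDiffOn_intervalIntegral_param {H : Type} [NormedAddCommGroup H] [NormedSpace ℝ H]
    [ProperSpace H] {U : Set H} (hU : IsOpen U) (a b : ℝ) {g : H × ℝ → ℝ}
    (hg : ContDiffOn ℝ (⊤ : ℕ∞) g (U ×ˢ univ)) :
    ContDiffOn ℝ (⊤ : ℕ∞) (fun x => ∫ t in a..b, g (x, t)) U :=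
  contDiffOn_infty.2 fun n =>
    contDiffOn_intervalIntegral_param_aux hU a b n (hg.of_le (by exact_mod_cast le_top))

/-! ### Null sets under functions with nonvanishing derivative -/

/-- The part of `s` lying over `N` is covered by countably many pieces on which `g` is injective
with Lipschitz inverse, and Lipschitz maps carry null sets to null sets. Neither measurability of
`s` nor continuity of the derivative is needed. -/
theorem volume_inter_preimage_eq_zero {g : ℝ → ℝ} {s N : Set ℝ}
    (hg : ∀ x ∈ s, ∃ d ≠ 0, HasDerivAt g d x) (hN : volume N = 0) :
    volume (s ∩ g ⁻¹' N) = 0 := by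
  -- On `S n k` distances shrink under `g` at most by the factor `n + 1`, but only for points closer
  -- than `1/(n+1)`. Fixing the floor of `(n+1)x` makes any two points of a piece that close.
  let S : ℕ → ℤ → Set ℝ := fun n k => {x | x ∈ s ∧ g x ∈ N ∧
    (∀ y, |y - x| < 1 / ((n : ℝ) + 1) → |y - x| ≤ ((n : ℝ) + 1) * |g y - g x|) ∧
    ⌊((n : ℝ) + 1) * x⌋ = k}
  have hcov : s ∩ g ⁻¹' N ⊆ ⋃ n, ⋃ k, S n k := by
    rintro x ⟨hx, hxN⟩
    obtain ⟨d, hd, hdx⟩ := hg x hx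
    have hlo := hdx.isLittleO
    have hev := hlo.bound (show 0 < |d| / 2 by positivity)
    rw [Metric.eventually_nhds_iff] at hev
    obtain ⟨ε, hε, hev⟩ := hev
    obtain ⟨n, hn⟩ := exists_nat_gt (max (1 / ε) (2 / |d|))
    have hn1 : 1 / ε < n := lt_of_le_of_lt (le_max_left _ _) hn
    have hn2 : 2 / |d| < n := lt_of_le_of_lt (le_max_right _ _) hn
    have hd0 : 0 < |d| := abs_pos.2 hd
    rw [div_lt_iff₀ hε] at hn1
    rw [div_lt_iff₀ hd0] at hn2
    refine mem_iUnion.2 ⟨n, mem_iUnion.2 ⟨_, hx, hxN, fun y hy => ?_, rfl⟩⟩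
    have hy' : dist y x < ε := by
      rw [Real.dist_eq]
      refine hy.trans_le ?_
      rw [div_le_iff₀ (by positivity)]
      nlinarith
    have h2 := hev hy'
    rw [Real.norm_eq_abs, Real.norm_eq_abs] at h2
    have h3 : |d| * |y - x| ≤ |g y - g x| + |d| / 2 * |y - x| := by
      calc |d| * |y - x| = |(y - x) * d| := by rw [abs_mul, mul_comm]
        _ = |(g y - g x) - (g y - g x - (y - x) * d)| := by congr 1; ring
        _ ≤ |g y - g x| + |g y - g x - (y - x) * d| := abs_sub _ _
        _ ≤ _ := by
          have : (y - x) • d = (y - x) * d := rfl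
          rw [this] at h2
          linarith
    have h4 : 0 ≤ |y - x| := abs_nonneg _
    have h5 : 0 ≤ |g y - g x| := abs_nonneg _
    have h6 : |d| * |y - x| ≤ 2 * |g y - g x| := by linarith
    have h7 : 2 * |y - x| ≤ (n * |d|) * |y - x| := by nlinarith
    have h8 : (n : ℝ) * (|d| * |y - x|) ≤ n * (2 * |g y - g x|) := by gcongr
    nlinarith
  refine measure_mono_null hcov ?_
  rw [measure_iUnion_null_iff]
  intro n
  rw [measure_iUnion_null_iff]
  intro k
  have hanti : ∀ x ∈ S n k, ∀ y ∈ S n k, |y - x| ≤ ((n : ℝ) + 1) * |g y - g x| := by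
    rintro x ⟨-, -, hx, hxk⟩ y ⟨-, -, -, hyk⟩
    apply hx
    have := Int.abs_sub_lt_one_of_floor_eq_floor (hyk.trans hxk.symm)
    rw [← mul_sub, abs_mul, abs_of_pos (by positivity : (0 : ℝ) < n + 1)] at this
    rw [lt_div_iff₀ (by positivity)]
    linarith
  have hinj : InjOn g (S n k) := by
    intro x hx y hy hxy
    have := hanti x hx y hy
    rw [hxy, sub_self, abs_zero, mul_zero] at this
    have := abs_nonpos_iff.1 this
    linarith
  have hlip : LipschitzOnWith ((n : NNReal) + 1) (Function.invFunOn g (S n k)) (g '' S n k) := by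
    apply LipschitzOnWith.of_dist_le_mul
    rintro _ ⟨x, hx, rfl⟩ _ ⟨y, hy, rfl⟩
    rw [hinj.leftInvOn_invFunOn hx, hinj.leftInvOn_invFunOn hy, Real.dist_eq, Real.dist_eq]
    exact_mod_cast hanti y hy x hx
  have h1 := hlip.hausdorffMeasure_image_le (d := 1) zero_le_one
  rw [hinj.leftInvOn_invFunOn.image_image, hausdorffMeasure_real] at h1
  have h2 : volume (g '' S n k) = 0 := by
    refine measure_mono_null ?_ hN
    rintro _ ⟨x, hx, rfl⟩
    exact hx.2.1
  rw [h2, mul_zero] at h1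
  exact nonpos_iff_eq_zero.1 h1

/-! ### The Riemann–Lebesgue lemma for a phase with absolutely continuous law -/

theorem integrable_exp_mul {X : Type*} [MeasurableSpace X] {μ : Measure X}
    {θ : X → ℝ} (hθ : AEMeasurable θ μ) {H : X → ℂ} (hH : Integrable H μ) (s : ℝ) :
    Integrable (fun x => Complex.exp (Complex.I * (s * θ x : ℝ)) * H x) μ := by
  refine hH.bdd_mul (c := 1) ?_ (ae_of_all _ fun x => ?_)
  · apply AEMeasurable.aestronglyMeasurable
    fun_prop
  · rw [mul_comm, Complex.norm_exp_ofReal_mul_I]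

theorem norm_integral_exp_mul_le {X : Type*} [MeasurableSpace X] {μ : Measure X}
    (θ : X → ℝ) (H : X → ℂ) (s : ℝ) :
    ‖∫ x, Complex.exp (Complex.I * (s * θ x : ℝ)) * H x ∂μ‖ ≤ ∫ x, ‖H x‖ ∂μ := by
  refine (norm_integral_le_integral_norm _).trans_eq ?_
  congr 1
  ext x
  rw [norm_mul, mul_comm Complex.I, Complex.norm_exp_ofReal_mul_I, one_mul]

/-- Riemann–Lebesgue lemma for a finite measure whose image under the phase is absolutely
continuous. -/
theorem tendsto_integral_exp_mul_atTop {X : Type*} [MeasurableSpace X] {μ : Measure X}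
    [IsFiniteMeasure μ] {θ : X → ℝ} (hθ : AEMeasurable θ μ) (hac : μ.map θ ≪ volume)
    {H : X → ℂ} (hH : Integrable H μ) :
    Tendsto (fun s : ℝ => ∫ x, Complex.exp (Complex.I * (s * θ x : ℝ)) * H x ∂μ) atTop (𝓝 0) := by
  refine Integrable.induction (P := fun H => Tendsto (fun s : ℝ =>
    ∫ x, Complex.exp (Complex.I * (s * θ x : ℝ)) * H x ∂μ) atTop (𝓝 0)) ?_ ?_ ?_ ?_ hH
  · intro c S hS _
    have h1 : ∀ s : ℝ, ∫ x, Complex.exp (Complex.I * (s * θ x : ℝ)) * S.indicator (fun _ => c) x ∂μ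
        = (∫ x, Complex.exp (Complex.I * (s * x : ℝ)) ∂((μ.restrict S).map θ)) * c := by
      intro s
      rw [integral_map (hθ.mono_measure Measure.restrict_le_self)
        (by apply Continuous.aestronglyMeasurable; fun_prop), ← integral_mul_const,
        ← integral_indicator hS]
      congr 1
      ext x
      by_cases hx : x ∈ S <;> simp [hx]
    simp_rw [h1]
    rw [← zero_mul c]
    apply Tendsto.mul_const
    -- For an indicator the integral is the characteristic function of the law `ρ` of the phase on
    -- `S`. As `ρ` has an integrable density, this is the Fourier transform of an `L¹` function.
    set ρ := (μ.restrict S).map θ with hρ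
    have hρac : ρ ≪ volume := by
      refine Measure.AbsolutelyContinuous.trans ?_ hac
      exact Measure.absolutelyContinuous_of_le
        (Measure.map_mono_of_aemeasurable Measure.restrict_le_self hθ)
    have h2 : ∀ s : ℝ, ∫ x, Complex.exp (Complex.I * (s * x : ℝ)) ∂ρ =
        ∫ v : ℝ, (Real.fourierChar (-(v * (-s / (2 * Real.pi)))) : Circle) •
          (((ρ.rnDeriv volume v).toReal : ℝ) : ℂ) := by
      intro s
      rw [← integral_rnDeriv_smul hρac]
      congr 1
      ext v
      rw [Circle.smul_def, Real.fourierChar_apply, smul_eq_mul, Complex.real_smul, mul_comm]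
      congr 2
      have : (Real.pi : ℂ) ≠ 0 := by exact_mod_cast Real.pi_ne_zero
      push_cast
      field_simp
    simp_rw [h2]
    refine (Real.tendsto_integral_exp_smul_cocompact _).comp ?_
    have : Tendsto (fun s : ℝ => -s / (2 * Real.pi)) atTop atBot :=
      tendsto_neg_atTop_atBot.atBot_div_const Real.two_pi_pos
    exact this.mono_right atBot_le_cocompact
  · intro f g _ hf hg hPf hPg
    have := hPf.add hPg
    rw [add_zero] at this
    refine this.congr fun s => ?_
    rw [← integral_add (integrable_exp_mul hθ hf s) (integrable_exp_mul hθ hg s)]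
    simp only [Pi.add_apply, mul_add]
  -- The oscillatory integral is bounded by the `L¹` norm for every `s`, so the functions with limit
  -- zero form a closed set.
  · rw [← isSeqClosed_iff_isClosed]
    intro f g hf hfg
    simp only [mem_ofPred_eq] at hf ⊢
    rw [Metric.tendsto_nhds]
    intro ε hε
    have hfg' : Tendsto (fun n => ∫ x, ‖f n x - g x‖ ∂μ) atTop (𝓝 0) := by
      have := tendsto_iff_norm_sub_tendsto_zero.1 hfg
      refine this.congr fun n => ?_
      rw [L1.norm_eq_integral_norm]
      refine integral_congr_ae ?_
      filter_upwards [Lp.coeFn_sub (f n) g] with x hx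
      rw [hx]; rfl
    obtain ⟨n, hn⟩ := ((tendsto_order.1 hfg').2 (ε / 2) (by positivity)).exists
    filter_upwards [(Metric.tendsto_nhds.1 (hf n)) (ε / 2) (by positivity)] with s hs
    rw [dist_zero_right] at hs ⊢
    have h3 := norm_integral_exp_mul_le (μ := μ) θ (fun x => f n x - g x) s
    have h4 : ∫ x, Complex.exp (Complex.I * (s * θ x : ℝ)) * (f n x - g x) ∂μ =
        (∫ x, Complex.exp (Complex.I * (s * θ x : ℝ)) * f n x ∂μ) -
        ∫ x, Complex.exp (Complex.I * (s * θ x : ℝ)) * g x ∂μ := by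
      rw [← integral_sub (integrable_exp_mul hθ (L1.integrable_coeFn _) s)
        (integrable_exp_mul hθ (L1.integrable_coeFn _) s)]
      simp only [mul_sub]
    rw [h4] at h3
    have h5 := norm_sub_norm_le (∫ x, Complex.exp (Complex.I * (s * θ x : ℝ)) * g x ∂μ)
      (∫ x, Complex.exp (Complex.I * (s * θ x : ℝ)) * f n x ∂μ)
    rw [norm_sub_rev] at h5
    linarith
  · intro f g hfg _ hP
    refine hP.congr fun s => integral_congr_ae ?_
    filter_upwards [hfg] with x hx
    rw [hx]

/-! ### Winding a bounded time interval around the torus -/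

theorem setLIntegral_circle_le (g : S1 → ENNReal) (b : ℝ) (n : ℕ) :
    ∫⁻ x in Ioc b (b + n * (2 * Real.pi)), g (x : S1) ≤ n * ∫⁻ q, g q := by
  induction n with
  | zero => simp
  | succ n ih =>
    have h : Ioc b (b + (n + 1 : ℕ) * (2 * Real.pi)) ⊆ Ioc b (b + n * (2 * Real.pi)) ∪
        Ioc (b + n * (2 * Real.pi)) (b + n * (2 * Real.pi) + 2 * Real.pi) := by
      intro x hx
      push_cast at hx
      simp only [mem_union, mem_Ioc] at hx ⊢
      by_cases h : x ≤ b + n * (2 * Real.pi)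
      · exact Or.inl ⟨hx.1, h⟩
      · exact Or.inr ⟨not_le.1 h, by linarith [hx.2]⟩
    refine (lintegral_mono_set h).trans ((lintegral_union_le _ _ _).trans ?_)
    rw [AddCircle.lintegral_preimage (2 * Real.pi)]
    push_cast
    rw [add_mul, one_mul]
    gcongr

/-- The substitution `x = w t` produces an interval of length `2T|w|`, covered by at most `T|w|/π +
1` full turns; dividing by `|w|` gives the constant. -/
theorem setLIntegral_circle_affine_le (g : S1 → ENNReal) {w : ℝ} (hw : w ≠ 0) {T : ℝ} (hT : 0 ≤ T)
    (c : S1) :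
    ∫⁻ t in Icc (-T) T, g (((w * t : ℝ) : S1) + c) ≤
      ENNReal.ofReal (T / Real.pi + 1 / |w|) * ∫⁻ q, g q := by
  have hpi := Real.pi_pos
  have hw0 : 0 < |w| := abs_pos.2 hw
  set n : ℕ := ⌊T * |w| / Real.pi⌋₊ + 1 with hn
  have hn1 : T * |w| / Real.pi < n := by
    rw [hn]; push_cast; exact Nat.lt_floor_add_one _
  have hn2 : (n : ℝ) ≤ T * |w| / Real.pi + 1 := by
    rw [hn]; push_cast; gcongr; exact Nat.floor_le (by positivity)
  have h1 := lintegral_image_eq_lintegral_abs_deriv_mul (s := Icc (-T) T) (f := fun t => w * t)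
    (f' := fun _ => w) measurableSet_Icc
    (fun x _ => by simpa using ((hasDerivAt_id x).const_mul w).hasDerivWithinAt)
    (fun x _ y _ h => mul_left_cancel₀ hw h) (fun x => g ((x : S1) + c))
  rw [lintegral_const_mul' _ _ ENNReal.ofReal_ne_top] at h1
  have h2 : (fun t => w * t) '' Icc (-T) T ⊆ Icc (-(T * |w|)) (T * |w|) := by
    rintro _ ⟨t, ht, rfl⟩
    rw [mem_Icc, ← abs_le] at ht
    rw [mem_Icc, ← abs_le, abs_mul, mul_comm]
    gcongr
  have h3 : ∫⁻ x in Icc (-(T * |w|)) (T * |w|), g ((x : S1) + c) ≤ n * ∫⁻ q, g q := by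
    rw [← Measure.restrict_congr_set Ioc_ae_eq_Icc]
    have h4 : Ioc (-(T * |w|)) (T * |w|) ⊆ Ioc (-(T * |w|)) (-(T * |w|) + n * (2 * Real.pi)) := by
      apply Ioc_subset_Ioc_right
      rw [div_lt_iff₀ hpi] at hn1
      linarith
    refine (lintegral_mono_set h4).trans ?_
    refine (setLIntegral_circle_le (fun q => g (q + c)) _ n).trans_eq ?_
    rw [lintegral_add_right_eq_self]
  have h5 : ENNReal.ofReal |w| * ∫⁻ t in Icc (-T) T, g (((w * t : ℝ) : S1) + c) ≤
      n * ∫⁻ q, g q := h1 ▸ (lintegral_mono_set h2).trans h3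
  have h6 : ENNReal.ofReal (1 / |w|) * ENNReal.ofReal |w| = 1 := by
    rw [← ENNReal.ofReal_mul (by positivity), one_div_mul_cancel hw0.ne', ENNReal.ofReal_one]
  calc _ = ENNReal.ofReal (1 / |w|) * (ENNReal.ofReal |w| *
        ∫⁻ t in Icc (-T) T, g (((w * t : ℝ) : S1) + c)) := by rw [← mul_assoc, h6, one_mul]
    _ ≤ ENNReal.ofReal (1 / |w|) * (n * ∫⁻ q, g q) := by gcongr
    _ ≤ _ := by
      rw [← mul_assoc]
      gcongr
      rw [← ENNReal.ofReal_natCast, ← ENNReal.ofReal_mul (by positivity)]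
      apply ENNReal.ofReal_le_ofReal
      calc 1 / |w| * (n : ℝ) ≤ 1 / |w| * (T * |w| / Real.pi + 1) := by gcongr
        _ = _ := by field_simp

/-- Pushing the bounded strip `|t| ≤ T` forward to the torus along lines of slope `w₁/w₂` produces
a bounded density. -/
theorem lintegral_torus_line_le {g : S1 × S1 → ENNReal} (hg : Measurable g) {w₁ w₂ : ℝ}
    (hw : w₂ ≠ 0) {T : ℝ} (hT : 0 ≤ T) (c₁ c₂ : S1) :
    ∫⁻ t in Icc (-T) T, ∫⁻ ϕ : S1, g (ϕ + ((w₁ * t : ℝ) : S1) + c₁, ((w₂ * t : ℝ) : S1) + c₂) ≤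
      ENNReal.ofReal (T / Real.pi + 1 / |w₂|) * ∫⁻ q, g q := by
  -- Translation invariance in `ϕ` removes the drift of the first angle, so `w₁` is arbitrary and
  -- only `w₂ ≠ 0` matters.
  have h1 : ∀ t : ℝ,
      ∫⁻ ϕ : S1, g (ϕ + ((w₁ * t : ℝ) : S1) + c₁, ((w₂ * t : ℝ) : S1) + c₂) =
      ∫⁻ ϕ : S1, g (ϕ, ((w₂ * t : ℝ) : S1) + c₂) := by
    intro t
    simp_rw [add_assoc]
    exact lintegral_add_right_eq_self (fun ϕ => g (ϕ, ((w₂ * t : ℝ) : S1) + c₂)) _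
  simp_rw [h1]
  refine (setLIntegral_circle_affine_le (fun q => ∫⁻ ϕ : S1, g (ϕ, q)) hw hT c₂).trans_eq ?_
  rw [Measure.volume_eq_prod, lintegral_prod_symm _ hg.aemeasurable]

/-! ### Torus flows and approximation in `L¹` -/

/-- This is the source of all bounds uniform in time: `C` depends only on the domination of the
image measure, and the same `C` serves for all `s`. -/
theorem integrable_comp_of_map_le {X Z : Type*} [MeasurableSpace X] [MeasurableSpace Z]
    {μ : Measure X} {ρ : Measure Z} {f : X → Z} (hf : AEMeasurable f μ) {C : ENNReal} (hC : C ≠ ⊤)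
    (hle : μ.map f ≤ C • ρ) {G : Z → ℂ} (hG : Integrable G ρ) :
    Integrable (fun x => G (f x)) μ ∧ ∫ x, ‖G (f x)‖ ∂μ ≤ C.toReal * ∫ z, ‖G z‖ ∂ρ := by
  have h1 : Integrable G (C • ρ) := hG.smul_measure hC
  have h2 : Integrable G (μ.map f) := h1.mono_measure hle
  refine ⟨h2.comp_aemeasurable hf, ?_⟩
  rw [← integral_map (f := fun z => ‖G z‖) hf h2.norm.aestronglyMeasurable]
  refine (integral_mono_measure hle (ae_of_all _ fun z => norm_nonneg _) h1.norm).trans_eq ?_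
  rw [integral_smul_measure, smul_eq_mul]

/-- A measure space carrying torus-valued angles `q`, actions `J` and frequencies `w` such that
the angles transported along the frequencies have uniformly bounded density, and all nontrivial
resonance combinations of the frequencies are absolutely continuous; `h` is a bounded weight. -/
structure TorusFlow {X Y : Type*} [MeasurableSpace X] [MeasurableSpace Y] (μ : Measure X)
    (ν : Measure Y) where
  q₁ : X → S1
  q₂ : X → S1
  J : X → Y
  w₁ : X → ℝ
  w₂ : X → ℝ
  h : X → ℂ
  D : ℝ
  C : ENNReal
  aem_q₁ : AEMeasurable q₁ μ
  aem_q₂ : AEMeasurable q₂ μ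
  aem_J : AEMeasurable J μ
  aem_w₁ : AEMeasurable w₁ μ
  aem_w₂ : AEMeasurable w₂ μ
  aem_h : AEMeasurable h μ
  norm_h_le : ∀ x, ‖h x‖ ≤ D
  C_ne_top : C ≠ ⊤
  map_le : ∀ s : ℝ, μ.map (fun x => (q₁ x + ((s * w₁ x : ℝ) : S1), q₂ x + ((s * w₂ x : ℝ) : S1),
    J x)) ≤ C • (volume : Measure S1).prod ((volume : Measure S1).prod ν)
  map_ac : ∀ k l : ℤ, (k ≠ 0 ∨ l ≠ 0) → μ.map (fun x => k * w₁ x + l * w₂ x) ≪ volume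

/-- Product of the volume of the torus with `ν`. -/
noncomputable abbrev torusProd {Y : Type*} [MeasurableSpace Y] (ν : Measure Y) : Measure (S1 × S1 × Y) :=
  (volume : Measure S1).prod ((volume : Measure S1).prod ν)

/-- The average over the torus. -/
noncomputable def torusAverage {Y : Type*} (F : S1 × S1 × Y → ℂ) (y : Y) : ℂ :=
  (1 / (2 * Real.pi) ^ 2 : ℝ) * ∫ q : S1 × S1, F (q.1, q.2, y)

theorem volume_circle : (volume : Measure S1) univ = ENNReal.ofReal (2 * Real.pi) :=
  AddCircle.measure_univ _

theorem integrable_torusAverage {Y : Type*} [MeasurableSpace Y] {ν : Measure Y} [SFinite ν]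
    {F : S1 × S1 × Y → ℂ} (hF : Integrable F (torusProd ν)) :
    Integrable (torusAverage F) ν ∧
      ∫ y, ‖torusAverage F y‖ ∂ν ≤ 1 / (2 * Real.pi) ^ 2 * ∫ z, ‖F z‖ ∂torusProd ν := by
  have hmp := measurePreserving_prodAssoc (volume : Measure S1) (volume : Measure S1) ν
  have h1 : Integrable (fun z : (S1 × S1) × Y => F (z.1.1, z.1.2, z.2))
      ((volume : Measure (S1 × S1)).prod ν) := hmp.integrable_comp_of_integrable hF
  refine ⟨h1.integral_prod_right.const_mul _, ?_⟩
  have h2 : ∀ y, ‖torusAverage F y‖ ≤ 1 / (2 * Real.pi) ^ 2 *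
      ∫ q : S1 × S1, ‖F (q.1, q.2, y)‖ := by
    intro y
    rw [torusAverage, norm_mul, Complex.norm_real, Real.norm_of_nonneg (by positivity)]
    gcongr
    exact norm_integral_le_integral_norm _
  refine (integral_mono (h1.integral_prod_right.const_mul _).norm
    (h1.norm.integral_prod_right.const_mul _) h2).trans_eq ?_
  rw [integral_const_mul, integral_integral_swap (f := fun y (q : S1 × S1) => ‖F (q.1, q.2, y)‖)
    h1.norm.swap, integral_integral
    (f := fun (q : S1 × S1) y => ‖F (q.1, q.2, y)‖) h1.norm]
  congr 1
  exact hmp.integral_comp' (f := MeasurableEquiv.prodAssoc) (fun z => ‖F z‖)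

namespace TorusFlow

variable {X Y : Type*} [MeasurableSpace X] [MeasurableSpace Y] {μ : Measure X} {ν : Measure Y}
  (𝒯 : TorusFlow μ ν)

/-- Angles at time `s`, and actions. -/
noncomputable def flow (s : ℝ) (x : X) : S1 × S1 × Y :=
  (𝒯.q₁ x + ((s * 𝒯.w₁ x : ℝ) : S1), 𝒯.q₂ x + ((s * 𝒯.w₂ x : ℝ) : S1), 𝒯.J x)

theorem aemeasurable_flow (s : ℝ) : AEMeasurable (𝒯.flow s) μ := by
  have hc : Measurable ((↑) : ℝ → S1) := (AddCircle.continuous_mk' _).measurable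
  exact (𝒯.aem_q₁.add (hc.comp_aemeasurable (𝒯.aem_w₁.const_mul s))).prodMk
    ((𝒯.aem_q₂.add (hc.comp_aemeasurable (𝒯.aem_w₂.const_mul s))).prodMk 𝒯.aem_J)

theorem integrable_weight_mul {G : X → ℂ} (hG : Integrable G μ) :
    Integrable (fun x => G x * 𝒯.h x) μ :=
  hG.mul_bdd (c := 𝒯.D) 𝒯.aem_h.aestronglyMeasurable (ae_of_all _ 𝒯.norm_h_le)

theorem norm_integral_weight_mul_le {G : X → ℂ} (hG : Integrable G μ) :
    ‖∫ x, G x * 𝒯.h x ∂μ‖ ≤ |𝒯.D| * ∫ x, ‖G x‖ ∂μ := by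
  refine (norm_integral_le_integral_norm _).trans ?_
  rw [← integral_const_mul]
  refine integral_mono (𝒯.integrable_weight_mul hG).norm (hG.norm.const_mul _) fun x => ?_
  simp only
  rw [norm_mul, mul_comm]
  gcongr
  exact (𝒯.norm_h_le x).trans (le_abs_self _)

/-- At time zero, forgetting the two angles in the domination of the joint law costs the area
`(2π)²` of the torus. -/
theorem map_J_le [SFinite ν] :
    μ.map 𝒯.J ≤ (𝒯.C * (ENNReal.ofReal (2 * Real.pi)) ^ 2) • ν := by
  have h1 : μ.map 𝒯.J = (μ.map (𝒯.flow 0)).map (fun z => z.2.2) := by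
    rw [AEMeasurable.map_map_of_aemeasurable (by fun_prop) (𝒯.aemeasurable_flow 0)]
    rfl
  rw [h1]
  refine (Measure.map_mono (𝒯.map_le 0) (by fun_prop)).trans ?_
  rw [Measure.le_iff]
  intro s hs
  rw [Measure.map_apply (by fun_prop) hs]
  have : (fun z : S1 × S1 × Y => z.2.2) ⁻¹' s = univ ×ˢ (univ ×ˢ s) := by
    ext z; simp
  rw [this]
  simp only [Measure.smul_apply, Measure.prod_prod, volume_circle, smul_eq_mul]
  apply le_of_eq
  ring

/-- Convergence of the observable of `F` to that of its torus average. -/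
def Mixes (F : S1 × S1 × Y → ℂ) : Prop :=
  Tendsto (fun s : ℝ => ∫ x, F (𝒯.flow s x) * 𝒯.h x ∂μ) atTop
    (𝓝 (∫ x, torusAverage F (𝒯.J x) * 𝒯.h x ∂μ))

theorem integrable_comp_flow {F : S1 × S1 × Y → ℂ} (hF : Integrable F (torusProd ν)) (s : ℝ) :
    Integrable (fun x => F (𝒯.flow s x)) μ :=
  (integrable_comp_of_map_le (𝒯.aemeasurable_flow s) 𝒯.C_ne_top (𝒯.map_le s) hF).1

theorem integrable_torusAverage_comp [SFinite ν] {F : S1 × S1 × Y → ℂ}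
    (hF : Integrable F (torusProd ν)) : Integrable (fun x => torusAverage F (𝒯.J x)) μ :=
  (integrable_comp_of_map_le 𝒯.aem_J
    (ENNReal.mul_ne_top 𝒯.C_ne_top (by finiteness)) 𝒯.map_J_le (integrable_torusAverage hF).1).1

theorem torusAverage_sub_ae [SFinite ν] {F G : S1 × S1 × Y → ℂ}
    (hF : Integrable F (torusProd ν)) (hG : Integrable G (torusProd ν)) :
    torusAverage (fun z => F z - G z) =ᵐ[ν] fun y => torusAverage F y - torusAverage G y := by
  have hmp := measurePreserving_prodAssoc (volume : Measure S1) (volume : Measure S1) ν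
  have h1 : Integrable (fun z : (S1 × S1) × Y => F (z.1.1, z.1.2, z.2))
      ((volume : Measure (S1 × S1)).prod ν) := hmp.integrable_comp_of_integrable hF
  have h2 : Integrable (fun z : (S1 × S1) × Y => G (z.1.1, z.1.2, z.2))
      ((volume : Measure (S1 × S1)).prod ν) := hmp.integrable_comp_of_integrable hG
  filter_upwards [h1.prod_left_ae, h2.prod_left_ae] with y h1 h2
  rw [torusAverage, torusAverage, torusAverage, integral_sub h1 h2, mul_sub]

theorem aemeas_ae_J [SFinite ν] {p : Y → Prop} (hp : ∀ᵐ y ∂ν, p y) : ∀ᵐ x ∂μ, p (𝒯.J x) := by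
  apply ae_of_ae_map 𝒯.aem_J
  have : μ.map 𝒯.J ≪ ν := (Measure.absolutelyContinuous_of_le 𝒯.map_J_le).trans
    Measure.smul_absolutelyContinuous
  exact this.ae_le hp

/-- `Mixes` is closed under approximation in `L¹`. -/
theorem mixes_of_approx [SFinite ν] {F : S1 × S1 × Y → ℂ} (hF : Integrable F (torusProd ν))
    (h : ∀ ε > 0, ∃ G, Integrable G (torusProd ν) ∧ 𝒯.Mixes G ∧
      ∫ z, ‖F z - G z‖ ∂torusProd ν ≤ ε) : 𝒯.Mixes F := by
  -- Both the observable at time `s` and the limiting one are Lipschitz in `F` for the `L¹` norm,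
  -- with constants `A` and `B` independent of `s`. The summand 1 in each only makes it positive.
  obtain ⟨A, hA0, hA⟩ : ∃ A > 0, ∀ G, Integrable G (torusProd ν) → ∀ s : ℝ,
      ‖∫ x, F (𝒯.flow s x) * 𝒯.h x ∂μ - ∫ x, G (𝒯.flow s x) * 𝒯.h x ∂μ‖ ≤
        A * ∫ z, ‖F z - G z‖ ∂torusProd ν := by
    refine ⟨|𝒯.D| * 𝒯.C.toReal + 1, by positivity, fun G hG s => ?_⟩
    have h1 := integrable_comp_of_map_le (𝒯.aemeasurable_flow s) 𝒯.C_ne_top (𝒯.map_le s)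
      (hF.sub hG)
    have h2 := 𝒯.norm_integral_weight_mul_le h1.1
    rw [← integral_sub (𝒯.integrable_weight_mul (𝒯.integrable_comp_flow hF s))
      (𝒯.integrable_weight_mul (𝒯.integrable_comp_flow hG s))]
    simp_rw [← sub_mul]
    refine h2.trans ((mul_le_mul_of_nonneg_left h1.2 (abs_nonneg _)).trans ?_)
    rw [← mul_assoc]
    apply mul_le_mul_of_nonneg_right _ (integral_nonneg fun _ => norm_nonneg _)
    linarith
  obtain ⟨B, hB0, hB⟩ : ∃ B > 0, ∀ G, Integrable G (torusProd ν) →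
      ‖∫ x, torusAverage F (𝒯.J x) * 𝒯.h x ∂μ - ∫ x, torusAverage G (𝒯.J x) * 𝒯.h x ∂μ‖ ≤
        B * ∫ z, ‖F z - G z‖ ∂torusProd ν := by
    refine ⟨|𝒯.D| * ((𝒯.C * (ENNReal.ofReal (2 * Real.pi)) ^ 2).toReal *
      (1 / (2 * Real.pi) ^ 2)) + 1, by positivity, fun G hG => ?_⟩
    have h0 := integrable_torusAverage (hF.sub hG)
    have h1 := integrable_comp_of_map_le 𝒯.aem_J
      (ENNReal.mul_ne_top 𝒯.C_ne_top (by finiteness)) 𝒯.map_J_le h0.1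
    have h2 := 𝒯.norm_integral_weight_mul_le h1.1
    rw [← integral_sub (𝒯.integrable_weight_mul (𝒯.integrable_torusAverage_comp hF))
      (𝒯.integrable_weight_mul (𝒯.integrable_torusAverage_comp hG))]
    have h3 : ∫ x, torusAverage F (𝒯.J x) * 𝒯.h x - torusAverage G (𝒯.J x) * 𝒯.h x ∂μ =
        ∫ x, torusAverage (F - G) (𝒯.J x) * 𝒯.h x ∂μ := by
      apply integral_congr_ae
      filter_upwards [𝒯.aemeas_ae_J (torusAverage_sub_ae hF hG)] with x hx
      rw [← sub_mul, ← hx]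
      rfl
    rw [h3]
    refine h2.trans ((mul_le_mul_of_nonneg_left (h1.2.trans
      (mul_le_mul_of_nonneg_left h0.2 ENNReal.toReal_nonneg)) (abs_nonneg _)).trans ?_)
    rw [← mul_assoc, ← mul_assoc, mul_assoc |𝒯.D|]
    apply mul_le_mul_of_nonneg_right _ (integral_nonneg fun _ => norm_nonneg _)
    linarith
  rw [Mixes, Metric.tendsto_nhds]
  intro ε hε
  obtain ⟨G, hG, hGm, hFG⟩ := h (ε / (3 * (A + B))) (by positivity)
  filter_upwards [Metric.tendsto_nhds.1 hGm (ε / 3) (by positivity)] with s hs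
  have e1 := hA G hG s
  have e2 := hB G hG
  rw [← dist_eq_norm] at e1 e2
  rw [dist_comm] at e2
  have e3 : (A + B) * ∫ z, ‖F z - G z‖ ∂torusProd ν ≤ ε / 3 := by
    calc _ ≤ (A + B) * (ε / (3 * (A + B))) := by gcongr
      _ = _ := by field_simp
  have e4 := dist_triangle4 (∫ x, F (𝒯.flow s x) * 𝒯.h x ∂μ) (∫ x, G (𝒯.flow s x) * 𝒯.h x ∂μ)
    (∫ x, torusAverage G (𝒯.J x) * 𝒯.h x ∂μ) (∫ x, torusAverage F (𝒯.J x) * 𝒯.h x ∂μ)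
  linarith

theorem Mixes.congr_ae [SFinite ν] {F G : S1 × S1 × Y → ℂ} (hF : Integrable F (torusProd ν))
    (hFG : F =ᵐ[torusProd ν] G) (hm : 𝒯.Mixes F) : 𝒯.Mixes G := by
  refine 𝒯.mixes_of_approx (hF.congr hFG) fun ε hε => ⟨F, hF, hm, ?_⟩
  have : ∫ z, ‖G z - F z‖ ∂torusProd ν = 0 := by
    rw [← integral_zero (S1 × S1 × Y) ℝ (μ := torusProd ν)]
    apply integral_congr_ae
    filter_upwards [hFG] with z hz
    rw [hz, sub_self, norm_zero]
  rw [this]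
  exact hε.le

theorem Mixes.sub [SFinite ν] {F G : S1 × S1 × Y → ℂ} (hF : Integrable F (torusProd ν))
    (hG : Integrable G (torusProd ν)) (hmF : 𝒯.Mixes F) (hmG : 𝒯.Mixes G) :
    𝒯.Mixes (fun z => F z - G z) := by
  have h1 := Tendsto.sub hmF hmG
  have h3 : ∫ x, torusAverage F (𝒯.J x) * 𝒯.h x ∂μ - ∫ x, torusAverage G (𝒯.J x) * 𝒯.h x ∂μ =
      ∫ x, torusAverage (fun z => F z - G z) (𝒯.J x) * 𝒯.h x ∂μ := by
    rw [← integral_sub (𝒯.integrable_weight_mul (𝒯.integrable_torusAverage_comp hF))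
      (𝒯.integrable_weight_mul (𝒯.integrable_torusAverage_comp hG))]
    apply integral_congr_ae
    filter_upwards [𝒯.aemeas_ae_J (torusAverage_sub_ae hF hG)] with x hx
    rw [← sub_mul, ← hx]
  rw [h3] at h1
  refine h1.congr fun s => ?_
  rw [← integral_sub (𝒯.integrable_weight_mul (𝒯.integrable_comp_flow hF s))
    (𝒯.integrable_weight_mul (𝒯.integrable_comp_flow hG s))]
  simp_rw [← sub_mul]

theorem Mixes.const_mul {F : S1 × S1 × Y → ℂ} (c : ℂ) (hmF : 𝒯.Mixes F) :
    𝒯.Mixes (fun z => c * F z) := by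
  have h1 := Tendsto.const_mul c hmF
  rw [← integral_const_mul] at h1
  have h2 : ∀ x, torusAverage (fun z => c * F z) (𝒯.J x) * 𝒯.h x =
      c * (torusAverage F (𝒯.J x) * 𝒯.h x) := by
    intro x
    rw [torusAverage, torusAverage, integral_const_mul]
    ring
  rw [Mixes]
  simp_rw [h2]
  refine h1.congr fun s => ?_
  rw [← integral_const_mul]
  simp_rw [mul_assoc]

theorem Mixes.add [SFinite ν] {F G : S1 × S1 × Y → ℂ} (hF : Integrable F (torusProd ν))
    (hG : Integrable G (torusProd ν)) (hmF : 𝒯.Mixes F) (hmG : 𝒯.Mixes G) :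
    𝒯.Mixes (fun z => F z + G z) := by
  have := Mixes.sub 𝒯 hF (hG.const_mul (-1)) hmF (hmG.const_mul 𝒯 (-1))
  refine this.congr_ae 𝒯 (hF.sub (hG.const_mul (-1))) (ae_of_all _ fun z => ?_)
  change F z - -1 * G z = F z + G z
  ring

/-- Since `ν` and the torus have finite mass, bounded pointwise convergence implies convergence in
`L¹`, to which `mixes_of_approx` applies. -/
theorem mixes_of_tendsto [IsFiniteMeasure ν] {F : S1 × S1 × Y → ℂ} {G : ℕ → S1 × S1 × Y → ℂ}
    {c : ℝ} (hGm : ∀ n, Measurable (G n)) (hc : ∀ n z, ‖G n z‖ ≤ c)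
    (hlim : ∀ z, Tendsto (fun n => G n z) atTop (𝓝 (F z))) (hm : ∀ n, 𝒯.Mixes (G n)) :
    𝒯.Mixes F := by
  have hGi : ∀ n, Integrable (G n) (torusProd ν) := fun n =>
    Integrable.of_bound (hGm n).aestronglyMeasurable c (ae_of_all _ (hc n))
  have hFm : Measurable F := measurable_of_tendsto_metrizable hGm (tendsto_pi_nhds.2 hlim)
  have hFc : ∀ z, ‖F z‖ ≤ c := fun z =>
    le_of_tendsto (hlim z).norm (Eventually.of_forall fun n => hc n z)
  refine 𝒯.mixes_of_approx (Integrable.of_bound hFm.aestronglyMeasurable c (ae_of_all _ hFc))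
    fun ε hε => ?_
  have : Tendsto (fun n => ∫ z, ‖F z - G n z‖ ∂torusProd ν) atTop (𝓝 0) := by
    rw [← integral_zero (S1 × S1 × Y) ℝ (μ := torusProd ν)]
    apply tendsto_integral_of_dominated_convergence (fun _ => c + c)
    · exact fun n => (hFm.sub (hGm n)).norm.aestronglyMeasurable
    · exact integrable_const _
    · intro n
      refine ae_of_all _ fun z => ?_
      rw [norm_norm]
      exact (norm_sub_le _ _).trans (add_le_add (hFc z) (hc n z))
    · refine ae_of_all _ fun z => ?_
      have := ((hlim z).const_sub (F z)).norm
      simpa using this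
  obtain ⟨n, hn⟩ := ((tendsto_order.1 this).2 ε hε).exists
  exact ⟨G n, hGi n, hm n, hn.le⟩

end TorusFlow

/-! ### From characters to integrable functions -/

/-- A translation by half a period of the character changes its sign. -/
theorem integral_fourier_eq_zero {n : ℤ} (hn : n ≠ 0) : ∫ q : S1, fourier n q = 0 :=
  integral_eq_zero_of_add_right_eq_neg
    (fourier_add_half_inv_index hn Real.two_pi_pos)

theorem fourier_add_coe (n : ℤ) (q : S1) (x : ℝ) :
    fourier n (q + (x : S1)) = Complex.exp (Complex.I * (n * x : ℝ)) * fourier n q := by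
  have h1 : fourier n (q + (x : S1)) = fourier n q * fourier n (x : S1) := by
    simp only [fourier_apply, smul_add, AddCircle.toCircle_add, Circle.coe_mul]
  rw [h1, fourier_coe_apply, mul_comm]
  congr 2
  have : (Real.pi : ℂ) ≠ 0 := by exact_mod_cast Real.pi_ne_zero
  push_cast
  field_simp

namespace TorusFlow

variable {X Y : Type*} [MeasurableSpace X] [MeasurableSpace Y] {μ : Measure X} {ν : Measure Y}
  (𝒯 : TorusFlow μ ν)

/-- The function `u(q₁) v(q₂) 1_S(y)`. -/
noncomputable def tensor (u v : S1 → ℂ) (S : Set Y) (z : S1 × S1 × Y) : ℂ :=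
  u z.1 * (v z.2.1 * S.indicator (fun _ => 1) z.2.2)

theorem measurable_tensor {u v : S1 → ℂ} (hu : Measurable u) (hv : Measurable v) {S : Set Y}
    (hS : MeasurableSet S) : Measurable (tensor u v S) := by
  have : Measurable (S.indicator fun _ => (1 : ℂ)) := measurable_const.indicator hS
  unfold tensor
  fun_prop

theorem norm_tensor_le {Z : Type*} {u v : S1 → ℂ} {S : Set Z} {a b : ℝ} (hu : ∀ q, ‖u q‖ ≤ a)
    (hv : ∀ q, ‖v q‖ ≤ b) (z : S1 × S1 × Z) : ‖tensor u v S z‖ ≤ a * b := by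
  have ha : 0 ≤ a := (norm_nonneg _).trans (hu 0)
  have hb : 0 ≤ b := (norm_nonneg _).trans (hv 0)
  rw [tensor, norm_mul, norm_mul]
  have h1 : ‖S.indicator (fun _ => (1 : ℂ)) z.2.2‖ ≤ 1 := by
    by_cases h : z.2.2 ∈ S <;> simp [h]
  calc _ ≤ a * (b * 1) := by
        gcongr
        · exact hu _
        · exact hv _
    _ = _ := by ring

theorem integrable_tensor [IsFiniteMeasure ν] (u v : C(S1, ℂ)) {S : Set Y}
    (hS : MeasurableSet S) : Integrable (tensor u v S) (torusProd ν) :=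
  Integrable.of_bound (measurable_tensor u.continuous.measurable v.continuous.measurable
    hS).aestronglyMeasurable _ (ae_of_all _ (norm_tensor_le u.norm_coe_le_norm v.norm_coe_le_norm))

/-- The heart of the mixing argument. At time `s` the tensor equals its value at time zero times
`e^{is(k w₁ + l w₂)}`; for `(k,l) ≠ 0` the torus average vanishes and Riemann–Lebesgue applies with
`map_ac`, while for `(k,l) = 0` the observable is constant in `s`. -/
theorem mixes_fourier [IsFiniteMeasure μ] (k l : ℤ) {S : Set Y} (hS : MeasurableSet S) :
    𝒯.Mixes (tensor (fourier k) (fourier l) S) := by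
  have hav : ∀ y, torusAverage (tensor (fourier k) (fourier l) S) y =
      (1 / (2 * Real.pi) ^ 2 : ℝ) * ((∫ q : S1, fourier k q) * ((∫ q : S1, fourier l q) *
        S.indicator (fun _ => 1) y)) := by
    intro y
    rw [torusAverage]
    congr 1
    rw [← integral_mul_const _ (fun q : S1 => (fourier l q : ℂ)), Measure.volume_eq_prod,
      ← integral_prod_mul (fun q : S1 => (fourier k q : ℂ))]
    rfl
  by_cases hkl : k ≠ 0 ∨ l ≠ 0
  · have h0 : ∀ y, torusAverage (tensor (fourier k) (fourier l) S) y = 0 := by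
      intro y
      rw [hav]
      rcases hkl with h | h <;> rw [integral_fourier_eq_zero h] <;> simp
    rw [Mixes]
    simp only [h0, zero_mul, integral_zero]
    have hθ : AEMeasurable (fun x => k * 𝒯.w₁ x + l * 𝒯.w₂ x) μ :=
      (𝒯.aem_w₁.const_mul _).add (𝒯.aem_w₂.const_mul _)
    have hT : AEMeasurable (fun x => tensor (fourier k) (fourier l) S (𝒯.q₁ x, 𝒯.q₂ x, 𝒯.J x)) μ :=
      (measurable_tensor (by fun_prop) (by fun_prop) hS).comp_aemeasurable
        (𝒯.aem_q₁.prodMk (𝒯.aem_q₂.prodMk 𝒯.aem_J))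
    have hTi : Integrable (fun x => tensor (fourier k) (fourier l) S (𝒯.q₁ x, 𝒯.q₂ x, 𝒯.J x)) μ :=
      Integrable.of_bound hT.aestronglyMeasurable _ (ae_of_all _ fun x =>
        norm_tensor_le (fourier k).norm_coe_le_norm (fourier l).norm_coe_le_norm _)
    refine (tendsto_integral_exp_mul_atTop hθ (𝒯.map_ac k l hkl)
      (𝒯.integrable_weight_mul hTi)).congr fun s => ?_
    congr 1
    ext x
    simp only [tensor, flow, fourier_add_coe]
    rw [show Complex.I * ((s * (k * 𝒯.w₁ x + l * 𝒯.w₂ x) : ℝ) : ℂ) =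
      Complex.I * ((k * (s * 𝒯.w₁ x) : ℝ) : ℂ) + Complex.I * ((l * (s * 𝒯.w₂ x) : ℝ) : ℂ) by
        push_cast; ring, Complex.exp_add]
    ring
  · push Not at hkl
    obtain ⟨rfl, rfl⟩ := hkl
    rw [Mixes]
    refine tendsto_const_nhds.congr fun s => ?_
    congr 1
    ext x
    rw [hav]
    have hc : ∫ q : S1, fourier 0 q = (2 * Real.pi : ℝ) := by
      have : (fun q : S1 => (fourier 0 q : ℂ)) = fun _ => 1 := by ext q; exact fourier_zero
      rw [this, integral_const, Measure.real, volume_circle,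
        ENNReal.toReal_ofReal Real.two_pi_pos.le]
      simp
    rw [hc, tensor, fourier_zero, fourier_zero]
    have : (Real.pi : ℂ) ≠ 0 := by exact_mod_cast Real.pi_ne_zero
    simp only [flow]
    push_cast
    field_simp

/-- Trigonometric polynomials are uniformly dense in `C(S1, ℂ)`. The map `L` stays abstract so that
the density argument can be run once for each of the two angles. -/
theorem mixes_of_mixes_fourier [IsFiniteMeasure ν]
    {L : C(S1, ℂ) → C(S1, ℂ) → S1 × S1 × Y → ℂ}
    (hLadd : ∀ u u' v z, L (u + u') v z = L u v z + L u' v z)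
    (hLsmul : ∀ (c : ℂ) u v z, L (c • u) v z = c * L u v z)
    (hLm : ∀ u v, Integrable (L u v) (torusProd ν))
    (hLb : ∀ u v z, ‖L u v z‖ ≤ ‖u‖ * ‖v‖) (v : C(S1, ℂ))
    (hf : ∀ k : ℤ, 𝒯.Mixes (L (fourier k) v)) (u : C(S1, ℂ)) : 𝒯.Mixes (L u v) := by
  have hspan : ∀ u ∈ Submodule.span ℂ (range (fourier : ℤ → C(S1, ℂ))), 𝒯.Mixes (L u v) := by
    intro u hu
    induction hu using Submodule.span_induction with
    | mem u hu => obtain ⟨k, rfl⟩ := hu; exact hf k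
    | zero =>
      have : L 0 v = fun z => 0 * L 0 v z := by
        ext z
        have := hLsmul 0 0 v z
        rwa [zero_smul] at this
      rw [this]
      have := (hf 0).const_mul 𝒯 0
      simpa only [zero_mul] using this
    | add u u' _ _ h h' =>
      have : L (u + u') v = fun z => L u v z + L u' v z := by ext z; exact hLadd _ _ _ _
      rw [this]
      exact h.add 𝒯 (hLm _ _) (hLm _ _) h'
    | smul c u _ h =>
      have : L (c • u) v = fun z => c * L u v z := by ext z; exact hLsmul _ _ _ _
      rw [this]
      exact h.const_mul 𝒯 c
  refine 𝒯.mixes_of_approx (hLm _ _) fun ε hε => ?_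
  set V : ℝ := (torusProd ν).real univ with hV
  have hV0 : 0 ≤ V := measureReal_nonneg
  have hu : u ∈ (Submodule.span ℂ (range (fourier : ℤ → C(S1, ℂ)))).topologicalClosure := by
    rw [span_fourier_closure_eq_top]; trivial
  -- The tolerance absorbs both `‖v‖` and the total mass `V`; adding 1 to each avoids division by
  -- zero.
  obtain ⟨u', hu', hd⟩ := Metric.mem_closure_iff.1 hu (ε / ((‖v‖ + 1) * (V + 1))) (by positivity)
  refine ⟨L u' v, hLm _ _, hspan u' hu', ?_⟩
  have h1 : ∀ z, ‖L u v z - L u' v z‖ ≤ ε / ((‖v‖ + 1) * (V + 1)) * ‖v‖ := by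
    intro z
    have h2 : L u v z - L u' v z = L (u - u') v z := by
      have := hLadd (u - u') u' v z
      rw [sub_add_cancel] at this
      rw [this, add_sub_cancel_right]
    rw [h2]
    refine (hLb _ _ _).trans ?_
    rw [dist_eq_norm] at hd
    gcongr
  calc ∫ z, ‖L u v z - L u' v z‖ ∂torusProd ν
      ≤ ∫ z, ε / ((‖v‖ + 1) * (V + 1)) * ‖v‖ ∂torusProd ν :=
        integral_mono ((hLm _ _).sub (hLm _ _)).norm (integrable_const _) h1
    _ = ε * ((V / (V + 1)) * (‖v‖ / (‖v‖ + 1))) := by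
        rw [integral_const, smul_eq_mul, ← hV]
        field_simp
    _ ≤ ε * (1 * 1) := by
        gcongr <;> rw [div_le_one (by positivity)] <;> linarith
    _ = ε := by ring

theorem mixes_tensor [IsFiniteMeasure μ] [IsFiniteMeasure ν] (u v : C(S1, ℂ)) {S : Set Y}
    (hS : MeasurableSet S) : 𝒯.Mixes (tensor u v S) := by
  refine 𝒯.mixes_of_mixes_fourier (L := fun u v => tensor u v S) ?_ ?_
    (fun u v => integrable_tensor u v hS)
    (fun u v => norm_tensor_le u.norm_coe_le_norm v.norm_coe_le_norm) v (fun k => ?_) u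
  · intro u u' v z; simp [tensor, add_mul]
  · intro c u v z; simp [tensor, mul_assoc]
  · refine 𝒯.mixes_of_mixes_fourier (L := fun u v => tensor v u S) ?_ ?_
      (fun u v => integrable_tensor v u hS) ?_ (fourier k) (fun l => ?_) v
    · intro u u' v z; simp [tensor, add_mul, mul_add]
    · intro c u v z; simp [tensor]; ring
    · intro u v z
      exact (norm_tensor_le v.norm_coe_le_norm u.norm_coe_le_norm z).trans_eq (mul_comm _ _)
    · exact 𝒯.mixes_fourier k l hS

/-- The indicator of a closed set is a bounded pointwise limit of continuous functions, so the case
of continuous tensors passes to the limit. -/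
theorem mixes_rectangle [IsFiniteMeasure μ] [IsFiniteMeasure ν] {A B : Set S1} (hA : IsClosed A)
    (hB : IsClosed B) {S : Set Y} (hS : MeasurableSet S) :
    𝒯.Mixes ((A ×ˢ B ×ˢ S).indicator fun _ => 1) := by
  let u : ℕ → C(S1, ℂ) := fun n => ⟨fun q => ((hA.apprSeq n q : ℝ) : ℂ), by fun_prop⟩
  let v : ℕ → C(S1, ℂ) := fun n => ⟨fun q => ((hB.apprSeq n q : ℝ) : ℂ), by fun_prop⟩
  have hu : ∀ n q, ‖u n q‖ ≤ 1 := by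
    intro n q
    simp only [u, ContinuousMap.coe_mk, Complex.norm_real, NNReal.norm_eq]
    exact_mod_cast HasOuterApproxClosed.apprSeq_apply_le_one hA n q
  have hv : ∀ n q, ‖v n q‖ ≤ 1 := by
    intro n q
    simp only [v, ContinuousMap.coe_mk, Complex.norm_real, NNReal.norm_eq]
    exact_mod_cast HasOuterApproxClosed.apprSeq_apply_le_one hB n q
  have hlim : ∀ {A : Set S1} (hA : IsClosed A) (q : S1),
      Tendsto (fun n => ((hA.apprSeq n q : ℝ) : ℂ)) atTop (𝓝 (A.indicator (fun _ => 1) q)) := by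
    intro A hA q
    have h1 := tendsto_pi_nhds.1 (HasOuterApproxClosed.tendsto_apprSeq hA) q
    have h2 := ((Complex.continuous_ofReal.comp NNReal.continuous_coe).tendsto _).comp h1
    have h3 : (A.indicator (fun _ => 1) q : ℂ) =
        (((A.indicator (fun _ => 1) q : NNReal) : ℝ) : ℂ) := by
      by_cases h : q ∈ A <;> simp [h]
    rw [h3]
    exact h2
  refine 𝒯.mixes_of_tendsto (G := fun n => tensor (u n) (v n) S) (c := 1 * 1) (fun n =>
    measurable_tensor (u n).continuous.measurable (v n).continuous.measurable hS)
    (fun n => norm_tensor_le (hu n) (hv n)) (fun z => ?_) (fun n => 𝒯.mixes_tensor _ _ hS)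
  have h1 := (hlim hA z.1).mul ((hlim hB z.2.1).mul_const (S.indicator (fun _ => 1) z.2.2))
  convert! h1 using 2
  by_cases hzA : z.1 ∈ A <;> by_cases hzB : z.2.1 ∈ B <;> by_cases hzS : z.2.2 ∈ S <;>
    simp [hzA, hzB, hzS, indicator, mem_prod]

/-- Dynkin's π-λ argument: products of two closed sets and a measurable set form a π-system
generating the product σ-algebra, and mixing is stable under complements and countable disjoint
unions. -/
theorem mixes_indicator [IsFiniteMeasure μ] [IsFiniteMeasure ν] {A : Set (S1 × S1 × Y)}
    (hA : MeasurableSet A) : 𝒯.Mixes (A.indicator fun _ => 1) := by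
  let CC : Set (Set (S1 × Y)) :=
    image2 (· ×ˢ ·) {s : Set S1 | IsClosed s} {t : Set Y | MeasurableSet t}
  have hcl : MeasurableSpace.generateFrom {s : Set S1 | IsClosed s} =
      (inferInstance : MeasurableSpace S1) := by
    rw [BorelSpace.measurable_eq (α := S1), borel_eq_generateFrom_isClosed]
  have hsp : IsCountablySpanning {s : Set S1 | IsClosed s} :=
    ⟨fun _ => univ, fun _ => isClosed_univ, iUnion_const _⟩
  have hspY : IsCountablySpanning {s : Set Y | MeasurableSet s} :=
    isCountablySpanning_measurableSet
  have hCC : MeasurableSpace.generateFrom CC = (inferInstance : MeasurableSpace (S1 × Y)) :=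
    generateFrom_eq_prod hcl MeasurableSpace.generateFrom_measurableSet hsp hspY
  have hCCpi : IsPiSystem CC := isPiSystem_isClosed.prod MeasurableSpace.isPiSystem_measurableSet
  have hgen := generateFrom_eq_prod hcl hCC hsp (hsp.prod hspY)
  have hone : ∀ {A : Set (S1 × S1 × Y)}, MeasurableSet A →
      Integrable (A.indicator fun _ => (1 : ℂ)) (torusProd ν) := fun hA =>
    (integrable_const 1).indicator hA
  have huniv : 𝒯.Mixes fun _ => 1 := by
    have := 𝒯.mixes_rectangle isClosed_univ isClosed_univ (MeasurableSet.univ (α := Y))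
    simpa using this
  induction A, hA using MeasurableSpace.induction_on_inter hgen.symm
    (isPiSystem_isClosed.prod hCCpi) with
  | empty =>
    have := huniv.const_mul 𝒯 0
    simpa using this
  | basic t ht =>
    obtain ⟨A, hA, _, ⟨B, hB, S, hS, rfl⟩, rfl⟩ := ht
    exact 𝒯.mixes_rectangle hA hB hS
  | compl t ht ih =>
    have := huniv.sub 𝒯 (integrable_const 1) (hone ht) ih
    convert! this using 2 with z
    by_cases h : z ∈ t <;> simp [h]
  | iUnion f hd hf ih =>
    -- Finite disjoint unions are handled by additivity; the countable union is then a bounded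
    -- pointwise limit.
    have hfin : ∀ n, 𝒯.Mixes ((⋃ i ∈ Finset.range n, f i).indicator fun _ => (1 : ℂ)) := by
      intro n
      induction n with
      | zero =>
        have := huniv.const_mul 𝒯 0
        simpa using this
      | succ n ihn =>
        have := ihn.add 𝒯 (hone (Finset.measurableSet_biUnion _ fun i _ => hf i)) (hone (hf n))
          (ih n)
        convert! this using 2 with z
        by_cases h : z ∈ f n
        · have h2 : z ∉ ⋃ i ∈ Finset.range n, f i := by
            simp only [mem_iUnion, not_exists, Finset.mem_range]
            intro i hi hz
            exact (hd hi.ne).le_bot ⟨hz, h⟩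
          have h3 : z ∈ ⋃ i ∈ Finset.range (n + 1), f i := by
            simp only [mem_iUnion, Finset.mem_range]
            exact ⟨n, by omega, h⟩
          rw [indicator_of_mem h3, indicator_of_notMem h2, indicator_of_mem h, zero_add]
        · by_cases h2 : z ∈ ⋃ i ∈ Finset.range n, f i
          · have h3 : z ∈ ⋃ i ∈ Finset.range (n + 1), f i := by
              simp only [mem_iUnion, Finset.mem_range] at h2 ⊢
              obtain ⟨i, hi, hz⟩ := h2
              exact ⟨i, by omega, hz⟩
            rw [indicator_of_mem h3, indicator_of_mem h2, indicator_of_notMem h, add_zero]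
          · have h3 : z ∉ ⋃ i ∈ Finset.range (n + 1), f i := by
              simp only [mem_iUnion, Finset.mem_range, not_exists] at h2 ⊢
              intro i hi hz
              rcases Nat.lt_succ_iff_lt_or_eq.1 hi with h4 | rfl
              · exact h2 i h4 hz
              · exact h hz
            rw [indicator_of_notMem h3, indicator_of_notMem h2, indicator_of_notMem h, add_zero]
    refine 𝒯.mixes_of_tendsto (c := 1) (fun n => measurable_const.indicator
      (Finset.measurableSet_biUnion _ fun i _ => hf i)) (fun n z => ?_) (fun z => ?_) hfin
    · by_cases h : z ∈ ⋃ i ∈ Finset.range n, f i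
      · rw [indicator_of_mem h]; simp
      · rw [indicator_of_notMem h]; simp
    · by_cases h : z ∈ ⋃ i, f i
      · rw [indicator_of_mem h]
        obtain ⟨i, hi⟩ := mem_iUnion.1 h
        refine tendsto_const_nhds.congr' ?_
        filter_upwards [eventually_gt_atTop i] with n hn
        rw [indicator_of_mem]
        simp only [mem_iUnion, Finset.mem_range]
        exact ⟨i, hn, hi⟩
      · rw [indicator_of_notMem h]
        refine tendsto_const_nhds.congr fun n => ?_
        rw [indicator_of_notMem]
        intro h'
        simp only [mem_iUnion, Finset.mem_range] at h'
        obtain ⟨i, _, hi⟩ := h'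
        exact h (mem_iUnion.2 ⟨i, hi⟩)

/-- Mixing: every integrable `F` converges weakly to its torus average. -/
theorem mixes_of_integrable [IsFiniteMeasure μ] [IsFiniteMeasure ν] {F : S1 × S1 × Y → ℂ}
    (hF : Integrable F (torusProd ν)) : 𝒯.Mixes F := by
  refine Integrable.induction (P := 𝒯.Mixes) ?_ ?_ ?_ ?_ hF
  · intro c s hs _
    have := (𝒯.mixes_indicator hs).const_mul 𝒯 c
    convert! this using 2 with z
    by_cases h : z ∈ s <;> simp [h]
  · intro f g _ hf hg hmf hmg
    exact hmf.add 𝒯 hf hg hmg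
  · rw [← isSeqClosed_iff_isClosed]
    intro f g hf hfg
    refine 𝒯.mixes_of_approx (L1.integrable_coeFn g) fun ε hε => ?_
    have hfg' : Tendsto (fun n => ∫ x, ‖g x - f n x‖ ∂torusProd ν) atTop (𝓝 0) := by
      have := tendsto_iff_norm_sub_tendsto_zero.1 hfg
      refine this.congr fun n => ?_
      rw [L1.norm_eq_integral_norm]
      refine integral_congr_ae ?_
      filter_upwards [Lp.coeFn_sub (f n) g] with x hx
      rw [hx, norm_sub_rev]; rfl
    obtain ⟨n, hn⟩ := ((tendsto_order.1 hfg').2 ε hε).exists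
    exact ⟨f n, L1.integrable_coeFn _, hf n, hn.le⟩
  · intro f g hfg hf hm
    exact hm.congr_ae 𝒯 hf hfg

end TorusFlow

/-! ### Algebra of the metric and of the radial polynomial -/

section Algebra

variable {M a m E L r : ℝ}

theorem le_rH (M a : ℝ) : M ≤ rH M a := by
  unfold rH; linarith [Real.sqrt_nonneg (M ^ 2 - a ^ 2)]

theorem Del_eq (M a r : ℝ) : Del M a r = (r - M) ^ 2 - (M ^ 2 - a ^ 2) := by
  unfold Del; ring

theorem Del_pos (ha : |a| ≤ M) (hr : rH M a < r) : 0 < Del M a r := by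
  have hM : 0 ≤ M := (abs_nonneg a).trans ha
  have h1 : 0 ≤ M ^ 2 - a ^ 2 := by
    have := sq_le_sq' (by linarith [abs_nonneg a]) ha
    rw [sq_abs] at this
    linarith
  have h2 := Real.sq_sqrt h1
  have h3 := Real.sqrt_nonneg (M ^ 2 - a ^ 2)
  rw [Del_eq]
  unfold rH at hr
  nlinarith

theorem Del_le_Del {s : ℝ} (hr : rH M a < r) (hs : r ≤ s) : Del M a r ≤ Del M a s := by
  have := le_rH M a
  rw [Del_eq, Del_eq]
  nlinarith

theorem R_quartic (M a m E L r : ℝ) : R M a m E L r = (E ^ 2 - m ^ 2) * r ^ 4 +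
    2 * M * m ^ 2 * r ^ 3 +
    (-(2 * a * E * (L - a * E)) - (L - a * E) ^ 2 - a ^ 2 * m ^ 2) * r ^ 2 +
    2 * M * (L - a * E) ^ 2 * r := by
  unfold R Del; ring

theorem metric_inv (hM : 0 < M) (ha : |a| ≤ M) (hr : rH M a < r) :
    (metric M a r)⁻¹ = !![-((r ^ 2 + a ^ 2) ^ 2 - a ^ 2 * Del M a r) / (Del M a r * r ^ 2),
      -(2 * M * a * r) / (Del M a r * r ^ 2), 0;
      -(2 * M * a * r) / (Del M a r * r ^ 2), (Del M a r - a ^ 2) / (Del M a r * r ^ 2), 0;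
      0, 0, Del M a r / r ^ 2] := by
  have hD := (Del_pos ha hr).ne'
  have hr0 : r ≠ 0 := (hM.trans_le (le_rH M a) |>.trans hr).ne'
  apply Matrix.inv_eq_right_inv
  have hDd : Del M a r = r ^ 2 - 2 * M * r + a ^ 2 := rfl
  ext i j
  fin_cases i <;> fin_cases j <;>
    simp [metric, Matrix.mul_apply, Fin.sum_univ_three] <;> field_simp <;>
    (try rw [hDd]) <;> ring

/-- `-2H r² Δ = P² - Δ L̂² - Δ² p_r²`. -/
theorem hamiltonian_eq (hM : 0 < M) (ha : |a| ≤ M) (hr : rH M a < r) (pt pphi pr : ℝ) :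
    -2 * hamiltonian M a r pt pphi pr * (r ^ 2 * Del M a r) =
      (-pt * r ^ 2 - a * (pphi - a * -pt)) ^ 2 - Del M a r * (pphi - a * -pt) ^ 2 -
        (Del M a r * pr) ^ 2 := by
  have hD := (Del_pos ha hr).ne'
  have hr0 : r ≠ 0 := (hM.trans_le (le_rH M a) |>.trans hr).ne'
  rw [hamiltonian, metric_inv hM ha hr]
  simp [dotProduct, Matrix.mulVec, Fin.sum_univ_three]
  have hDd : Del M a r = r ^ 2 - 2 * M * r + a ^ 2 := rfl
  field_simp
  rw [hDd]
  ring

theorem mass_sq (h : hamiltonian M a r m E L < 0) :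
    mass M a r m E L ^ 2 = -2 * hamiltonian M a r m E L :=
  Real.sq_sqrt (by linarith)

theorem R_mass_eq (hM : 0 < M) (ha : |a| ≤ M) (hr : rH M a < r) {pt pphi pr : ℝ}
    (hH : hamiltonian M a r pt pphi pr < 0) :
    R M a (mass M a r pt pphi pr) (-pt) pphi r = (Del M a r * pr) ^ 2 := by
  have h := hamiltonian_eq hM ha hr pt pphi pr
  rw [← mass_sq hH] at h
  unfold R
  linear_combination -h

theorem eq_zero_of_three_roots {α β γ x y z : ℝ} (hxy : x ≠ y) (hxz : x ≠ z) (hyz : y ≠ z)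
    (hx : α * x ^ 2 + β * x + γ = 0) (hy : α * y ^ 2 + β * y + γ = 0)
    (hz : α * z ^ 2 + β * z + γ = 0) : α = 0 ∧ β = 0 ∧ γ = 0 := by
  have h1 : α * (x + y) + β = 0 := by
    apply mul_left_cancel₀ (sub_ne_zero.2 hxy); linear_combination hx - hy
  have h2 : α * (x + z) + β = 0 := by
    apply mul_left_cancel₀ (sub_ne_zero.2 hxz); linear_combination hx - hz
  have h3 : α = 0 := by
    apply mul_left_cancel₀ (sub_ne_zero.2 hyz); linear_combination h1 - h2
  subst h3
  have h4 : β = 0 := by linarith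
  subst h4
  exact ⟨rfl, rfl, by linarith⟩

/-- `R` is `r` times a cubic with leading coefficient `E² - m²`. The difference between this cubic
and the proposed product has degree at most two and three distinct zeros. -/
theorem R_factor {x y z : ℝ} (hx0 : x ≠ 0) (hy0 : y ≠ 0) (hz0 : z ≠ 0) (hxy : x ≠ y) (hxz : x ≠ z)
    (hyz : y ≠ z) (hx : R M a m E L x = 0) (hy : R M a m E L y = 0) (hz : R M a m E L z = 0)
    (r : ℝ) : R M a m E L r = (m ^ 2 - E ^ 2) * r * (r - x) * (r - y) * (z - r) := by
  rw [R_quartic] at hx hy hz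
  set b := 2 * M * m ^ 2
  set c := -(2 * a * E * (L - a * E)) - (L - a * E) ^ 2 - a ^ 2 * m ^ 2
  set d := 2 * M * (L - a * E) ^ 2
  have key := eq_zero_of_three_roots (α := b - (m ^ 2 - E ^ 2) * (x + y + z))
    (β := c + (m ^ 2 - E ^ 2) * (x * y + x * z + y * z)) (γ := d - (m ^ 2 - E ^ 2) * (x * y * z))
    hxy hxz hyz
    (by apply mul_left_cancel₀ hx0; linear_combination hx)
    (by apply mul_left_cancel₀ hy0; linear_combination hy)
    (by apply mul_left_cancel₀ hz0; linear_combination hz)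
  obtain ⟨h1, h2, h3⟩ := key
  rw [R_quartic]
  linear_combination r ^ 3 * h1 + r ^ 2 * h2 + r * h3

/-- The expression is monotone in `r > 0`, so future-directedness on the whole interval reduces to
two strict inequalities, an open condition on the constants of motion. -/
theorem future_of_endpoints {r₁ r₂ c : ℝ} (h₀ : 0 < r₁) (h₁ : 0 < E * r₁ ^ 2 - c)
    (h₂ : 0 < E * r₂ ^ 2 - c) (hr : r ∈ Icc r₁ r₂) : 0 < E * r ^ 2 - c := by
  obtain ⟨hr1, hr2⟩ := hr
  rcases le_total 0 E with hE | hE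
  · have : r₁ ^ 2 ≤ r ^ 2 := by gcongr
    nlinarith
  · have h5 : r ^ 2 ≤ r₂ ^ 2 := by
      have : 0 ≤ r := h₀.le.trans hr1
      gcongr
    nlinarith

end Algebra

/-! ### Turning points as smooth functions of the constants of motion -/

/-- The smallest positive root of `R`, from the sum of the roots. -/
noncomputable def rLow (M a m E L : ℝ) : ℝ :=
  2 * M * m ^ 2 / (m ^ 2 - E ^ 2) - rIn M a m E L - rOut M a m E L

/-- The set of constants of motion `(m, E, L)` of bound orbits. -/
def boundSet (M a : ℝ) : Set (ℝ × ℝ × ℝ) := {p | IsBound M a p.1 p.2.1 p.2.2}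

section Roots

variable {M a m E L : ℝ}

theorem rOut_eq_rIn_eq {r₀ r₁ r₂ : ℝ} (hk : E ^ 2 < m ^ 2) (h0 : 0 < r₀) (h1 : r₀ < r₁)
    (h2 : r₁ < r₂)
    (hR : ∀ r, R M a m E L r = (m ^ 2 - E ^ 2) * r * (r - r₀) * (r - r₁) * (r₂ - r)) :
    rOut M a m E L = r₂ ∧ rIn M a m E L = r₁ ∧ rLow M a m E L = r₀ := by
  have hk' : 0 < m ^ 2 - E ^ 2 := by linarith
  have hz : ∀ r, R M a m E L r = 0 ↔ r = 0 ∨ r = r₀ ∨ r = r₁ ∨ r = r₂ := by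
    intro r
    rw [hR]
    simp only [mul_eq_zero, hk'.ne', false_or, sub_eq_zero, or_assoc]
    constructor <;> rintro (h | h | h | h) <;> simp [h]
  have ho : rOut M a m E L = r₂ := by
    apply IsGreatest.csSup_eq
    refine ⟨(hz r₂).2 (by simp), fun r hr => ?_⟩
    rcases (hz r).1 hr with h | h | h | h <;> rw [h] <;> linarith
  have hi : rIn M a m E L = r₁ := by
    apply IsGreatest.csSup_eq
    rw [ho]
    refine ⟨⟨h2, (hz r₁).2 (by simp)⟩, fun r hr => ?_⟩
    rcases (hz r).1 hr.2 with h | h | h | h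
    · rw [h]; linarith
    · rw [h]; linarith
    · rw [h]
    · exact absurd hr.1 (by rw [h]; exact lt_irrefl _)
  refine ⟨ho, hi, ?_⟩
  rw [rLow, ho, hi]
  -- The odd part of both sides at 1 and 2 isolates the coefficient of `r³`, which is the sum of the
  -- roots up to the factor `m² - E²`.
  have e1 := hR 1
  have e2 := hR (-1)
  have e3 := hR 2
  have e4 := hR (-2)
  rw [R_quartic] at e1 e2 e3 e4
  have : 2 * M * m ^ 2 = (m ^ 2 - E ^ 2) * (r₀ + r₁ + r₂) := by
    linear_combination (e3 - e4 - 2 * (e1 - e2)) / 12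
  rw [this]
  field_simp
  ring

/-- The defining properties of bound orbits, in terms of the turning points. -/
theorem IsBound.spec (h : IsBound M a m E L) : 0 < m ∧ E ^ 2 < m ^ 2 ∧ 0 < rLow M a m E L ∧
    rLow M a m E L < rIn M a m E L ∧ rIn M a m E L < rOut M a m E L ∧ rH M a < rIn M a m E L ∧
    (∀ r, R M a m E L r = (m ^ 2 - E ^ 2) * r * (r - rLow M a m E L) * (r - rIn M a m E L) *
      (rOut M a m E L - r)) ∧
    ∀ r ∈ Icc (rIn M a m E L) (rOut M a m E L), 0 < E * r ^ 2 - a * (L - a * E) := by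
  obtain ⟨hm, hk, r₀, r₁, r₂, h0, h1, h2, hH, hR, hf⟩ := h
  obtain ⟨e2, e1, e0⟩ := rOut_eq_rIn_eq hk h0 h1 h2 hR
  rw [e2, e1, e0]
  exact ⟨hm, hk, h0, h1, h2, hH, hR, hf⟩

theorem contDiff_R (M a : ℝ) :
    ContDiff ℝ (⊤ : ℕ∞) (fun z : (ℝ × ℝ × ℝ) × ℝ => R M a z.1.1 z.1.2.1 z.1.2.2 z.2) := by
  unfold R Del; fun_prop

theorem exists_root_function {p : ℝ × ℝ × ℝ} {ρ d : ℝ} (h0 : R M a p.1 p.2.1 p.2.2 ρ = 0)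
    (hd : HasDerivAt (R M a p.1 p.2.1 p.2.2) d ρ) (hd0 : d ≠ 0) :
    ∃ g : ℝ × ℝ × ℝ → ℝ, ContDiffAt ℝ (⊤ : ℕ∞) g p ∧ g p = ρ ∧
      ∀ᶠ q in 𝓝 p, R M a q.1 q.2.1 q.2.2 (g q) = 0 := by
  have cdf : ContDiffAt ℝ (⊤ : ℕ∞) (fun z : (ℝ × ℝ × ℝ) × ℝ => R M a z.1.1 z.1.2.1 z.1.2.2 z.2)
    (p, ρ) := (contDiff_R M a).contDiffAt
  have hinv : (fderiv ℝ (fun z : (ℝ × ℝ × ℝ) × ℝ => R M a z.1.1 z.1.2.1 z.1.2.2 z.2) (p, ρ) ∘L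
      .inr ℝ (ℝ × ℝ × ℝ) ℝ).IsInvertible := by
    refine ⟨ContinuousLinearEquiv.unitsEquivAut ℝ (Units.mk0 d hd0), ?_⟩
    ext
    have h1 : HasFDerivAt (R M a p.1 p.2.1 p.2.2) (fderiv ℝ
        (fun z : (ℝ × ℝ × ℝ) × ℝ => R M a z.1.1 z.1.2.1 z.1.2.2 z.2) (p, ρ) ∘L
        .inr ℝ (ℝ × ℝ × ℝ) ℝ) ρ :=
      ((cdf.differentiableAt (by simp)).hasFDerivAt).comp ρ (hasFDerivAt_prodMk_right p ρ)
    have h2 := h1.hasDerivAt.unique hd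
    rw [h2]
    simp
  refine ⟨cdf.implicitFunction (by simp) hinv, cdf.contDiffAt_implicitFunction (by simp) hinv,
    cdf.implicitFunction_apply_self (by simp) hinv, ?_⟩
  filter_upwards [cdf.eventually_apply_implicitFunction (by simp) hinv] with q hq
  rw [hq]
  exact h0

/-- Simple roots persist and move smoothly by the implicit function theorem. All defining conditions
are strict inequalities in these roots, and their order identifies the continued roots with the
suprema that define `rIn` and `rOut`. -/
theorem boundSet_local {p : ℝ × ℝ × ℝ} (hp : p ∈ boundSet M a) :
    boundSet M a ∈ 𝓝 p ∧ ContDiffAt ℝ (⊤ : ℕ∞) (fun q => rIn M a q.1 q.2.1 q.2.2) p ∧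
      ContDiffAt ℝ (⊤ : ℕ∞) (fun q => rOut M a q.1 q.2.1 q.2.2) p := by
  obtain ⟨hm, hk, r₀, r₁, r₂, h0, h1, h2, hH, hR, hf⟩ := hp
  have hk' : 0 < p.1 ^ 2 - p.2.1 ^ 2 := by linarith
  have hder : ∀ ρ, HasDerivAt (R M a p.1 p.2.1 p.2.2) ((p.1 ^ 2 - p.2.1 ^ 2) *
      ((ρ - r₀) * (ρ - r₁) * (r₂ - ρ) + ρ * (ρ - r₁) * (r₂ - ρ) + ρ * (ρ - r₀) * (r₂ - ρ)
        - ρ * (ρ - r₀) * (ρ - r₁))) ρ := by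
    intro ρ
    have : R M a p.1 p.2.1 p.2.2 = fun r =>
      (p.1 ^ 2 - p.2.1 ^ 2) * r * (r - r₀) * (r - r₁) * (r₂ - r) := funext hR
    rw [this]
    have hid := hasDerivAt_id ρ
    have := ((((hid.const_mul (p.1 ^ 2 - p.2.1 ^ 2)).mul (hid.sub_const r₀)).mul
      (hid.sub_const r₁)).mul (hid.const_sub r₂))
    refine this.congr_deriv ?_
    simp only [id, Pi.mul_apply]
    ring
  -- At each root the derivative of `R` is, up to sign, `m² - E²` times the root times its distances
  -- to the two others.
  obtain ⟨g₀, hg0, e0, z0⟩ := exists_root_function (by rw [hR]; ring) (hder r₀) (by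
    have : (p.1 ^ 2 - p.2.1 ^ 2) * (r₀ * ((r₁ - r₀) * (r₂ - r₀))) > 0 :=
      mul_pos hk' (mul_pos h0 (mul_pos (by linarith) (by linarith)))
    intro h
    nlinarith)
  obtain ⟨g₁, hg1, e1, z1⟩ := exists_root_function (by rw [hR]; ring) (hder r₁) (by
    have : (p.1 ^ 2 - p.2.1 ^ 2) * (r₁ * ((r₁ - r₀) * (r₂ - r₁))) > 0 :=
      mul_pos hk' (mul_pos (by linarith) (mul_pos (by linarith) (by linarith)))
    intro h
    nlinarith)
  obtain ⟨g₂, hg2, e2, z2⟩ := exists_root_function (by rw [hR]; ring) (hder r₂) (by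
    have : (p.1 ^ 2 - p.2.1 ^ 2) * (r₂ * ((r₂ - r₀) * (r₂ - r₁))) > 0 :=
      mul_pos hk' (mul_pos (by linarith) (mul_pos (by linarith) (by linarith)))
    intro h
    nlinarith)
  have hr1 : 0 < r₁ := h0.trans h1
  have c0 := hg0.continuousAt
  have c1 := hg1.continuousAt
  have c2 := hg2.continuousAt
  have hev : ∀ᶠ q in 𝓝 p, q ∈ boundSet M a ∧ rIn M a q.1 q.2.1 q.2.2 = g₁ q ∧
      rOut M a q.1 q.2.1 q.2.2 = g₂ q := by
    have f1 : ∀ᶠ q : ℝ × ℝ × ℝ in 𝓝 p, 0 < q.1 :=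
      continuousAt_fst.eventually_const_lt hm
    have f2 : ∀ᶠ q : ℝ × ℝ × ℝ in 𝓝 p, q.2.1 ^ 2 < q.1 ^ 2 :=
      ContinuousAt.eventually_lt (f := fun q : ℝ × ℝ × ℝ => q.2.1 ^ 2)
        (g := fun q : ℝ × ℝ × ℝ => q.1 ^ 2) (by fun_prop) (by fun_prop) hk
    have f3 : ∀ᶠ q in 𝓝 p, 0 < g₀ q := c0.eventually_const_lt (by rw [e0]; exact h0)
    have f4 : ∀ᶠ q in 𝓝 p, g₀ q < g₁ q := c0.eventually_lt c1 (by rw [e0, e1]; exact h1)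
    have f5 : ∀ᶠ q in 𝓝 p, g₁ q < g₂ q := c1.eventually_lt c2 (by rw [e1, e2]; exact h2)
    have f6 : ∀ᶠ q in 𝓝 p, rH M a < g₁ q := c1.eventually_const_lt (by rw [e1]; exact hH)
    have f7 : ∀ᶠ q in 𝓝 p, 0 < q.2.1 * g₁ q ^ 2 - a * (q.2.2 - a * q.2.1) := by
      have hc : ContinuousAt (fun q => q.2.1 * g₁ q ^ 2 - a * (q.2.2 - a * q.2.1)) p := by fun_prop
      refine hc.eventually_const_lt ?_
      beta_reduce
      rw [e1]
      exact hf _ ⟨le_rfl, h2.le⟩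
    have f8 : ∀ᶠ q in 𝓝 p, 0 < q.2.1 * g₂ q ^ 2 - a * (q.2.2 - a * q.2.1) := by
      have hc : ContinuousAt (fun q => q.2.1 * g₂ q ^ 2 - a * (q.2.2 - a * q.2.1)) p := by fun_prop
      refine hc.eventually_const_lt ?_
      beta_reduce
      rw [e2]
      exact hf _ ⟨h2.le, le_rfl⟩
    filter_upwards [f1, f2, f3, f4, f5, f6, f7, f8, z0, z1, z2] with q f1 f2 f3 f4 f5 f6 f7 f8 z0
      z1 z2
    have hfac := R_factor f3.ne' (by linarith : 0 < g₁ q).ne' (by linarith : 0 < g₂ q).ne' f4.ne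
      (by linarith : g₀ q < g₂ q).ne f5.ne z0 z1 z2
    obtain ⟨k2, k1, -⟩ := rOut_eq_rIn_eq f2 f3 f4 f5 hfac
    exact ⟨⟨f1, f2, g₀ q, g₁ q, g₂ q, f3, f4, f5, f6, hfac,
      fun r hr => future_of_endpoints (f3.trans f4) f7 f8 hr⟩, k1, k2⟩
  exact ⟨hev.mono fun q h => h.1, hg1.congr_of_eventuallyEq (hev.mono fun q h => h.2.1),
    hg2.congr_of_eventuallyEq (hev.mono fun q h => h.2.2)⟩

theorem isOpen_boundSet : IsOpen (boundSet M a) :=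
  isOpen_iff_mem_nhds.2 fun _ hp => (boundSet_local hp).1

theorem contDiffOn_rIn :
    ContDiffOn ℝ (⊤ : ℕ∞) (fun q : ℝ × ℝ × ℝ => rIn M a q.1 q.2.1 q.2.2) (boundSet M a) :=
  fun _ hp => (boundSet_local hp).2.1.contDiffWithinAt

theorem contDiffOn_rOut :
    ContDiffOn ℝ (⊤ : ℕ∞) (fun q : ℝ × ℝ × ℝ => rOut M a q.1 q.2.1 q.2.2) (boundSet M a) :=
  fun _ hp => (boundSet_local hp).2.2.contDiffWithinAt

theorem contDiffOn_rLow :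
    ContDiffOn ℝ (⊤ : ℕ∞) (fun q : ℝ × ℝ × ℝ => rLow M a q.1 q.2.1 q.2.2) (boundSet M a) := by
  unfold rLow
  refine (ContDiffOn.sub (ContDiffOn.div (by fun_prop) (by fun_prop) fun q hq => ?_)
    contDiffOn_rIn).sub contDiffOn_rOut
  have : q.2.1 ^ 2 < q.1 ^ 2 := hq.2.1
  linarith

end Roots

/-! ### Angular parametrization and smoothness of the area and of the radial action -/

variable {M a : ℝ}

/-- Parametrization of the radial interval `[r₁, r₂]` by an angle. -/
noncomputable def chartRadius (M a : ℝ) (z : (ℝ × ℝ × ℝ) × ℝ) : ℝ :=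
  (rIn M a z.1.1 z.1.2.1 z.1.2.2 + rOut M a z.1.1 z.1.2.1 z.1.2.2) / 2 -
    (rOut M a z.1.1 z.1.2.1 z.1.2.2 - rIn M a z.1.1 z.1.2.1 z.1.2.2) / 2 * Real.cos z.2

/-- The integrand `√R / Δ dr` in the angular parametrization. -/
noncomputable def chartIntegrand (M a : ℝ) (z : (ℝ × ℝ × ℝ) × ℝ) : ℝ :=
  Real.sqrt (z.1.1 ^ 2 - z.1.2.1 ^ 2) *
    Real.sqrt (chartRadius M a z * (chartRadius M a z - rLow M a z.1.1 z.1.2.1 z.1.2.2)) *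
    ((rOut M a z.1.1 z.1.2.1 z.1.2.2 - rIn M a z.1.1 z.1.2.1 z.1.2.2) / 2 * Real.sin z.2) ^ 2 /
    Del M a (chartRadius M a z)

theorem chartRadius_mem {z : (ℝ × ℝ × ℝ) × ℝ} (hz : z.1 ∈ boundSet M a) :
    chartRadius M a z ∈ Icc (rIn M a z.1.1 z.1.2.1 z.1.2.2) (rOut M a z.1.1 z.1.2.1 z.1.2.2) := by
  obtain ⟨-, -, -, -, h, -⟩ := IsBound.spec hz
  have h1 := Real.cos_le_one z.2
  have h2 := Real.neg_one_le_cos z.2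
  unfold chartRadius
  constructor <;> nlinarith

theorem contDiffOn_chartRadius :
    ContDiffOn ℝ (⊤ : ℕ∞) (chartRadius M a) (boundSet M a ×ˢ univ) := by
  have hmaps : MapsTo (Prod.fst : (ℝ × ℝ × ℝ) × ℝ → _) (boundSet M a ×ˢ univ) (boundSet M a) :=
    fun z hz => hz.1
  have h1 := (contDiffOn_rIn (M := M) (a := a)).comp contDiff_fst.contDiffOn hmaps
  have h2 := (contDiffOn_rOut (M := M) (a := a)).comp contDiff_fst.contDiffOn hmaps
  have h3 : ContDiffOn ℝ (⊤ : ℕ∞) (fun z : (ℝ × ℝ × ℝ) × ℝ => Real.cos z.2)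
    (boundSet M a ×ˢ univ) := (Real.contDiff_cos.comp contDiff_snd).contDiffOn
  exact ((h1.add h2).div_const 2).sub (((h2.sub h1).div_const 2).mul h3)

/-- After the substitution the factors vanishing at the turning points have become a square, and the
remaining square roots are of positive quantities. -/
theorem contDiffOn_chartIntegrand (ha : |a| ≤ M) :
    ContDiffOn ℝ (⊤ : ℕ∞) (chartIntegrand M a) (boundSet M a ×ˢ univ) := by
  have hmaps : MapsTo (Prod.fst : (ℝ × ℝ × ℝ) × ℝ → _) (boundSet M a ×ˢ univ) (boundSet M a) :=
    fun z hz => hz.1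
  have h0 := (contDiffOn_rLow (M := M) (a := a)).comp contDiff_fst.contDiffOn hmaps
  have h1 := (contDiffOn_rIn (M := M) (a := a)).comp contDiff_fst.contDiffOn hmaps
  have h2 := (contDiffOn_rOut (M := M) (a := a)).comp contDiff_fst.contDiffOn hmaps
  have h3 : ContDiffOn ℝ (⊤ : ℕ∞) (fun z : (ℝ × ℝ × ℝ) × ℝ => Real.sin z.2)
    (boundSet M a ×ˢ univ) := (Real.contDiff_sin.comp contDiff_snd).contDiffOn
  have h4 := contDiffOn_chartRadius (M := M) (a := a)
  have h5 : ContDiffOn ℝ (⊤ : ℕ∞) (fun z : (ℝ × ℝ × ℝ) × ℝ => z.1.1 ^ 2 - z.1.2.1 ^ 2)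
    (boundSet M a ×ˢ univ) := by fun_prop
  have h6 : ContDiff ℝ (⊤ : ℕ∞) (Del M a) := by unfold Del; fun_prop
  refine (((h5.sqrt fun z hz => ?_).mul ((h4.mul (h4.sub h0)).sqrt fun z hz => ?_)).mul
    ((((h2.sub h1).div_const 2).mul h3).pow 2)).div (h6.comp_contDiffOn h4) fun z hz => ?_
  · obtain ⟨-, h, -⟩ := IsBound.spec hz.1
    linarith
  · obtain ⟨-, -, h7, h8, -⟩ := IsBound.spec hz.1
    have h9 := (chartRadius_mem hz.1).1
    exact (mul_pos (by linarith) (by simp only [Function.comp]; linarith)).ne'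
  · obtain ⟨-, -, -, -, -, h8, -⟩ := IsBound.spec hz.1
    have h9 := (chartRadius_mem hz.1).1
    exact (Del_pos ha (h8.trans_le h9)).ne'

theorem continuousOn_sqrt_R_div_Del (ha : |a| ≤ M) (m E L : ℝ) :
    ContinuousOn (fun r => Real.sqrt (R M a m E L r) / Del M a r) (Ioi (rH M a)) := by
  apply ContinuousOn.div
  · apply Continuous.continuousOn; unfold R Del; fun_prop
  · apply Continuous.continuousOn; unfold Del; fun_prop
  · exact fun r hr => (Del_pos ha hr).ne'

/-- With `r = (r₁+r₂)/2 - ((r₂-r₁)/2) cos u` one has `(r-r₁)(r₂-r) = (((r₂-r₁)/2) sin u)²`. Its root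
combines with `dr` to give the squared factor of the chart integrand, as `sin u ≥ 0` on `[0, π]`. -/
theorem integral_sqrt_R_div_Del (ha : |a| ≤ M) {p : ℝ × ℝ × ℝ} (hp : p ∈ boundSet M a) {r : ℝ}
    (hr : r ∈ Icc (rIn M a p.1 p.2.1 p.2.2) (rOut M a p.1 p.2.1 p.2.2)) :
    ∫ s in (rIn M a p.1 p.2.1 p.2.2)..r, Real.sqrt (R M a p.1 p.2.1 p.2.2 s) / Del M a s =
      ∫ u in 0..Real.arccos ((rIn M a p.1 p.2.1 p.2.2 + rOut M a p.1 p.2.1 p.2.2 - 2 * r) /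
        (rOut M a p.1 p.2.1 p.2.2 - rIn M a p.1 p.2.1 p.2.2)), chartIntegrand M a (p, u) := by
  obtain ⟨-, hk, h0, h01, h12, hH, hR, -⟩ := IsBound.spec hp
  set r₁ := rIn M a p.1 p.2.1 p.2.2 with hr₁
  set r₂ := rOut M a p.1 p.2.1 p.2.2 with hr₂
  set v := Real.arccos ((r₁ + r₂ - 2 * r) / (r₂ - r₁)) with hv
  have hd : 0 < r₂ - r₁ := by linarith
  have hcos : Real.cos v = (r₁ + r₂ - 2 * r) / (r₂ - r₁) := by
    apply Real.cos_arccos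
    · rw [le_div_iff₀ hd]; linarith [hr.2]
    · rw [div_le_iff₀ hd]; linarith [hr.1]
  have e1 : chartRadius M a (p, 0) = r₁ := by
    simp only [chartRadius, Real.cos_zero, ← hr₁, ← hr₂]; ring
  have e2 : chartRadius M a (p, v) = r := by
    simp only [chartRadius, hcos, ← hr₁, ← hr₂]; field_simp; ring
  have hder : ∀ u, HasDerivAt (fun u => chartRadius M a (p, u)) ((r₂ - r₁) / 2 * Real.sin u) u := by
    intro u
    have := ((Real.hasDerivAt_cos u).const_mul ((r₂ - r₁) / 2)).const_sub ((r₁ + r₂) / 2)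
    exact this.congr_deriv (by ring)
  have hcv := intervalIntegral.integral_comp_mul_deriv''' (a := 0) (b := v)
    (f := fun u => chartRadius M a (p, u)) (f' := fun u => (r₂ - r₁) / 2 * Real.sin u)
    (g := fun s => Real.sqrt (R M a p.1 p.2.1 p.2.2 s) / Del M a s)
    (fun u _ => (hder u).continuousAt.continuousWithinAt)
    (fun u _ => (hder u).hasDerivWithinAt)
    ((continuousOn_sqrt_R_div_Del ha _ _ _).mono (by
      rintro _ ⟨u, -, rfl⟩
      exact hH.trans_le (chartRadius_mem (z := (p, u)) hp).1))
    (ContinuousOn.integrableOn_compact (isCompact_uIcc.image_of_continuousOn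
      (fun u _ => (hder u).continuousAt.continuousWithinAt))
      ((continuousOn_sqrt_R_div_Del ha _ _ _).mono (by
        rintro _ ⟨u, -, rfl⟩
        exact hH.trans_le (chartRadius_mem (z := (p, u)) hp).1)))
    (by
      apply ContinuousOn.integrableOn_compact isCompact_uIcc
      refine ContinuousOn.mul (ContinuousOn.comp (t := Ioi (rH M a))
        (continuousOn_sqrt_R_div_Del ha _ _ _) (fun u _ =>
        (hder u).continuousAt.continuousWithinAt) ?_) (by fun_prop)
      intro u _
      exact hH.trans_le (chartRadius_mem (z := (p, u)) hp).1)
  rw [e1, e2] at hcv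
  rw [← hcv]
  apply intervalIntegral.integral_congr
  intro u hu
  have hv0 : 0 ≤ v := Real.arccos_nonneg _
  have hvpi : v ≤ Real.pi := Real.arccos_le_pi _
  rw [uIcc_of_le hv0] at hu
  have hsin : 0 ≤ Real.sin u := Real.sin_nonneg_of_nonneg_of_le_pi hu.1 (hu.2.trans hvpi)
  have hmem := chartRadius_mem (z := (p, u)) hp
  simp only [Function.comp, chartIntegrand, ← hr₁, ← hr₂]
  set ρ := chartRadius M a (p, u) with hρ
  have hρd : ρ = (r₁ + r₂) / 2 - (r₂ - r₁) / 2 * Real.cos u := rfl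
  have hfac : R M a p.1 p.2.1 p.2.2 ρ = (p.1 ^ 2 - p.2.1 ^ 2) *
      (ρ * (ρ - rLow M a p.1 p.2.1 p.2.2)) * ((r₂ - r₁) / 2 * Real.sin u) ^ 2 := by
    have : (ρ - r₁) * (r₂ - ρ) = ((r₂ - r₁) / 2 * Real.sin u) ^ 2 := by
      rw [hρd]
      have := Real.sin_sq_add_cos_sq u
      linear_combination (-((r₂ - r₁) / 2) ^ 2) * this
    rw [hR, ← this]
    ring
  rw [hfac, Real.sqrt_mul', Real.sqrt_mul (by linarith : 0 ≤ p.1 ^ 2 - p.2.1 ^ 2),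
    Real.sqrt_sq (mul_nonneg (by linarith) hsin)]
  · ring
  · positivity

theorem area_eq (ha : |a| ≤ M) {p : ℝ × ℝ × ℝ} (hp : p ∈ boundSet M a) :
    area M a p.1 p.2.1 p.2.2 = 2 * ∫ u in 0..Real.pi, chartIntegrand M a (p, u) := by
  obtain ⟨-, -, -, -, h, -⟩ := IsBound.spec hp
  rw [area, integral_sqrt_R_div_Del ha hp ⟨h.le, le_rfl⟩]
  congr 2
  rw [show (rIn M a p.1 p.2.1 p.2.2 + rOut M a p.1 p.2.1 p.2.2 - 2 * rOut M a p.1 p.2.1 p.2.2) /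
    (rOut M a p.1 p.2.1 p.2.2 - rIn M a p.1 p.2.1 p.2.2) = -1 by
      rw [div_eq_iff (by linarith)]; ring, Real.arccos_neg_one]

theorem contDiffOn_area (ha : |a| ≤ M) :
    ContDiffOn ℝ (⊤ : ℕ∞) (fun p : ℝ × ℝ × ℝ => area M a p.1 p.2.1 p.2.2) (boundSet M a) := by
  have := contDiffOn_intervalIntegral_param (isOpen_boundSet (M := M) (a := a)) 0 Real.pi
    (contDiffOn_chartIntegrand ha)
  exact (contDiffOn_const (c := (2 : ℝ)).mul this).congr fun p hp => area_eq ha hp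

/-- Radius together with constants of motion, strictly between the turning points. -/
def radialSet (M a : ℝ) : Set (ℝ × ℝ × ℝ × ℝ) :=
  {y | y.2 ∈ boundSet M a ∧ rIn M a y.2.1 y.2.2.1 y.2.2.2 < y.1 ∧
    y.1 < rOut M a y.2.1 y.2.2.1 y.2.2.2}

theorem isOpen_radialSet : IsOpen (radialSet M a) := by
  have hB : IsOpen {y : ℝ × ℝ × ℝ × ℝ | y.2 ∈ boundSet M a} :=
    isOpen_boundSet.preimage continuous_snd
  have h1 : ContinuousOn (fun y : ℝ × ℝ × ℝ × ℝ => rIn M a y.2.1 y.2.2.1 y.2.2.2)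
      {y | y.2 ∈ boundSet M a} :=
    contDiffOn_rIn.continuousOn.comp continuous_snd.continuousOn fun y hy => hy
  have h2 : ContinuousOn (fun y : ℝ × ℝ × ℝ × ℝ => rOut M a y.2.1 y.2.2.1 y.2.2.2)
      {y | y.2 ∈ boundSet M a} :=
    contDiffOn_rOut.continuousOn.comp continuous_snd.continuousOn fun y hy => hy
  have h3 := (continuous_fst.continuousOn.sub h1).isOpen_inter_preimage hB (isOpen_Ioi (a := 0))
  have h4 := (h2.sub continuous_fst.continuousOn).isOpen_inter_preimage hB (isOpen_Ioi (a := 0))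
  convert! h3.inter h4 using 1
  ext y
  simp only [radialSet, mem_inter_iff, mem_preimage, mem_Ioi, mem_ofPred_eq, Pi.sub_apply, sub_pos]
  tauto

/-- The variable upper limit `v` is rescaled to the fixed interval `[0,1]`. It is an `arccos`,
smooth only away from its endpoints, which is why the radius must lie strictly between the turning
points. -/
theorem contDiffOn_radialAction (ha : |a| ≤ M) (σ : ℝ) :
    ContDiffOn ℝ (⊤ : ℕ∞) (fun y : ℝ × ℝ × ℝ × ℝ => radialAction M a y.1 σ y.2.1 y.2.2.1 y.2.2.2)
      (radialSet M a) := by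
  have hmaps : MapsTo (Prod.snd : ℝ × ℝ × ℝ × ℝ → _) (radialSet M a) (boundSet M a) :=
    fun y hy => hy.1
  have h1 := (contDiffOn_rIn (M := M) (a := a)).comp contDiff_snd.contDiffOn hmaps
  have h2 := (contDiffOn_rOut (M := M) (a := a)).comp contDiff_snd.contDiffOn hmaps
  have hd : ∀ y ∈ radialSet M a, 0 < rOut M a y.2.1 y.2.2.1 y.2.2.2 - rIn M a y.2.1 y.2.2.1 y.2.2.2 :=
    fun y hy => by linarith [hy.2.1, hy.2.2]
  have h3 : ContDiffOn ℝ (⊤ : ℕ∞) (fun y : ℝ × ℝ × ℝ × ℝ =>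
      (rIn M a y.2.1 y.2.2.1 y.2.2.2 + rOut M a y.2.1 y.2.2.1 y.2.2.2 - 2 * y.1) /
        (rOut M a y.2.1 y.2.2.1 y.2.2.2 - rIn M a y.2.1 y.2.2.1 y.2.2.2)) (radialSet M a) :=
    ((h1.add h2).sub (contDiffOn_const.mul contDiff_fst.contDiffOn)).div (h2.sub h1)
      fun y hy => (hd y hy).ne'
  set v : ℝ × ℝ × ℝ × ℝ → ℝ := fun y => Real.arccos
    ((rIn M a y.2.1 y.2.2.1 y.2.2.2 + rOut M a y.2.1 y.2.2.1 y.2.2.2 - 2 * y.1) /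
        (rOut M a y.2.1 y.2.2.1 y.2.2.2 - rIn M a y.2.1 y.2.2.1 y.2.2.2)) with hv
  have hvc : ContDiffOn ℝ (⊤ : ℕ∞) v (radialSet M a) := by
    intro y hy
    refine ContDiffAt.comp_contDiffWithinAt (g := Real.arccos) y (Real.contDiffAt_arccos ?_ ?_) (h3 y hy)
    · rw [ne_eq, div_eq_iff (hd y hy).ne']; intro h; linarith [hy.2.2]
    · rw [ne_eq, div_eq_iff (hd y hy).ne']; intro h; linarith [hy.2.1]
  have hin : ContDiffOn ℝ (⊤ : ℕ∞) (fun z : (ℝ × ℝ × ℝ × ℝ) × ℝ =>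
      chartIntegrand M a (z.1.2, v z.1 * z.2)) (radialSet M a ×ˢ univ) := by
    refine (contDiffOn_chartIntegrand ha).comp (ContDiffOn.prodMk ?_ (ContDiffOn.mul ?_ ?_)) ?_
    · exact (contDiff_snd.comp contDiff_fst).contDiffOn
    · exact hvc.comp contDiff_fst.contDiffOn fun z hz => hz.1
    · exact contDiff_snd.contDiffOn
    · exact fun z hz => ⟨hz.1.1, mem_univ _⟩
  have hI := contDiffOn_intervalIntegral_param (isOpen_radialSet (M := M) (a := a)) 0 1 hin
  refine (contDiffOn_const (c := σ).mul (hvc.mul hI)).congr fun y hy => ?_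
  rw [radialAction, integral_sqrt_R_div_Del ha hy.1 ⟨hy.2.1.le, hy.2.2.le⟩]
  congr 1
  have := intervalIntegral.mul_integral_comp_mul_left (a := 0) (b := 1) (v y)
    (f := fun u => chartIntegrand M a (y.2, u))
  rw [mul_zero, mul_one] at this
  exact this.symm

/-! ### Monotonicity of the area in the mass and in the energy -/

theorem R_nonneg_of_mem {p : ℝ × ℝ × ℝ} (hp : p ∈ boundSet M a) {r : ℝ}
    (hr : r ∈ Icc (rIn M a p.1 p.2.1 p.2.2) (rOut M a p.1 p.2.1 p.2.2)) :
    0 ≤ R M a p.1 p.2.1 p.2.2 r := by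
  obtain ⟨-, hk, h0, h01, h12, -, hR, -⟩ := IsBound.spec hp
  rw [hR]
  have := hr.1
  have := hr.2
  apply mul_nonneg (mul_nonneg (mul_nonneg (mul_nonneg _ _) _) _) _ <;> linarith

theorem R_pos_of_mem {p : ℝ × ℝ × ℝ} (hp : p ∈ boundSet M a) {r : ℝ}
    (hr : r ∈ Ioo (rIn M a p.1 p.2.1 p.2.2) (rOut M a p.1 p.2.1 p.2.2)) :
    0 < R M a p.1 p.2.1 p.2.2 r := by
  obtain ⟨-, hk, h0, h01, h12, -, hR, -⟩ := IsBound.spec hp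
  rw [hR]
  have := hr.1
  have := hr.2
  apply mul_pos (mul_pos (mul_pos (mul_pos _ _) _) _) _ <;> linarith

theorem mem_Ioo_of_R_pos {p : ℝ × ℝ × ℝ} (hp : p ∈ boundSet M a) {r : ℝ}
    (hr : rLow M a p.1 p.2.1 p.2.2 < r) (hR : 0 < R M a p.1 p.2.1 p.2.2 r) :
    r ∈ Ioo (rIn M a p.1 p.2.1 p.2.2) (rOut M a p.1 p.2.1 p.2.2) := by
  obtain ⟨-, hk, h0, h01, h12, -, hfac, -⟩ := IsBound.spec hp
  rw [hfac, mul_assoc] at hR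
  have h1 : 0 < (p.1 ^ 2 - p.2.1 ^ 2) * r * (r - rLow M a p.1 p.2.1 p.2.2) := by
    apply mul_pos (mul_pos _ _) _ <;> linarith
  have h2 := (mul_pos_iff_of_pos_left h1).1 hR
  constructor <;> by_contra h <;> nlinarith

theorem intervalIntegrable_sqrt_R_div_Del (ha : |a| ≤ M) (m E L : ℝ) {x y : ℝ} (hx : rH M a < x)
    (hy : rH M a < y) :
    IntervalIntegrable (fun r => Real.sqrt (R M a m E L r) / Del M a r) volume x y := by
  apply ContinuousOn.intervalIntegrable
  refine (continuousOn_sqrt_R_div_Del ha m E L).mono fun r hr => ?_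
  exact (lt_min hx hy).trans_le hr.1

theorem area_pos (ha : |a| ≤ M) {p : ℝ × ℝ × ℝ} (hp : p ∈ boundSet M a) :
    0 < area M a p.1 p.2.1 p.2.2 := by
  obtain ⟨-, -, -, -, h12, hH, -⟩ := IsBound.spec hp
  rw [area]
  apply mul_pos two_pos
  apply intervalIntegral.intervalIntegral_pos_of_pos_on
    (intervalIntegrable_sqrt_R_div_Del ha _ _ _ hH (hH.trans h12)) _ h12
  intro r hr
  exact div_pos (Real.sqrt_pos.2 (R_pos_of_mem hp hr)) (Del_pos ha (hH.trans hr.1))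

/-- The area strictly increases along a curve of constants of motion along which `R` does. -/
theorem area_deriv_pos (ha : |a| ≤ M) {γ : ℝ → ℝ × ℝ × ℝ} (hγ : ContinuousAt γ 0)
    (hp : γ 0 ∈ boundSet M a) {κ : ℝ} (hκ : 0 < κ)
    (hR : ∀ᶠ t in 𝓝[>] (0 : ℝ), ∀ r ∈ Icc (rIn M a (γ 0).1 (γ 0).2.1 (γ 0).2.2)
      (rOut M a (γ 0).1 (γ 0).2.1 (γ 0).2.2),
      R M a (γ 0).1 (γ 0).2.1 (γ 0).2.2 r + κ * t ≤ R M a (γ t).1 (γ t).2.1 (γ t).2.2 r)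
    {D : ℝ} (hD : HasDerivAt (fun t => area M a (γ t).1 (γ t).2.1 (γ t).2.2) D 0) : 0 < D := by
  set p := γ 0 with hp0
  obtain ⟨-, -, h0, h01, h12, hH, -⟩ := IsBound.spec hp
  set r₁ := rIn M a p.1 p.2.1 p.2.2 with hr₁
  set r₂ := rOut M a p.1 p.2.1 p.2.2 with hr₂
  obtain ⟨K, hK⟩ := (isCompact_Icc (a := r₁) (b := r₂)).exists_bound_of_continuousOn
    (f := R M a p.1 p.2.1 p.2.2) (by apply Continuous.continuousOn; unfold R Del; fun_prop)
  have hKR : ∀ r ∈ Icc r₁ r₂, R M a p.1 p.2.1 p.2.2 r ≤ K :=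
    fun r hr => (le_abs_self _).trans (hK r hr)
  have hK0 : 0 ≤ K := (norm_nonneg _).trans (hK r₁ ⟨le_rfl, h12.le⟩)
  have hD2 : 0 < Del M a r₂ := Del_pos ha (hH.trans h12)
  -- A positive lower bound on the difference quotients suffices, so no differentiation under the
  -- integral near the turning points is required.
  have hev : ∀ᶠ t in 𝓝[>] (0 : ℝ), κ / (2 * Real.sqrt (K + κ)) / Del M a r₂ * (r₂ - r₁) * 2 ≤
      slope (fun t => area M a (γ t).1 (γ t).2.1 (γ t).2.2) 0 t := by
    have hc : Tendsto γ (𝓝[>] 0) (𝓝 p) := hγ.tendsto.mono_left nhdsWithin_le_nhds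
    have f1 : ∀ᶠ t in 𝓝[>] (0 : ℝ), γ t ∈ boundSet M a :=
      hc.eventually (isOpen_boundSet.mem_nhds hp)
    have f2 : ∀ᶠ t in 𝓝[>] (0 : ℝ), rLow M a (γ t).1 (γ t).2.1 (γ t).2.2 < r₁ := by
      have := (contDiffOn_rLow.continuousOn.continuousAt (isOpen_boundSet.mem_nhds hp)).tendsto.comp
        hc
      exact this.eventually_lt_const h01
    have f3 : ∀ᶠ t in 𝓝[>] (0 : ℝ), t < 1 :=
      (tendsto_id.mono_left nhdsWithin_le_nhds).eventually_lt_const one_pos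
    filter_upwards [f1, f2, f3, hR, self_mem_nhdsWithin] with t f1 f2 f3 hR ht
    have ht : 0 < t := ht
    have hκt : 0 < κ * t := mul_pos hκ ht
    obtain ⟨-, -, -, -, g12, gH, -⟩ := IsBound.spec f1
    -- The increased `R` is positive at the old turning points, so the new interval contains the old
    -- one and the area may be bounded below over the old one.
    have hin : r₁ ∈ Ioo _ _ := mem_Ioo_of_R_pos f1 f2 (by
      have e1 := hR r₁ ⟨le_rfl, h12.le⟩
      have e2 := R_nonneg_of_mem hp (r := r₁) ⟨le_rfl, h12.le⟩
      linarith)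
    have hout : r₂ ∈ Ioo _ _ := mem_Ioo_of_R_pos f1 (f2.trans h12) (by
      have e1 := hR r₂ ⟨h12.le, le_rfl⟩
      have e2 := R_nonneg_of_mem hp (r := r₂) ⟨h12.le, le_rfl⟩
      linarith)
    have h1 : ∫ r in r₁..r₂, Real.sqrt (R M a (γ t).1 (γ t).2.1 (γ t).2.2 r) / Del M a r ≤
        ∫ r in (rIn M a (γ t).1 (γ t).2.1 (γ t).2.2)..(rOut M a (γ t).1 (γ t).2.1 (γ t).2.2),
          Real.sqrt (R M a (γ t).1 (γ t).2.1 (γ t).2.2 r) / Del M a r := by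
      apply intervalIntegral.integral_mono_interval hin.1.le h12.le hout.2.le
      · filter_upwards [ae_restrict_mem measurableSet_Ioc] with r hr
        exact div_nonneg (Real.sqrt_nonneg _) (Del_pos ha (gH.trans hr.1)).le
      · exact intervalIntegrable_sqrt_R_div_Del ha _ _ _ gH (gH.trans g12)
    have h2 : ∫ r in r₁..r₂, (Real.sqrt (R M a p.1 p.2.1 p.2.2 r) / Del M a r +
        κ * t / (2 * Real.sqrt (K + κ)) / Del M a r₂) ≤
        ∫ r in r₁..r₂, Real.sqrt (R M a (γ t).1 (γ t).2.1 (γ t).2.2 r) / Del M a r := by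
      apply intervalIntegral.integral_mono_on h12.le
      · exact (intervalIntegrable_sqrt_R_div_Del ha _ _ _ hH (hH.trans h12)).add
          intervalIntegrable_const
      · exact intervalIntegrable_sqrt_R_div_Del ha _ _ _ hH (hH.trans h12)
      · intro r hr
        have e0 := R_nonneg_of_mem hp hr
        have e1 := hR r hr
        have e2 := hKR r hr
        set x := R M a p.1 p.2.1 p.2.2 r
        have hΔ : 0 < Del M a r := Del_pos ha (hH.trans_le hr.1)
        have hΔ2 : Del M a r ≤ Del M a r₂ := Del_le_Del (hH.trans_le hr.1) hr.2
        have hs0 : 0 < Real.sqrt (K + κ) := Real.sqrt_pos.2 (by linarith)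
        -- The increment of the square root is at least `κt` divided by the sum of the two roots,
        -- and each of them is at most `√(K+κ)` because `t < 1`.
        have hs : Real.sqrt x + κ * t / (2 * Real.sqrt (K + κ)) ≤
            Real.sqrt (R M a (γ t).1 (γ t).2.1 (γ t).2.2 r) := by
          refine le_trans ?_ (Real.sqrt_le_sqrt e1)
          have h3 := Real.sqrt_nonneg x
          have h4 := Real.sq_sqrt e0
          have h5 := Real.sq_sqrt (by linarith : 0 ≤ x + κ * t)
          have h6 : Real.sqrt x ≤ Real.sqrt (x + κ * t) := Real.sqrt_le_sqrt (by linarith)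
          have h7 : Real.sqrt (x + κ * t) ≤ Real.sqrt (K + κ) :=
            Real.sqrt_le_sqrt (by nlinarith)
          have h8 : κ * t / (2 * Real.sqrt (K + κ)) ≤ Real.sqrt (x + κ * t) - Real.sqrt x := by
            rw [div_le_iff₀ (by positivity)]
            nlinarith
          linarith
        calc _ ≤ Real.sqrt x / Del M a r + κ * t / (2 * Real.sqrt (K + κ)) / Del M a r := by
              gcongr
          _ = (Real.sqrt x + κ * t / (2 * Real.sqrt (K + κ))) / Del M a r := by ring
          _ ≤ _ := by gcongr
    rw [intervalIntegral.integral_add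
      (intervalIntegrable_sqrt_R_div_Del ha _ _ _ hH (hH.trans h12)) intervalIntegrable_const,
      intervalIntegral.integral_const, smul_eq_mul] at h2
    rw [slope_def_field, sub_zero, le_div_iff₀ ht, area, area]
    have h3 : κ / (2 * Real.sqrt (K + κ)) / Del M a r₂ * (r₂ - r₁) * 2 * t =
      2 * ((r₂ - r₁) * (κ * t / (2 * Real.sqrt (K + κ)) / Del M a r₂)) := by ring
    rw [h3]
    linarith
  have hlim := (hasDerivAt_iff_tendsto_slope.1 hD).mono_left
    (nhdsWithin_mono 0 (fun x (hx : x ∈ Ioi (0 : ℝ)) => (mem_Ioi.1 hx).ne'))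
  refine lt_of_lt_of_le ?_ (ge_of_tendsto hlim hev)
  have : 0 < Real.sqrt (K + κ) := Real.sqrt_pos.2 (by linarith)
  have : 0 < r₂ - r₁ := by linarith
  positivity

theorem differentiableAt_area (ha : |a| ≤ M) {p : ℝ × ℝ × ℝ} (hp : p ∈ boundSet M a) :
    DifferentiableAt ℝ (fun q : ℝ × ℝ × ℝ => area M a q.1 q.2.1 q.2.2) p :=
  ((contDiffOn_area ha).contDiffAt (isOpen_boundSet.mem_nhds hp)).differentiableAt (by simp)

theorem area_deriv_m_neg (hM : 0 < M) (ha : |a| ≤ M) {m E L : ℝ} (hp : IsBound M a m E L) :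
    DifferentiableAt ℝ (fun m' => area M a m' E L) m ∧
      deriv (fun m' => area M a m' E L) m < 0 := by
  have hd : DifferentiableAt ℝ (fun m' => area M a m' E L) m :=
    (differentiableAt_area ha (p := (m, E, L)) hp).comp m (f := fun m' => (m', E, L))
      (by fun_prop)
  refine ⟨hd, ?_⟩
  obtain ⟨hm, -, -, -, h12, hH, -⟩ := IsBound.spec hp
  have h1 : 0 < -deriv (fun m' => area M a m' E L) m := by
    have hD1 := Del_pos ha hH
    have hr1 : 0 < rIn M a m E L := hM.trans_le (le_rH M a) |>.trans hH
    -- The mass is lowered, since `R` depends on it through `-m²Δr²`. The increment is `t(2m-t)Δr² ≥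
    -- tmΔr²` for `t < m`, and `Δr²` is smallest at `r₁`; hence `κ`.
    refine area_deriv_pos ha (γ := fun t => (m - t, E, L)) (by fun_prop) (by simpa [boundSet] using hp)
      (κ := m * (Del M a (rIn M a m E L) * rIn M a m E L ^ 2)) (by positivity) ?_ ?_
    · have : ∀ᶠ t in 𝓝[>] (0 : ℝ), t < m :=
        (tendsto_id.mono_left nhdsWithin_le_nhds).eventually_lt_const hm
      filter_upwards [this, self_mem_nhdsWithin] with t htm ht
      have ht : 0 < t := ht
      simp only [sub_zero]
      intro r hr
      have e1 := Del_le_Del hH hr.1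
      have e0 : 0 ≤ Del M a r := hD1.le.trans e1
      have e2 : rIn M a m E L ^ 2 ≤ r ^ 2 := by gcongr; exact hr.1
      have e3 : Del M a (rIn M a m E L) * rIn M a m E L ^ 2 ≤ Del M a r * r ^ 2 := by gcongr
      have e4 : R M a (m - t) E L r - R M a m E L r = (t * (2 * m - t)) * (Del M a r * r ^ 2) := by
        unfold R; ring
      have e5 : t * m ≤ t * (2 * m - t) := by nlinarith
      have e6 : (t * m) * (Del M a (rIn M a m E L) * rIn M a m E L ^ 2) ≤
        (t * (2 * m - t)) * (Del M a r * r ^ 2) := by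
        gcongr
        exact (mul_pos ht hm).le.trans e5
      linarith
    · have h2 := hd.hasDerivAt
      have h3 : HasDerivAt (fun t : ℝ => m - t) (-1) 0 := (hasDerivAt_id 0).const_sub m
      have h4 : HasDerivAt (fun m' => area M a m' E L) (deriv (fun m' => area M a m' E L) m)
        ((fun t : ℝ => m - t) 0) := by simpa using h2
      have := h4.comp 0 h3
      simpa [Function.comp_def] using this
  linarith

/-- The quantity is half of `∂R/∂E`. With `P = Er² - aL̂`, the condition `R ≥ 0` gives `ΔL̂² ≤ P²`,
and `a²Δ < (r²+a²)²`; so the last term is smaller in absolute value than the first, which is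
positive by future-directedness. -/
theorem R_deriv_E_pos (hM : 0 < M) (ha : |a| ≤ M) {m E L r : ℝ} (hr : rH M a < r)
    (hR : 0 ≤ R M a m E L r) (hf : 0 < E * r ^ 2 - a * (L - a * E)) :
    0 < (E * r ^ 2 - a * (L - a * E)) * (r ^ 2 + a ^ 2) + a * Del M a r * (L - a * E) := by
  have hD := Del_pos ha hr
  have hr0 : 0 < r := hM.trans_le (le_rH M a) |>.trans hr
  have hDd : Del M a r = r ^ 2 - 2 * M * r + a ^ 2 := rfl
  set P := E * r ^ 2 - a * (L - a * E) with hP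
  set l := L - a * E with hl
  have h1 : Del M a r * l ^ 2 ≤ P ^ 2 := by
    have : R M a m E L r = P ^ 2 - Del M a r * (m ^ 2 * r ^ 2 + l ^ 2) := rfl
    have h2 : 0 ≤ Del M a r * (m ^ 2 * r ^ 2) := by positivity
    linarith
  have h3 : a ^ 2 * Del M a r < (r ^ 2 + a ^ 2) ^ 2 := by
    have : 0 < M * r := by positivity
    have h4 : a ^ 2 * Del M a r ≤ a ^ 2 * (r ^ 2 + a ^ 2) := by
      apply mul_le_mul_of_nonneg_left _ (sq_nonneg a); rw [hDd]; nlinarith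
    have h5 : 0 < r ^ 2 := by positivity
    nlinarith [sq_nonneg a]
  have h6 : (a * Del M a r * l) ^ 2 < (P * (r ^ 2 + a ^ 2)) ^ 2 := by
    calc (a * Del M a r * l) ^ 2 = (a ^ 2 * Del M a r) * (Del M a r * l ^ 2) := by ring
      _ ≤ (a ^ 2 * Del M a r) * P ^ 2 := by gcongr
      _ < (r ^ 2 + a ^ 2) ^ 2 * P ^ 2 := by gcongr
      _ = _ := by ring
  have h7 := (abs_lt.1 (abs_lt_of_sq_lt_sq h6 (by positivity))).1
  linarith

theorem area_deriv_E_pos (hM : 0 < M) (ha : |a| ≤ M) {m E L : ℝ} (hp : IsBound M a m E L) :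
    0 < deriv (fun E' => area M a m E' L) E := by
  have hd : DifferentiableAt ℝ (fun E' => area M a m E' L) E :=
    (differentiableAt_area ha (p := (m, E, L)) hp).comp E (f := fun E' => (m, E', L))
      (by fun_prop)
  obtain ⟨hm, -, -, -, h12, hH, hfac, hf⟩ := IsBound.spec hp
  -- Compactness of the radial interval makes the lower bound on `∂R/∂E` uniform; the part of `R`
  -- quadratic in the energy increment is nonnegative and may be dropped.
  obtain ⟨r₀, hr₀, hmin⟩ := (isCompact_Icc (a := rIn M a m E L) (b := rOut M a m E L)).exists_isMinOn
    ⟨_, le_rfl, h12.le⟩ (f := fun r => (E * r ^ 2 - a * (L - a * E)) * (r ^ 2 + a ^ 2) +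
      a * Del M a r * (L - a * E)) (by apply Continuous.continuousOn; unfold Del; fun_prop)
  have hpos := R_deriv_E_pos hM ha (hH.trans_le hr₀.1)
    (R_nonneg_of_mem (p := (m, E, L)) hp hr₀) (hf r₀ hr₀)
  refine area_deriv_pos ha (γ := fun t => (m, E + t, L)) (by fun_prop) (by simpa [boundSet] using hp)
    (κ := 2 * ((E * r₀ ^ 2 - a * (L - a * E)) * (r₀ ^ 2 + a ^ 2) +
      a * Del M a r₀ * (L - a * E))) (by positivity) ?_ ?_
  · filter_upwards [self_mem_nhdsWithin] with t ht
    have ht : 0 < t := ht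
    simp only [add_zero]
    intro r hr
    have e1 := isMinOn_iff.1 hmin r hr
    have hr0 : 0 < r := hM.trans_le (le_rH M a) |>.trans (hH.trans_le hr.1)
    have e4 : R M a m (E + t) L r - R M a m E L r =
        t * (2 * ((E * r ^ 2 - a * (L - a * E)) * (r ^ 2 + a ^ 2) +
          a * Del M a r * (L - a * E))) + t ^ 2 * (r ^ 4 + a ^ 2 * r ^ 2 + 2 * M * a ^ 2 * r) := by
      unfold R Del; ring
    have e5 : 0 ≤ t ^ 2 * (r ^ 4 + a ^ 2 * r ^ 2 + 2 * M * a ^ 2 * r) := by positivity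
    have e6 := mul_le_mul_of_nonneg_left e1 ht.le
    linarith
  · have h2 := hd.hasDerivAt
    have h3 : HasDerivAt (fun t : ℝ => E + t) 1 0 := (hasDerivAt_id 0).const_add E
    have h4 : HasDerivAt (fun E' => area M a m E' L) (deriv (fun E' => area M a m E' L) E)
      ((fun t : ℝ => E + t) 0) := by simpa using h2
    have := h4.comp 0 h3
    simpa [Function.comp_def] using this

/-! ### Exchanging the radial momentum for the mass -/

/-- The constants of motion `(m, E, L)` as functions of `(r, p_t, p_φ, p_r)`. -/
noncomputable def constants (M a : ℝ) (y : ℝ × ℝ × ℝ × ℝ) : ℝ × ℝ × ℝ :=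
  (mass M a y.1 y.2.1 y.2.2.1 y.2.2.2, -y.2.1, y.2.2.1)

/-- The timelike region of the reduced phase space. -/
def timelikeSet (M a : ℝ) : Set (ℝ × ℝ × ℝ × ℝ) :=
  {y | rH M a < y.1 ∧ hamiltonian M a y.1 y.2.1 y.2.2.1 y.2.2.2 < 0}

/-- Reduced phase space of bound orbits away from the turning points. -/
def reducedGamma (M a : ℝ) : Set (ℝ × ℝ × ℝ × ℝ) :=
  {y | y ∈ timelikeSet M a ∧ (y.1, constants M a y) ∈ radialSet M a}

theorem continuousOn_hamiltonian (hM : 0 < M) (ha : |a| ≤ M) :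
    ContinuousOn (fun y : ℝ × ℝ × ℝ × ℝ => hamiltonian M a y.1 y.2.1 y.2.2.1 y.2.2.2)
      {y | rH M a < y.1} := by
  have h : ContinuousOn (fun y : ℝ × ℝ × ℝ × ℝ =>
      ((-y.2.1 * y.1 ^ 2 - a * (y.2.2.1 - a * -y.2.1)) ^ 2 -
        Del M a y.1 * (y.2.2.1 - a * -y.2.1) ^ 2 - (Del M a y.1 * y.2.2.2) ^ 2) /
        (-2 * (y.1 ^ 2 * Del M a y.1))) {y | rH M a < y.1} := by
    apply ContinuousOn.div
    · apply Continuous.continuousOn; unfold Del; fun_prop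
    · apply Continuous.continuousOn; unfold Del; fun_prop
    · intro y hy
      have h1 := Del_pos ha hy
      have h2 : 0 < y.1 := hM.trans_le (le_rH M a) |>.trans hy
      have : 0 < y.1 ^ 2 * Del M a y.1 := by positivity
      linarith
  refine h.congr fun y hy => ?_
  have h1 := Del_pos ha hy
  have h2 : 0 < y.1 := hM.trans_le (le_rH M a) |>.trans hy
  have : 0 < y.1 ^ 2 * Del M a y.1 := by positivity
  beta_reduce
  rw [← hamiltonian_eq hM ha hy]
  field_simp

theorem isOpen_timelikeSet (hM : 0 < M) (ha : |a| ≤ M) : IsOpen (timelikeSet M a) :=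
  (continuousOn_hamiltonian hM ha).isOpen_inter_preimage
    (isOpen_lt continuous_const continuous_fst) isOpen_Iio

theorem continuousOn_constants (hM : 0 < M) (ha : |a| ≤ M) :
    ContinuousOn (constants M a) {y | rH M a < y.1} := by
  refine ContinuousOn.prodMk ?_ (by fun_prop)
  unfold mass
  exact (continuousOn_const.mul (continuousOn_hamiltonian hM ha)).sqrt

theorem continuousOn_prod_constants (hM : 0 < M) (ha : |a| ≤ M) :
    ContinuousOn (fun y => (y.1, constants M a y)) (timelikeSet M a) :=
  continuousOn_fst.prodMk ((continuousOn_constants hM ha).mono fun _ hy => hy.1)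

theorem isOpen_reducedGamma (hM : 0 < M) (ha : |a| ≤ M) : IsOpen (reducedGamma M a) :=
  (continuousOn_prod_constants hM ha).isOpen_inter_preimage (isOpen_timelikeSet hM ha)
    isOpen_radialSet

theorem sqrt_R_constants (hM : 0 < M) (ha : |a| ≤ M) {y : ℝ × ℝ × ℝ × ℝ}
    (hy : y ∈ timelikeSet M a) :
    Real.sqrt (R M a (constants M a y).1 (constants M a y).2.1 (constants M a y).2.2 y.1) =
      Del M a y.1 * |y.2.2.2| := by
  simp only [constants]
  rw [R_mass_eq hM ha hy.1 hy.2, Real.sqrt_sq_eq_abs, abs_mul, abs_of_pos (Del_pos ha hy.1)]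

/-- The Jacobian factor of the change of variables from `p_r` to the mass. -/
noncomputable def massWeight (M a : ℝ) (x : ℝ × ℝ × ℝ × ℝ) : ENNReal :=
  ENNReal.ofReal (x.2.1 * x.1 ^ 2 / Real.sqrt (R M a x.2.1 x.2.2.1 x.2.2.2 x.1))

theorem measurable_massWeight : Measurable (massWeight M a) := by
  unfold massWeight R Del; fun_prop

theorem mass_hasDerivAt (hM : 0 < M) (ha : |a| ≤ M) {r pt pphi pr : ℝ} (hr : rH M a < r)
    (hH : hamiltonian M a r pt pphi pr < 0) :
    HasDerivAt (fun x => mass M a r pt pphi x)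
      (-(Del M a r * pr) / (r ^ 2 * mass M a r pt pphi pr)) pr := by
  have h1 := Del_pos ha hr
  have h2 : 0 < r := hM.trans_le (le_rH M a) |>.trans hr
  have hEq : (fun x => mass M a r pt pphi x) = fun x => Real.sqrt
      (((-pt * r ^ 2 - a * (pphi - a * -pt)) ^ 2 - Del M a r * (pphi - a * -pt) ^ 2 -
        (Del M a r * x) ^ 2) / (r ^ 2 * Del M a r)) := by
    ext x
    rw [mass, ← hamiltonian_eq hM ha hr]
    congr 1
    field_simp
  have hval : ((-pt * r ^ 2 - a * (pphi - a * -pt)) ^ 2 - Del M a r * (pphi - a * -pt) ^ 2 -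
        (Del M a r * pr) ^ 2) / (r ^ 2 * Del M a r) = -2 * hamiltonian M a r pt pphi pr := by
    rw [← hamiltonian_eq hM ha hr]
    field_simp
  have hd : HasDerivAt (fun x => ((-pt * r ^ 2 - a * (pphi - a * -pt)) ^ 2 -
      Del M a r * (pphi - a * -pt) ^ 2 - (Del M a r * x) ^ 2) / (r ^ 2 * Del M a r))
      (-(2 * (Del M a r * pr) * Del M a r) / (r ^ 2 * Del M a r)) pr := by
    have := ((((hasDerivAt_id pr).const_mul (Del M a r)).pow 2).const_sub
      ((-pt * r ^ 2 - a * (pphi - a * -pt)) ^ 2 - Del M a r * (pphi - a * -pt) ^ 2)).div_const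
      (r ^ 2 * Del M a r)
    refine this.congr_deriv ?_
    simp
  have := hd.sqrt (by rw [hval]; linarith)
  rw [hEq]
  refine this.congr_deriv ?_
  rw [hval, ← mass]
  have : 0 < mass M a r pt pphi pr := Real.sqrt_pos.2 (by linarith)
  field_simp

/-- On a set where `p_r²` determines `p_r`, the mass is an injective function of `p_r` with
`|dm/dp_r| = Δ|p_r|/(r²m)`. As `Δ|p_r| = √R`, the inverse Jacobian is `m r²/√R`, the weight on the
right. -/
theorem lintegral_fiber_half_le (hM : 0 < M) (ha : |a| ≤ M) (r pt pphi : ℝ) {Z : Set ℝ}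
    (hZ : MeasurableSet Z) (hinj : ∀ x ∈ Z, ∀ y ∈ Z, x ^ 2 = y ^ 2 → x = y)
    (hS : ∀ x ∈ Z, (r, pt, pphi, x) ∈ reducedGamma M a) (h : ℝ × ℝ × ℝ × ℝ → ENNReal) :
    ∫⁻ x in Z, h (r, constants M a (r, pt, pphi, x)) ≤
      ∫⁻ m in {m | (r, m, -pt, pphi) ∈ radialSet M a},
        h (r, m, -pt, pphi) * massWeight M a (r, m, -pt, pphi) := by
  have key := lintegral_image_eq_lintegral_abs_deriv_mul hZ
    (f := fun x => mass M a r pt pphi x)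
    (f' := fun x => -(Del M a r * x) / (r ^ 2 * mass M a r pt pphi x))
    (fun x hx => (mass_hasDerivAt hM ha (hS x hx).1.1 (hS x hx).1.2).hasDerivWithinAt) ?_
    (fun m => h (r, m, -pt, pphi) * massWeight M a (r, m, -pt, pphi))
  · calc ∫⁻ x in Z, h (r, constants M a (r, pt, pphi, x))
        = ∫⁻ x in Z, ENNReal.ofReal |-(Del M a r * x) / (r ^ 2 * mass M a r pt pphi x)| *
          (h (r, mass M a r pt pphi x, -pt, pphi) *
            massWeight M a (r, mass M a r pt pphi x, -pt, pphi)) := by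
          refine setLIntegral_congr_fun hZ fun x hx => ?_
          obtain ⟨⟨hr, hH⟩, hB, hlt⟩ := hS x hx
          have hm : 0 < mass M a r pt pphi x := hB.1
          have hD := Del_pos ha hr
          have hr0 : 0 < r := hM.trans_le (le_rH M a) |>.trans hr
          have hR := R_pos_of_mem hB hlt
          have hsq := sqrt_R_constants hM ha (y := (r, pt, pphi, x)) ⟨hr, hH⟩
          simp only [constants] at hsq hR ⊢
          have hx0 : 0 < |x| := by
            have h1 := Real.sqrt_pos.2 hR
            rw [hsq] at h1
            exact (mul_pos_iff_of_pos_left hD).1 h1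
          have h1 : ENNReal.ofReal |-(Del M a r * x) / (r ^ 2 * mass M a r pt pphi x)| *
              massWeight M a (r, mass M a r pt pphi x, -pt, pphi) = 1 := by
            rw [massWeight, ← ENNReal.ofReal_mul (abs_nonneg _)]
            simp only
            rw [hsq, abs_div, abs_neg, abs_mul, abs_mul, abs_of_pos hm, abs_of_pos hD,
              abs_of_pos (by positivity : 0 < r ^ 2), ← ENNReal.ofReal_one]
            congr 1
            field_simp
          rw [mul_left_comm, h1, mul_one]
      _ = ∫⁻ m in (fun x => mass M a r pt pphi x) '' Z,
          h (r, m, -pt, pphi) * massWeight M a (r, m, -pt, pphi) := key.symm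
      _ ≤ _ := by
          apply lintegral_mono_set
          rintro _ ⟨x, hx, rfl⟩
          exact (hS x hx).2
  · intro x hx y hy hxy
    apply hinj x hx y hy
    have e1 := R_mass_eq hM ha (hS x hx).1.1 (hS x hx).1.2
    have e2 := R_mass_eq hM ha (hS y hy).1.1 (hS y hy).1.2
    simp only at e1 e2 hxy
    rw [hxy, e2, mul_pow, mul_pow] at e1
    have hD := Del_pos ha (hS x hx).1.1
    simp only at hD
    exact (mul_left_cancel₀ (by positivity) e1).symm

theorem lintegral_fiber_le (hM : 0 < M) (ha : |a| ≤ M) (r pt pphi : ℝ)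
    (h : ℝ × ℝ × ℝ × ℝ → ENNReal) :
    ∫⁻ x in {x | (r, pt, pphi, x) ∈ reducedGamma M a}, h (r, constants M a (r, pt, pphi, x)) ≤
      2 * ∫⁻ m in {m | (r, m, -pt, pphi) ∈ radialSet M a},
        h (r, m, -pt, pphi) * massWeight M a (r, m, -pt, pphi) := by
  have ho : MeasurableSet {x | (r, pt, pphi, x) ∈ reducedGamma M a} :=
    ((isOpen_reducedGamma hM ha).preimage (by fun_prop : Continuous fun x : ℝ =>
      (r, pt, pphi, x))).measurableSet
  have hsub : {x | (r, pt, pphi, x) ∈ reducedGamma M a} ⊆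
      ({x | (r, pt, pphi, x) ∈ reducedGamma M a} ∩ Ici 0) ∪
      ({x | (r, pt, pphi, x) ∈ reducedGamma M a} ∩ Iic 0) := by
    intro x hx
    rcases le_total 0 x with h | h
    · exact Or.inl ⟨hx, h⟩
    · exact Or.inr ⟨hx, h⟩
  refine (lintegral_mono_set hsub).trans ((lintegral_union_le _ _ _).trans ?_)
  rw [two_mul]
  refine add_le_add ?_ ?_
  · refine lintegral_fiber_half_le hM ha r pt pphi (ho.inter measurableSet_Ici) ?_
      (fun x hx => hx.1) h
    rintro x ⟨-, hx⟩ y ⟨-, hy⟩ hxy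
    exact (sq_eq_sq₀ hx hy).1 hxy
  · refine lintegral_fiber_half_le hM ha r pt pphi (ho.inter measurableSet_Iic) ?_
      (fun x hx => hx.1) h
    rintro x ⟨-, hx⟩ y ⟨-, hy⟩ hxy
    have hx : x ≤ 0 := hx
    have hy : y ≤ 0 := hy
    have := (sq_eq_sq₀ (a := -x) (b := -y) (by linarith) (by linarith)).1 (by rw [neg_sq, neg_sq, hxy])
    linarith

/-- Change of variables from `(r, p_t, p_φ, p_r)` to `(r, m, E, L)`. -/
theorem lintegral_reducedGamma_le (hM : 0 < M) (ha : |a| ≤ M) {h : ℝ × ℝ × ℝ × ℝ → ENNReal}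
    (hh : Measurable h) :
    ∫⁻ y in reducedGamma M a, h (y.1, constants M a y) ≤
      2 * ∫⁻ x in radialSet M a, h x * massWeight M a x := by
  have hG := (isOpen_reducedGamma hM ha).measurableSet
  have hRd := (isOpen_radialSet (M := M) (a := a)).measurableSet
  set k : ℝ × ℝ × ℝ × ℝ → ENNReal := (radialSet M a).indicator fun x => h x * massWeight M a x
    with hk
  have hkm : Measurable k := (hh.mul measurable_massWeight).indicator hRd
  rw [← lintegral_indicator hG, ← lintegral_indicator hRd, ← hk]
  have hfib : ∀ r pt pphi : ℝ, ∫⁻ x, (reducedGamma M a).indicator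
      (fun y => h (y.1, constants M a y)) (r, pt, pphi, x) ≤ 2 * ∫⁻ m, k (r, m, -pt, pphi) := by
    intro r pt pphi
    have ho : MeasurableSet {x | (r, pt, pphi, x) ∈ reducedGamma M a} :=
      ((isOpen_reducedGamma hM ha).preimage (by fun_prop : Continuous fun x : ℝ =>
        (r, pt, pphi, x))).measurableSet
    have ho2 : MeasurableSet {m | (r, m, -pt, pphi) ∈ radialSet M a} :=
      (isOpen_radialSet.preimage (by fun_prop : Continuous fun m : ℝ =>
        (r, m, -pt, pphi))).measurableSet
    have := lintegral_fiber_le hM ha r pt pphi h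
    rw [← lintegral_indicator ho, ← lintegral_indicator ho2] at this
    exact this
  calc ∫⁻ y, (reducedGamma M a).indicator (fun y => h (y.1, constants M a y)) y
      ≤ ∫⁻ r, ∫⁻ pt, ∫⁻ pphi, ∫⁻ x, (reducedGamma M a).indicator
          (fun y => h (y.1, constants M a y)) (r, pt, pphi, x) := by
        refine (lintegral_prod_le _).trans ?_
        gcongr with r
        refine (lintegral_prod_le _).trans ?_
        gcongr with pt
        exact lintegral_prod_le _
    _ ≤ ∫⁻ r, ∫⁻ pt, ∫⁻ pphi, 2 * ∫⁻ m, k (r, m, -pt, pphi) := by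
        gcongr with r pt pphi
        exact hfib r pt pphi
    _ = 2 * ∫⁻ r, ∫⁻ pt, ∫⁻ pphi, ∫⁻ m, k (r, m, -pt, pphi) := by
        simp_rw [lintegral_const_mul' 2 _ (by norm_num)]
    _ = 2 * ∫⁻ r, ∫⁻ E, ∫⁻ L, ∫⁻ m, k (r, m, E, L) := by
        congr 2
        ext r
        exact lintegral_neg_eq_self (fun E => ∫⁻ L, ∫⁻ m, k (r, m, E, L))
    _ = 2 * ∫⁻ x, k x := by
        congr 1
        rw [Measure.volume_eq_prod, lintegral_prod _ hkm.aemeasurable]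
        congr 1
        ext r
        have h1 : Measurable fun x : ℝ × ℝ × ℝ => k (r, x) := by fun_prop
        rw [Measure.volume_eq_prod, lintegral_prod_symm _ h1.aemeasurable, Measure.volume_eq_prod,
          lintegral_prod _ (h1.lintegral_prod_left').aemeasurable]

/-- This is the arcsine density: the substitution by the cosine turns the integrand into 1 on `(0,
π)`. -/
theorem lintegral_inv_sqrt_le {r₁ r₂ : ℝ} (h : r₁ < r₂) :
    ∫⁻ r in Ioo r₁ r₂, ENNReal.ofReal (1 / Real.sqrt ((r - r₁) * (r₂ - r))) ≤
      ENNReal.ofReal Real.pi := by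
  set d := (r₂ - r₁) / 2 with hd
  have hd0 : 0 < d := by rw [hd]; linarith
  have hder : ∀ u, HasDerivAt (fun u => (r₁ + r₂) / 2 - d * Real.cos u) (d * Real.sin u) u := by
    intro u
    have := ((Real.hasDerivAt_cos u).const_mul d).const_sub ((r₁ + r₂) / 2)
    exact this.congr_deriv (by ring)
  have key := lintegral_image_eq_lintegral_abs_deriv_mul (s := Ioo 0 Real.pi) measurableSet_Ioo
    (fun u _ => (hder u).hasDerivWithinAt) ?_
    (fun r => ENNReal.ofReal (1 / Real.sqrt ((r - r₁) * (r₂ - r))))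
  · have hsub : Ioo r₁ r₂ ⊆ (fun u => (r₁ + r₂) / 2 - d * Real.cos u) '' Ioo 0 Real.pi := by
      intro r hr
      have h1 : -1 < ((r₁ + r₂) / 2 - r) / d := by
        rw [lt_div_iff₀ hd0, hd]; linarith [hr.2]
      have h2 : ((r₁ + r₂) / 2 - r) / d < 1 := by
        rw [div_lt_iff₀ hd0, hd]; linarith [hr.1]
      refine ⟨Real.arccos (((r₁ + r₂) / 2 - r) / d), ⟨Real.arccos_pos.2 h2, ?_⟩, ?_⟩
      · refine lt_of_le_of_ne (Real.arccos_le_pi _) fun h3 => ?_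
        rw [Real.arccos_eq_pi] at h3
        linarith
      · beta_reduce
        rw [Real.cos_arccos h1.le h2.le]
        field_simp
        ring
    refine (lintegral_mono_set hsub).trans ?_
    rw [key]
    have h3 : ∀ u ∈ Ioo 0 Real.pi, ENNReal.ofReal |d * Real.sin u| * ENNReal.ofReal
        (1 / Real.sqrt (((r₁ + r₂) / 2 - d * Real.cos u - r₁) *
          (r₂ - ((r₁ + r₂) / 2 - d * Real.cos u)))) = 1 := by
      intro u hu
      have hs := Real.sin_pos_of_pos_of_lt_pi hu.1 hu.2
      have h4 : ((r₁ + r₂) / 2 - d * Real.cos u - r₁) * (r₂ - ((r₁ + r₂) / 2 - d * Real.cos u)) =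
          (d * Real.sin u) ^ 2 := by
        have := Real.sin_sq_add_cos_sq u
        rw [hd]
        linear_combination (-((r₂ - r₁) / 2) ^ 2) * this
      rw [h4, Real.sqrt_sq (by positivity), ← ENNReal.ofReal_mul (abs_nonneg _),
        abs_of_pos (by positivity), mul_one_div_cancel (by positivity), ENNReal.ofReal_one]
    rw [setLIntegral_congr_fun measurableSet_Ioo h3]
    simp
  · intro x hx y hy hxy
    have : d * Real.cos x = d * Real.cos y := by simp only at hxy; linarith
    exact Real.injOn_cos ⟨hx.1.le, hx.2.le⟩ ⟨hy.1.le, hy.2.le⟩ (mul_left_cancel₀ hd0.ne' this)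

theorem lintegral_massWeight_le {p : ℝ × ℝ × ℝ} (hp : p ∈ boundSet M a) :
    ∫⁻ r in {r | (r, p) ∈ radialSet M a}, massWeight M a (r, p) ≤
      ENNReal.ofReal (p.1 * rOut M a p.1 p.2.1 p.2.2 ^ 2 / Real.sqrt ((p.1 ^ 2 - p.2.1 ^ 2) *
        rIn M a p.1 p.2.1 p.2.2 * (rIn M a p.1 p.2.1 p.2.2 - rLow M a p.1 p.2.1 p.2.2))) *
      ENNReal.ofReal Real.pi := by
  obtain ⟨hm, hk, h0, h01, h12, hH, hfac, -⟩ := IsBound.spec hp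
  set r₀ := rLow M a p.1 p.2.1 p.2.2
  set r₁ := rIn M a p.1 p.2.1 p.2.2
  set r₂ := rOut M a p.1 p.2.1 p.2.2
  have hset : {r | (r, p) ∈ radialSet M a} = Ioo r₁ r₂ := by
    ext r; exact ⟨fun h => h.2, fun h => ⟨hp, h⟩⟩
  rw [hset]
  refine le_trans ?_ (mul_le_mul_right (lintegral_inv_sqrt_le h12) _)
  rw [← lintegral_const_mul' _ _ ENNReal.ofReal_ne_top]
  refine setLIntegral_mono' measurableSet_Ioo fun r hr => ?_
  obtain ⟨hr1, hr2⟩ := hr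
  have hr1' : 0 < r₁ := h0.trans h01
  have hr0 : 0 < r := hr1'.trans hr1
  have e1 : 0 < p.1 ^ 2 - p.2.1 ^ 2 := by linarith
  have e2 : 0 < r₁ - r₀ := by linarith
  have e3 : 0 < (r - r₁) * (r₂ - r) := mul_pos (by linarith) (by linarith)
  have e4 : 0 < (p.1 ^ 2 - p.2.1 ^ 2) * r₁ * (r₁ - r₀) := by positivity
  rw [massWeight, ← ENNReal.ofReal_mul (by positivity)]
  apply ENNReal.ofReal_le_ofReal
  -- The factors of `R` that do not vanish at the turning points are increasing in `r`, so they are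
  -- bounded below by their values at `r₁`.
  have e5 : ((p.1 ^ 2 - p.2.1 ^ 2) * r₁ * (r₁ - r₀)) * ((r - r₁) * (r₂ - r)) ≤
      R M a p.1 p.2.1 p.2.2 r := by
    rw [hfac, mul_assoc _ (r - r₁)]
    gcongr
  have e6 := Real.sqrt_le_sqrt e5
  rw [Real.sqrt_mul e4.le] at e6
  have e7 := Real.sqrt_pos.2 e4
  have e8 := Real.sqrt_pos.2 e3
  calc p.1 * r ^ 2 / Real.sqrt (R M a p.1 p.2.1 p.2.2 r)
      ≤ p.1 * r₂ ^ 2 / (Real.sqrt ((p.1 ^ 2 - p.2.1 ^ 2) * r₁ * (r₁ - r₀)) *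
        Real.sqrt ((r - r₁) * (r₂ - r))) := by gcongr
    _ = _ := by field_simp

theorem exists_lintegral_massWeight_le {K : Set (ℝ × ℝ × ℝ)} (hK : IsCompact K)
    (hKB : K ⊆ boundSet M a) : ∃ C : ENNReal, C ≠ ⊤ ∧ ∀ p ∈ K,
      ∫⁻ r in {r | (r, p) ∈ radialSet M a}, massWeight M a (r, p) ≤ C := by
  have hc : ContinuousOn (fun p : ℝ × ℝ × ℝ => p.1 * rOut M a p.1 p.2.1 p.2.2 ^ 2 /
      Real.sqrt ((p.1 ^ 2 - p.2.1 ^ 2) * rIn M a p.1 p.2.1 p.2.2 *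
        (rIn M a p.1 p.2.1 p.2.2 - rLow M a p.1 p.2.1 p.2.2))) K := by
    have h0 := (contDiffOn_rLow (M := M) (a := a)).continuousOn.mono hKB
    have h1 := (contDiffOn_rIn (M := M) (a := a)).continuousOn.mono hKB
    have h2 := (contDiffOn_rOut (M := M) (a := a)).continuousOn.mono hKB
    have h3 : ContinuousOn (fun p : ℝ × ℝ × ℝ => p.1 ^ 2 - p.2.1 ^ 2) K := by fun_prop
    refine (continuousOn_fst.mul (h2.pow 2)).div ((h3.mul h1).mul (h1.sub h0)).sqrt fun p hp => ?_
    obtain ⟨hm, hk, h0, h01, h12, hH, hfac, -⟩ := IsBound.spec (hKB hp)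
    exact (Real.sqrt_pos.2 (mul_pos (mul_pos (by linarith) (by linarith)) (by linarith))).ne'
  obtain ⟨W, hW⟩ := hK.exists_bound_of_continuousOn hc
  refine ⟨ENNReal.ofReal W * ENNReal.ofReal Real.pi, by finiteness, fun p hp => ?_⟩
  refine (lintegral_massWeight_le (hKB hp)).trans ?_
  gcongr
  exact (le_abs_self _).trans (hW p hp)

/-- Points of the reduced phase space whose constants of motion belong to `K`. -/
def reducedGammaOver (M a : ℝ) (K : Set (ℝ × ℝ × ℝ)) : Set (ℝ × ℝ × ℝ × ℝ) :=
  reducedGamma M a ∩ constants M a ⁻¹' K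

theorem measurableSet_reducedGammaOver (hM : 0 < M) (ha : |a| ≤ M) {K : Set (ℝ × ℝ × ℝ)}
    (hK : IsClosed K) : MeasurableSet (reducedGammaOver M a K) := by
  have hc : ContinuousOn (constants M a) (reducedGamma M a) :=
    (continuousOn_constants hM ha).mono fun y hy => hy.1.1
  have h1 : IsOpen (reducedGamma M a ∩ constants M a ⁻¹' Kᶜ) :=
    hc.isOpen_inter_preimage (isOpen_reducedGamma hM ha) hK.isOpen_compl
  have h2 : reducedGammaOver M a K =
      reducedGamma M a \ (reducedGamma M a ∩ constants M a ⁻¹' Kᶜ) := by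
    ext y
    simp only [reducedGammaOver, mem_inter_iff, mem_preimage, Set.mem_sdiff, mem_compl_iff]
    tauto
  rw [h2]
  exact (isOpen_reducedGamma hM ha).measurableSet.diff h1.measurableSet

theorem aemeasurable_constants (hM : 0 < M) (ha : |a| ≤ M) {K : Set (ℝ × ℝ × ℝ)}
    (hK : IsClosed K) : AEMeasurable (constants M a) (volume.restrict (reducedGammaOver M a K)) :=
  ((continuousOn_constants hM ha).mono fun _ hy => hy.1.1.1).aemeasurable
    (measurableSet_reducedGammaOver hM ha hK)

/-- After the change of variables the constants of motion are coordinates, and their density is at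
most twice the `r`-integral of the weight, which is bounded uniformly on compact sets. The factor 2
accounts for the two signs of `p_r`. -/
theorem map_constants_le (hM : 0 < M) (ha : |a| ≤ M) {K : Set (ℝ × ℝ × ℝ)} (hK : IsCompact K)
    (hKB : K ⊆ boundSet M a) : ∃ C : ENNReal, C ≠ ⊤ ∧
      (volume.restrict (reducedGammaOver M a K)).map (constants M a) ≤ C • volume.restrict K := by
  obtain ⟨C, hC, hle⟩ := exists_lintegral_massWeight_le hK hKB
  refine ⟨2 * C, ENNReal.mul_ne_top (by norm_num) hC, Measure.le_iff.2 fun G hG => ?_⟩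
  have hm := measurableSet_reducedGammaOver hM ha hK.isClosed
  have hKG : MeasurableSet (K ∩ G) := hK.measurableSet.inter hG
  rw [← lintegral_indicator_one hG, lintegral_map' (measurable_one.indicator hG).aemeasurable
    (aemeasurable_constants hM ha hK.isClosed), Measure.smul_apply, Measure.restrict_apply hG,
    smul_eq_mul]
  have hhm : Measurable fun x : ℝ × ℝ × ℝ × ℝ => (K ∩ G).indicator (fun _ => (1 : ENNReal)) x.2 :=
    (measurable_const.indicator hKG).comp measurable_snd
  have hRd := (isOpen_radialSet (M := M) (a := a)).measurableSet
  calc ∫⁻ y in reducedGammaOver M a K, G.indicator 1 (constants M a y)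
      = ∫⁻ y in reducedGammaOver M a K,
          (K ∩ G).indicator (fun _ => (1 : ENNReal)) (constants M a y) := by
        refine setLIntegral_congr_fun hm fun y hy => ?_
        have hyK : constants M a y ∈ K := hy.2
        by_cases hyG : constants M a y ∈ G
        · rw [indicator_of_mem hyG, indicator_of_mem (mem_inter hyK hyG)]; rfl
        · rw [indicator_of_notMem hyG, indicator_of_notMem fun h => hyG h.2]
    _ ≤ ∫⁻ y in reducedGamma M a, (K ∩ G).indicator (fun _ => (1 : ENNReal)) (constants M a y) :=
        lintegral_mono_set inter_subset_left
    _ ≤ 2 * ∫⁻ x in radialSet M a, (K ∩ G).indicator (fun _ => (1 : ENNReal)) x.2 *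
          massWeight M a x := lintegral_reducedGamma_le hM ha hhm
    _ ≤ 2 * ∫⁻ p, (K ∩ G).indicator (fun _ => C) p := by
        gcongr
        rw [← lintegral_indicator hRd, Measure.volume_eq_prod, lintegral_prod_symm _
          ((Measurable.indicator (f := fun x => (K ∩ G).indicator (fun _ => (1 : ENNReal)) x.2 *
          massWeight M a x) (hhm.mul measurable_massWeight) hRd).aemeasurable)]
        gcongr with p
        by_cases hp : p ∈ K ∩ G
        · rw [indicator_of_mem hp]
          refine le_trans (le_of_eq ?_) (hle p hp.1)
          have ho : MeasurableSet {r | (r, p) ∈ radialSet M a} :=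
            (isOpen_radialSet.preimage (by fun_prop :
              Continuous fun r : ℝ => (r, p))).measurableSet
          rw [← lintegral_indicator ho]
          congr 1
          ext r
          by_cases hr : (r, p) ∈ radialSet M a
          · rw [indicator_of_mem hr, indicator_of_mem (show r ∈ {r | (r, p) ∈ radialSet M a} from hr),
              indicator_of_mem hp, one_mul]
          · rw [indicator_of_notMem hr,
              indicator_of_notMem (show r ∉ {r | (r, p) ∈ radialSet M a} from hr)]
        · rw [indicator_of_notMem hp]
          refine le_of_eq ?_
          rw [← lintegral_zero (μ := (volume : Measure ℝ))]
          congr 1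
          ext r
          by_cases hr : (r, p) ∈ radialSet M a
          · rw [indicator_of_mem hr, indicator_of_notMem hp, zero_mul]
          · rw [indicator_of_notMem hr]
    _ = 2 * C * volume (G ∩ K) := by
        rw [lintegral_indicator_const hKG, inter_comm, mul_assoc]

/-! ### Derivatives of the area and the frequencies -/

theorem contDiffOn_fderiv_apply {V : Type*} [NormedAddCommGroup V] [NormedSpace ℝ V] {f : V → ℝ}
    {U : Set V} (hU : IsOpen U) (hf : ContDiffOn ℝ (⊤ : ℕ∞) f U) (v : V) :
    ContDiffOn ℝ (⊤ : ℕ∞) (fun x => fderiv ℝ f x v) U :=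
  (hf.fderiv_of_isOpen hU (m := (⊤ : ℕ∞)) (by simp)).clm_apply contDiffOn_const

theorem deriv_comp_line {V : Type*} [NormedAddCommGroup V] [NormedSpace ℝ V] {f : V → ℝ}
    {U : Set V} (hU : IsOpen U) (hf : ContDiffOn ℝ (⊤ : ℕ∞) f U) {ℓ : ℝ → V} {v : V} {s : ℝ}
    (hs : ℓ s ∈ U) (hℓ : HasDerivAt ℓ v s) :
    HasDerivAt (fun t => f (ℓ t)) (fderiv ℝ f (ℓ s) v) s :=
  (((hf.contDiffAt (hU.mem_nhds hs)).differentiableAt (by simp)).hasFDerivAt).comp_hasDerivAt s hℓ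

/-- `∂A/∂m`. -/
noncomputable def areaM (M a : ℝ) (p : ℝ × ℝ × ℝ) : ℝ :=
  deriv (fun m' => area M a m' p.2.1 p.2.2) p.1

/-- `∂A/∂E`. -/
noncomputable def areaE (M a : ℝ) (p : ℝ × ℝ × ℝ) : ℝ :=
  deriv (fun E' => area M a p.1 E' p.2.2) p.2.1

/-- `∂A/∂L`. -/
noncomputable def areaL (M a : ℝ) (p : ℝ × ℝ × ℝ) : ℝ :=
  deriv (fun L' => area M a p.1 p.2.1 L') p.2.2

theorem hasDerivAt_line_m (p : ℝ × ℝ × ℝ) :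
    HasDerivAt (fun m' : ℝ => (m', p.2.1, p.2.2)) (1, 0, 0) p.1 :=
  (hasDerivAt_id p.1).prodMk ((hasDerivAt_const _ _).prodMk (hasDerivAt_const _ _))

theorem hasDerivAt_line_E (p : ℝ × ℝ × ℝ) :
    HasDerivAt (fun E' : ℝ => (p.1, E', p.2.2)) (0, 1, 0) p.2.1 :=
  (hasDerivAt_const _ _).prodMk ((hasDerivAt_id p.2.1).prodMk (hasDerivAt_const _ _))

theorem hasDerivAt_line_L (p : ℝ × ℝ × ℝ) :
    HasDerivAt (fun L' : ℝ => (p.1, p.2.1, L')) (0, 0, 1) p.2.2 :=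
  (hasDerivAt_const _ _).prodMk ((hasDerivAt_const _ _).prodMk (hasDerivAt_id p.2.2))

theorem contDiffOn_areaM (ha : |a| ≤ M) : ContDiffOn ℝ (⊤ : ℕ∞) (areaM M a) (boundSet M a) :=
  (contDiffOn_fderiv_apply isOpen_boundSet (contDiffOn_area ha) (1, 0, 0)).congr fun p hp =>
    (deriv_comp_line isOpen_boundSet (contDiffOn_area ha) (s := p.1) hp (hasDerivAt_line_m p)).deriv

theorem contDiffOn_areaE (ha : |a| ≤ M) : ContDiffOn ℝ (⊤ : ℕ∞) (areaE M a) (boundSet M a) :=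
  (contDiffOn_fderiv_apply isOpen_boundSet (contDiffOn_area ha) (0, 1, 0)).congr fun p hp =>
    (deriv_comp_line isOpen_boundSet (contDiffOn_area ha) (s := p.2.1) hp
      (hasDerivAt_line_E p)).deriv

theorem contDiffOn_areaL (ha : |a| ≤ M) : ContDiffOn ℝ (⊤ : ℕ∞) (areaL M a) (boundSet M a) :=
  (contDiffOn_fderiv_apply isOpen_boundSet (contDiffOn_area ha) (0, 0, 1)).congr fun p hp =>
    (deriv_comp_line isOpen_boundSet (contDiffOn_area ha) (s := p.2.2) hp
      (hasDerivAt_line_L p)).deriv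

theorem areaM_neg (hM : 0 < M) (ha : |a| ≤ M) {p : ℝ × ℝ × ℝ} (hp : p ∈ boundSet M a) :
    areaM M a p < 0 := (area_deriv_m_neg hM ha hp).2

theorem areaE_pos (hM : 0 < M) (ha : |a| ≤ M) {p : ℝ × ℝ × ℝ} (hp : p ∈ boundSet M a) :
    0 < areaE M a p := area_deriv_E_pos hM ha hp

theorem deriv_neg_sq_half (m : ℝ) : deriv (fun m' : ℝ => -(m' ^ 2) / 2) m = -m := by
  have : HasDerivAt (fun m' : ℝ => -(m' ^ 2) / 2) (-m) m := by
    have := ((hasDerivAt_pow 2 m).neg).div_const 2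
    refine this.congr_deriv ?_
    push_cast; ring
  exact this.deriv

/-- The Hamiltonian depends on `m` only, so its derivatives along `J₀` and `J₁` share the factor
`∂_m H / ∂_m A`, which cancels in the quotient. -/
theorem omega1_eq (hM : 0 < M) (ha : |a| ≤ M) {p : ℝ × ℝ × ℝ} (hp : p ∈ boundSet M a) :
    omega1 M a p.1 p.2.1 p.2.2 = areaL M a p / areaE M a p := by
  have h1 := (areaM_neg hM ha hp).ne
  have h2 := (areaE_pos hM ha hp).ne'
  have hm : p.1 ≠ 0 := hp.1.ne'
  unfold areaM at h1
  unfold areaE at h2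
  simp only [omega1, dJ1, dJ0, deriv_neg_sq_half, areaL, areaE, deriv_const]
  field_simp
  ring

theorem omega2_eq (hM : 0 < M) (ha : |a| ≤ M) {p : ℝ × ℝ × ℝ} (hp : p ∈ boundSet M a) :
    omega2 M a p.1 p.2.1 p.2.2 = -(2 * Real.pi) / areaE M a p := by
  have h1 := (areaM_neg hM ha hp).ne
  have h2 := (areaE_pos hM ha hp).ne'
  have hm : p.1 ≠ 0 := hp.1.ne'
  unfold areaM at h1
  unfold areaE at h2
  simp only [omega2, dJ2, dJ0, deriv_neg_sq_half, areaE, deriv_const]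
  field_simp
  ring

/-! ### Exchanging the mass for the radial action -/

/-- The actions `(J₀, J₁, J₂)`. -/
noncomputable def actions (M a : ℝ) (p : ℝ × ℝ × ℝ) : ℝ × ℝ × ℝ :=
  (p.2.1, p.2.2, area M a p.1 p.2.1 p.2.2 / (2 * Real.pi))

theorem continuousOn_actions (ha : |a| ≤ M) : ContinuousOn (actions M a) (boundSet M a) :=
  (continuous_fst.comp continuous_snd).continuousOn.prodMk
    ((continuous_snd.comp continuous_snd).continuousOn.prodMk
      ((contDiffOn_area ha).continuousOn.div_const _))

/-- The coordinates `E` and `L` are kept, and for fixed `E, L` the map `m ↦ A/2π` is strictly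
decreasing with slope at least `c/2π` in absolute value. The ball is a product in the sup norm, so
its `m`-fibres are intervals and a substitution in one variable is enough. -/
theorem lintegral_actions_ball_le (ha : |a| ≤ M) {p₀ : ℝ × ℝ × ℝ} {ε c : ℝ}
    (hε : Metric.ball p₀ ε ⊆ boundSet M a) (hc : 0 < c)
    (hA : ∀ p ∈ Metric.ball p₀ ε, areaM M a p < -c) {h : ℝ × ℝ × ℝ → ENNReal} (hh : Measurable h) :
    ∫⁻ p in Metric.ball p₀ ε, h (actions M a p) ≤
      (ENNReal.ofReal (c / (2 * Real.pi)))⁻¹ * ∫⁻ y, h y := by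
  have hpi := Real.pi_pos
  set κ := ENNReal.ofReal (c / (2 * Real.pi)) with hκ
  have hκ0 : κ ≠ 0 := (ENNReal.ofReal_pos.2 (by positivity)).ne'
  have hfib : ∀ E L : ℝ, (E, L) ∈ Metric.ball p₀.2 ε →
      ∫⁻ m in Metric.ball p₀.1 ε, h (actions M a (m, E, L)) ≤ κ⁻¹ * ∫⁻ j, h (E, L, j) := by
    intro E L hEL
    have hmem : ∀ m ∈ Metric.ball p₀.1 ε, (m, E, L) ∈ Metric.ball p₀ ε := by
      intro m hm
      rw [show p₀ = (p₀.1, p₀.2) from rfl, ← ball_prod_same]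
      exact ⟨hm, hEL⟩
    have hder : ∀ m ∈ Metric.ball p₀.1 ε, HasDerivAt
        (fun m' => area M a m' E L / (2 * Real.pi)) (areaM M a (m, E, L) / (2 * Real.pi)) m := by
      intro m hm
      have hd := deriv_comp_line isOpen_boundSet (contDiffOn_area ha) (s := m)
        (hε (hmem m hm)) (hasDerivAt_line_m (m, E, L))
      have := hd.differentiableAt.hasDerivAt.div_const (2 * Real.pi)
      exact this
    have hanti : StrictAntiOn (fun m' => area M a m' E L / (2 * Real.pi)) (Metric.ball p₀.1 ε) := by
      apply strictAntiOn_of_deriv_neg (convex_ball _ _)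
      · exact fun m hm => (hder m hm).continuousAt.continuousWithinAt
      · intro m hm
        rw [Metric.isOpen_ball.interior_eq] at hm
        rw [(hder m hm).deriv]
        exact div_neg_of_neg_of_pos ((hA _ (hmem m hm)).trans (by linarith)) (by positivity)
    have key := lintegral_image_eq_lintegral_abs_deriv_mul
      (Metric.isOpen_ball (x := p₀.1) (ε := ε)).measurableSet
      (fun m hm => (hder m hm).hasDerivWithinAt) hanti.injOn (fun j => h (E, L, j))
    have h1 : κ * ∫⁻ m in Metric.ball p₀.1 ε, h (actions M a (m, E, L)) ≤ ∫⁻ j, h (E, L, j) := by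
      rw [← lintegral_const_mul' _ _ ENNReal.ofReal_ne_top]
      refine le_trans ?_ (setLIntegral_le_lintegral
        ((fun m' => area M a m' E L / (2 * Real.pi)) '' Metric.ball p₀.1 ε) _)
      rw [key]
      refine setLIntegral_mono' Metric.isOpen_ball.measurableSet fun m hm => ?_
      simp only [actions]
      gcongr
      have h2 := hA _ (hmem m hm)
      rw [abs_div, abs_of_neg (by linarith), abs_of_pos (by positivity : 0 < 2 * Real.pi)]
      gcongr
      linarith
    calc _ = κ⁻¹ * (κ * ∫⁻ m in Metric.ball p₀.1 ε, h (actions M a (m, E, L))) := by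
          rw [← mul_assoc, ENNReal.inv_mul_cancel hκ0 ENNReal.ofReal_ne_top, one_mul]
      _ ≤ _ := by gcongr
  have hball : Metric.ball p₀ ε = Metric.ball p₀.1 ε ×ˢ Metric.ball p₀.2 ε :=
    (ball_prod_same p₀.1 p₀.2 ε).symm
  have hm : AEMeasurable (fun p => h (actions M a p)) (volume.restrict (Metric.ball p₀ ε)) :=
    hh.comp_aemeasurable (((continuousOn_actions ha).mono hε).aemeasurable
      Metric.isOpen_ball.measurableSet)
  rw [hball, Measure.volume_eq_prod] at hm ⊢
  rw [← Measure.prod_restrict] at hm ⊢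
  rw [lintegral_prod_symm _ hm]
  calc ∫⁻ q in Metric.ball p₀.2 ε, ∫⁻ m in Metric.ball p₀.1 ε, h (actions M a (m, q))
      ≤ ∫⁻ q in Metric.ball p₀.2 ε, κ⁻¹ * ∫⁻ j, h (q.1, q.2, j) :=
        setLIntegral_mono' Metric.isOpen_ball.measurableSet fun q hq => hfib q.1 q.2 hq
    _ ≤ ∫⁻ q : ℝ × ℝ, κ⁻¹ * ∫⁻ j, h (q.1, q.2, j) := setLIntegral_le_lintegral _ _
    _ = κ⁻¹ * ∫⁻ y, h y := by
        have h1 : Measurable fun z : (ℝ × ℝ) × ℝ => h (z.1.1, z.1.2, z.2) := by fun_prop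
        rw [lintegral_const_mul _ (by exact h1.lintegral_prod_right')]
        congr 1
        have hmp := (measurePreserving_prodAssoc (volume : Measure ℝ) (volume : Measure ℝ)
          (volume : Measure ℝ)).lintegral_comp hh
        change _ = ∫⁻ y, h y ∂((volume : Measure ℝ).prod ((volume : Measure ℝ).prod volume))
        rw [← hmp, lintegral_prod _ (by exact h1.aemeasurable)]
        rfl

theorem exists_lintegral_actions_le (hM : 0 < M) (ha : |a| ≤ M) {K : Set (ℝ × ℝ × ℝ)}
    (hK : IsCompact K) (hKB : K ⊆ boundSet M a) : ∃ C : ENNReal, C ≠ ⊤ ∧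
      ∀ h : ℝ × ℝ × ℝ → ENNReal, Measurable h → ∫⁻ p in K, h (actions M a p) ≤ C * ∫⁻ y, h y := by
  refine hK.induction_on (p := fun s => ∃ C : ENNReal, C ≠ ⊤ ∧ ∀ h : ℝ × ℝ × ℝ → ENNReal,
    Measurable h → ∫⁻ p in s, h (actions M a p) ≤ C * ∫⁻ y, h y) ?_ ?_ ?_ ?_
  · exact ⟨0, by simp, fun h _ => by simp⟩
  · rintro s t hst ⟨C, hC, hle⟩
    exact ⟨C, hC, fun h hh => (lintegral_mono_set hst).trans (hle h hh)⟩
  · rintro s t ⟨C, hC, hle⟩ ⟨C', hC', hle'⟩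
    refine ⟨C + C', by finiteness, fun h hh => (lintegral_union_le _ _ _).trans ?_⟩
    rw [add_mul]
    exact add_le_add (hle h hh) (hle' h hh)
  · intro p hp
    have hneg := areaM_neg hM ha (hKB hp)
    have hcont := (contDiffOn_areaM ha).continuousOn.continuousAt
      (isOpen_boundSet.mem_nhds (hKB hp))
    have h1 : ∀ᶠ q in 𝓝 p, q ∈ boundSet M a ∧ areaM M a q < -(-areaM M a p / 2) :=
      Filter.Eventually.and
        (show ∀ᶠ q in 𝓝 p, q ∈ boundSet M a from isOpen_boundSet.mem_nhds (hKB hp))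
        (hcont.eventually_lt_const (by linarith))
    obtain ⟨ε, hε, hball⟩ := Metric.eventually_nhds_iff_ball.1 h1
    refine ⟨Metric.ball p ε, mem_nhdsWithin_of_mem_nhds (Metric.ball_mem_nhds p hε),
      (ENNReal.ofReal (-areaM M a p / 2 / (2 * Real.pi)))⁻¹, ?_, fun h hh =>
      lintegral_actions_ball_le ha (fun q hq => (hball q hq).1) (by linarith)
        (fun q hq => (hball q hq).2) hh⟩
    have := Real.pi_pos
    rw [ne_eq, ENNReal.inv_eq_top]
    exact (ENNReal.ofReal_pos.2 (by apply div_pos <;> linarith)).ne'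

theorem map_actions_le (hM : 0 < M) (ha : |a| ≤ M) {K : Set (ℝ × ℝ × ℝ)}
    (hK : IsCompact K) (hKB : K ⊆ boundSet M a) : ∃ C : ENNReal, C ≠ ⊤ ∧
      (volume.restrict K).map (actions M a) ≤ C • volume.restrict (actions M a '' K) := by
  obtain ⟨C, hC, hle⟩ := exists_lintegral_actions_le hM ha hK hKB
  refine ⟨C, hC, Measure.le_iff.2 fun G hG => ?_⟩
  have hcont := (continuousOn_actions ha).mono hKB
  have hI : MeasurableSet (actions M a '' K) := (hK.image_of_continuousOn hcont).measurableSet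
  rw [← lintegral_indicator_one hG, lintegral_map' (measurable_one.indicator hG).aemeasurable
    (hcont.aemeasurable hK.measurableSet), Measure.smul_apply, Measure.restrict_apply hG,
    smul_eq_mul]
  calc ∫⁻ p in K, G.indicator 1 (actions M a p)
      = ∫⁻ p in K, (G ∩ actions M a '' K).indicator 1 (actions M a p) := by
        refine setLIntegral_congr_fun hK.measurableSet fun p hp => ?_
        by_cases hpG : actions M a p ∈ G
        · rw [indicator_of_mem hpG, indicator_of_mem (mem_inter hpG (mem_image_of_mem _ hp))]
        · rw [indicator_of_notMem hpG, indicator_of_notMem fun h => hpG h.1]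
    _ ≤ _ := by
        refine (hle _ (measurable_one.indicator (hG.inter hI))).trans_eq ?_
        rw [lintegral_indicator_one (hG.inter hI)]

/-! ### Resonances and the Hessian of the area -/

/-- The combination `k (ω¹ + Ω) + l ω²` of the frequencies. -/
noncomputable def resonance (M a k l Ω : ℝ) (p : ℝ × ℝ × ℝ) : ℝ :=
  k * (areaL M a p / areaE M a p + Ω) + l * (-(2 * Real.pi) / areaE M a p)

theorem contDiffOn_resonance (hM : 0 < M) (ha : |a| ≤ M) (k l Ω : ℝ) :
    ContDiffOn ℝ (⊤ : ℕ∞) (resonance M a k l Ω) (boundSet M a) := by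
  have h : ∀ p ∈ boundSet M a, areaE M a p ≠ 0 := fun p hp => (areaE_pos hM ha hp).ne'
  exact (contDiffOn_const.mul (((contDiffOn_areaL ha).div (contDiffOn_areaE ha) h).add
    contDiffOn_const)).add (contDiffOn_const.mul (contDiffOn_const.div (contDiffOn_areaE ha) h))

theorem hasDerivAt_resonance_line (hM : 0 < M) (ha : |a| ≤ M) (k l Ω : ℝ) {ℓ : ℝ → ℝ × ℝ × ℝ}
    {v : ℝ × ℝ × ℝ} {s : ℝ} (hs : ℓ s ∈ boundSet M a) (hℓ : HasDerivAt ℓ v s) :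
    HasDerivAt (fun t => resonance M a k l Ω (ℓ t))
      ((k * deriv (fun t => areaL M a (ℓ t)) s + (2 * Real.pi * l - k * areaL M a (ℓ s)) /
        areaE M a (ℓ s) * deriv (fun t => areaE M a (ℓ t)) s) / areaE M a (ℓ s)) s := by
  have h1 := (deriv_comp_line isOpen_boundSet (contDiffOn_areaL ha) hs hℓ).differentiableAt.hasDerivAt
  have h2 := (deriv_comp_line isOpen_boundSet (contDiffOn_areaE ha) hs hℓ).differentiableAt.hasDerivAt
  have h3 := (areaE_pos hM ha hs).ne'
  have := (((h1.div h2 h3).add_const Ω).const_mul k).add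
    (((hasDerivAt_const s (-(2 * Real.pi))).div h2 h3).const_mul l)
  refine this.congr_deriv ?_
  field_simp
  ring

theorem deriv_resonance_ne_zero (hM : 0 < M) (ha : |a| ≤ M) {k l : ℝ} (Ω : ℝ)
    (hkl : k ≠ 0 ∨ l ≠ 0) {p : ℝ × ℝ × ℝ} (hp : p ∈ boundSet M a)
    (hdet : (areaHessian M a p.1 p.2.1 p.2.2).det ≠ 0) :
    (∃ d ≠ 0, HasDerivAt (fun E => resonance M a k l Ω (p.1, E, p.2.2)) d p.2.1) ∨
    (∃ d ≠ 0, HasDerivAt (fun L => resonance M a k l Ω (p.1, p.2.1, L)) d p.2.2) := by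
  by_contra hcon
  push Not at hcon
  obtain ⟨hE, hL⟩ := hcon
  have h1 := hasDerivAt_resonance_line hM ha k l Ω (s := p.2.1) hp (hasDerivAt_line_E p)
  have h2 := hasDerivAt_resonance_line hM ha k l Ω (s := p.2.2) hp (hasDerivAt_line_L p)
  have h3 := (areaE_pos hM ha hp).ne'
  have e1 := not_not.1 fun hd => hE _ hd h1
  have e2 := not_not.1 fun hd => hL _ hd h2
  simp only [div_eq_zero_iff, Prod.mk.eta, h3, or_false] at e1 e2
  apply hdet
  rw [areaHessian, Matrix.det_fin_two_of]
  change k * deriv (fun E' => deriv (fun L' => area M a p.1 E' L') p.2.2) p.2.1 +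
    _ * deriv (fun E' => deriv (fun E'' => area M a p.1 E'' p.2.2) E') p.2.1 = 0 at e1
  change k * deriv (fun L' => deriv (fun L'' => area M a p.1 p.2.1 L'') L') p.2.2 +
    _ * deriv (fun L' => deriv (fun E' => area M a p.1 E' L') p.2.1) p.2.2 = 0 at e2
  -- The vanishing of both derivatives says that the vector `(c, k)` is annihilated by the Hessian.
  -- It is nonzero, since `k = 0` leaves `c = 2πl/A_E`. Eliminating one component gives a vanishing
  -- determinant without using symmetry of the mixed derivatives.
  set c := (2 * Real.pi * l - k * areaL M a p) / areaE M a p with hc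
  set H00 := deriv (fun E' => deriv (fun E'' => area M a p.1 E'' p.2.2) E') p.2.1
  set H01 := deriv (fun E' => deriv (fun L' => area M a p.1 E' L') p.2.2) p.2.1
  set H10 := deriv (fun L' => deriv (fun E' => area M a p.1 E' L') p.2.1) p.2.2
  set H11 := deriv (fun L' => deriv (fun L'' => area M a p.1 p.2.1 L'') L') p.2.2
  by_cases hk : k = 0
  · have hl : l ≠ 0 := hkl.resolve_left (not_not.2 hk)
    have hc0 : c ≠ 0 := by
      rw [hc, hk]
      have := Real.pi_ne_zero
      simp [h3, hl, this]
    apply mul_left_cancel₀ hc0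
    linear_combination H11 * e1 - H01 * e2
  · apply mul_left_cancel₀ hk
    linear_combination H00 * e2 - H10 * e1

theorem measurableSet_inter_preimage {X Y : Type*} [TopologicalSpace X] [MeasurableSpace X]
    [OpensMeasurableSpace X] [TopologicalSpace Y] [MeasurableSpace Y] [BorelSpace Y] {s : Set X}
    {t : Set Y} {f : X → Y} (hs : MeasurableSet s) (hf : ContinuousOn f s) (ht : MeasurableSet t) :
    MeasurableSet (s ∩ f ⁻¹' t) := by
  have h := hs.subtype_image (hf.domRestrict.measurable ht)
  rwa [← Subtype.image_preimage_coe]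

/-- At each point of `K` the derivative in `E` or in `L` is nonzero. On each of the two parts,
Fubini along the corresponding coordinate lines reduces the claim to one variable; `m` is only a
parameter. -/
theorem volume_resonance_eq_zero (hM : 0 < M) (ha : |a| ≤ M) {k l : ℝ} (Ω : ℝ)
    (hkl : k ≠ 0 ∨ l ≠ 0) {K : Set (ℝ × ℝ × ℝ)} (hK : IsCompact K) (hKB : K ⊆ boundSet M a)
    (hdet : ∀ p ∈ K, (areaHessian M a p.1 p.2.1 p.2.2).det ≠ 0) {N : Set ℝ} (hN : volume N = 0) :
    volume (K ∩ resonance M a k l Ω ⁻¹' N) = 0 := by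
  have hsm := contDiffOn_resonance hM ha k l Ω
  -- Continuity of the directional derivatives makes the two parts measurable; together with a
  -- measurable hull of `N` this permits the use of Fubini.
  have hD : ∀ v, ContinuousOn (fun p => fderiv ℝ (resonance M a k l Ω) p v) K := fun v =>
    (contDiffOn_fderiv_apply isOpen_boundSet hsm v).continuousOn.mono hKB
  have hmeas : ∀ v, MeasurableSet (K ∩ resonance M a k l Ω ⁻¹' toMeasurable volume N ∩
      (K ∩ (fun p => fderiv ℝ (resonance M a k l Ω) p v) ⁻¹' {0}ᶜ)) := by
    intro v
    refine MeasurableSet.inter ?_ ?_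
    · exact measurableSet_inter_preimage hK.measurableSet (hsm.continuousOn.mono hKB)
        (measurableSet_toMeasurable _ _)
    · exact measurableSet_inter_preimage hK.measurableSet (hD v) (measurableSet_singleton _).compl
  have hN' : volume (toMeasurable volume N) = 0 := by rw [measure_toMeasurable, hN]
  have hsub : K ∩ resonance M a k l Ω ⁻¹' N ⊆
      (K ∩ resonance M a k l Ω ⁻¹' toMeasurable volume N ∩
        (K ∩ (fun p => fderiv ℝ (resonance M a k l Ω) p (0, 1, 0)) ⁻¹' {0}ᶜ)) ∪
      (K ∩ resonance M a k l Ω ⁻¹' toMeasurable volume N ∩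
        (K ∩ (fun p => fderiv ℝ (resonance M a k l Ω) p (0, 0, 1)) ⁻¹' {0}ᶜ)) := by
    rintro p ⟨hp, hpN⟩
    have h0 : p ∈ K ∩ resonance M a k l Ω ⁻¹' toMeasurable volume N :=
      ⟨hp, subset_toMeasurable _ _ hpN⟩
    rcases deriv_resonance_ne_zero hM ha Ω hkl (hKB hp) (hdet p hp) with ⟨d, hd, h⟩ | ⟨d, hd, h⟩
    · refine Or.inl ⟨h0, hp, ?_⟩
      have := deriv_comp_line isOpen_boundSet hsm (s := p.2.1) (hKB hp) (hasDerivAt_line_E p)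
      have e := this.unique h
      simp only [mem_preimage, mem_compl_iff, mem_singleton_iff]
      exact fun h' => hd (e.symm.trans h')
    · refine Or.inr ⟨h0, hp, ?_⟩
      have := deriv_comp_line isOpen_boundSet hsm (s := p.2.2) (hKB hp) (hasDerivAt_line_L p)
      have e := this.unique h
      simp only [mem_preimage, mem_compl_iff, mem_singleton_iff]
      exact fun h' => hd (e.symm.trans h')
  refine measure_mono_null hsub (measure_union_null ?_ ?_)
  · rw [Measure.volume_eq_prod, Measure.measure_prod_null (hmeas _)]
    refine Eventually.of_forall fun m => ?_
    have hm := measurable_prodMk_left (x := m) (hmeas (0, 1, 0))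
    change volume _ = 0
    rw [Measure.volume_eq_prod, Measure.prod_apply_symm hm, ← lintegral_zero (μ := (volume : Measure ℝ))]
    congr 1 with L
    refine measure_mono_null ?_ (volume_inter_preimage_eq_zero
      (g := fun E => resonance M a k l Ω (m, E, L)) (s := {E | (m, E, L) ∈ K ∧
        fderiv ℝ (resonance M a k l Ω) (m, E, L) (0, 1, 0) ≠ 0}) ?_ hN')
    · rintro E ⟨⟨h1, h2⟩, -, h3⟩
      exact ⟨⟨h1, h3⟩, h2⟩
    · rintro E ⟨h1, h3⟩
      exact ⟨_, h3, deriv_comp_line isOpen_boundSet hsm (s := E) (hKB h1)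
        (hasDerivAt_line_E (m, E, L))⟩
  · rw [Measure.volume_eq_prod, Measure.measure_prod_null (hmeas _)]
    refine Eventually.of_forall fun m => ?_
    have hm := measurable_prodMk_left (x := m) (hmeas (0, 0, 1))
    change volume _ = 0
    rw [Measure.volume_eq_prod, Measure.measure_prod_null hm]
    refine Eventually.of_forall fun E => ?_
    refine measure_mono_null ?_ (volume_inter_preimage_eq_zero
      (g := fun L => resonance M a k l Ω (m, E, L)) (s := {L | (m, E, L) ∈ K ∧
        fderiv ℝ (resonance M a k l Ω) (m, E, L) (0, 0, 1) ≠ 0}) ?_ hN')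
    · rintro L ⟨⟨h1, h2⟩, -, h3⟩
      exact ⟨⟨h1, h3⟩, h2⟩
    · rintro L ⟨h1, h3⟩
      exact ⟨_, h3, deriv_comp_line isOpen_boundSet hsm (s := L) (hKB h1)
        (hasDerivAt_line_L (m, E, L))⟩

/-! ### Bounded density of angles and actions -/

/-- Domination of the push-forward of a measure under angle and action variables depending
linearly on a bounded time. -/
theorem map_angles_le {Z Y : Type*} [MeasurableSpace Z] [MeasurableSpace Y] {ρ : Measure Z}
    [SFinite ρ] {ν : Measure Y} [SFinite ν] {w₁ w₂ c₁ c₂ : Z → ℝ} {J : Z → Y}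
    (hw₁ : AEMeasurable w₁ ρ) (hw₂ : AEMeasurable w₂ ρ) (hc₁ : AEMeasurable c₁ ρ)
    (hc₂ : AEMeasurable c₂ ρ) (hJ : AEMeasurable J ρ) {T : ℝ} (hT : 0 ≤ T) {C C' : ENNReal}
    (hC : ∀ᵐ z ∂ρ, w₂ z ≠ 0 ∧ ENNReal.ofReal (T / Real.pi + 1 / |w₂ z|) ≤ C)
    (hJν : ρ.map J ≤ C' • ν) :
    AEMeasurable (fun x : ℝ × S1 × Z => ((x.2.1 + ((w₁ x.2.2 * x.1 : ℝ) : S1) +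
      ((c₁ x.2.2 : ℝ) : S1), ((w₂ x.2.2 * x.1 : ℝ) : S1) + ((c₂ x.2.2 : ℝ) : S1), J x.2.2) : S1 × S1 × Y))
      ((volume.restrict (Icc (-T) T)).prod (volume.prod ρ)) ∧
    ((volume.restrict (Icc (-T) T)).prod (volume.prod ρ)).map
      (fun x : ℝ × S1 × Z => ((x.2.1 + ((w₁ x.2.2 * x.1 : ℝ) : S1) +
        ((c₁ x.2.2 : ℝ) : S1), ((w₂ x.2.2 * x.1 : ℝ) : S1) + ((c₂ x.2.2 : ℝ) : S1), J x.2.2) : S1 × S1 × Y)) ≤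
      (C * C') • (volume : Measure S1).prod ((volume : Measure S1).prod ν) := by
  set κ := (volume.restrict (Icc (-T) T)).prod ((volume : Measure S1).prod ρ) with hκ
  set Φ := fun x : ℝ × S1 × Z => ((x.2.1 + ((w₁ x.2.2 * x.1 : ℝ) : S1) +
      ((c₁ x.2.2 : ℝ) : S1), ((w₂ x.2.2 * x.1 : ℝ) : S1) + ((c₂ x.2.2 : ℝ) : S1), J x.2.2) : S1 × S1 × Y)
    with hΦ
  have hcoe : Measurable ((↑) : ℝ → S1) := (AddCircle.continuous_mk' _).measurable
  have hq : Measure.QuasiMeasurePreserving (fun x : ℝ × S1 × Z => x.2.2) κ ρ :=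
    Measure.quasiMeasurePreserving_snd.comp Measure.quasiMeasurePreserving_snd
  have hΦm : AEMeasurable Φ κ := by
    refine AEMeasurable.prodMk ?_ (AEMeasurable.prodMk ?_ (hJ.comp_quasiMeasurePreserving hq))
    · exact ((measurable_fst.comp measurable_snd).aemeasurable.add (hcoe.comp_aemeasurable
        ((hw₁.comp_quasiMeasurePreserving hq).mul measurable_fst.aemeasurable))).add
        (hcoe.comp_aemeasurable (hc₁.comp_quasiMeasurePreserving hq))
    · exact (hcoe.comp_aemeasurable
        ((hw₂.comp_quasiMeasurePreserving hq).mul measurable_fst.aemeasurable)).add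
        (hcoe.comp_aemeasurable (hc₂.comp_quasiMeasurePreserving hq))
  refine ⟨hΦm, Measure.le_iff.2 fun G hG => ?_⟩
  set g : S1 × S1 × Y → ENNReal := G.indicator 1 with hg
  have hgm : Measurable g := measurable_one.indicator hG
  have hgΦ : AEMeasurable (fun x => g (Φ x)) κ := hgm.comp_aemeasurable hΦm
  have hassoc : Measurable fun z : (S1 × S1) × Y => g (z.1.1, z.1.2, z.2) := by fun_prop
  have hgi : Measurable fun y => ∫⁻ q : S1 × S1, g (q.1, q.2, y) := hassoc.lintegral_prod_left'
  rw [← lintegral_indicator_one hG, ← hg, lintegral_map' hgm.aemeasurable hΦm, hκ,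
    lintegral_prod_symm _ hgΦ, lintegral_prod_symm _ (by exact hgΦ.lintegral_prod_left')]
  calc ∫⁻ z, (∫⁻ ϕ : S1, ∫⁻ t in Icc (-T) T, g (Φ (t, ϕ, z))) ∂ρ
      ≤ ∫⁻ z, (C * ∫⁻ q : S1 × S1, g (q.1, q.2, J z)) ∂ρ := by
        refine lintegral_mono_ae ?_
        filter_upwards [hC] with z hz
        have hgz : Measurable fun q : S1 × S1 => g (q.1, q.2, J z) := by fun_prop
        have hsw : Measurable fun x : S1 × ℝ => g (Φ (x.2, x.1, z)) := by
          simp only [hΦ]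
          refine hgm.comp (Measurable.prodMk ?_ (Measurable.prodMk ?_ measurable_const))
          · exact (measurable_fst.add (hcoe.comp (measurable_snd.const_mul _))).add
              measurable_const
          · exact (hcoe.comp (measurable_snd.const_mul _)).add measurable_const
        -- With `z` frozen the angles are affine in `t`; the integral over `ϕ` is moved inside so
        -- that the estimate for lines on the torus applies.
        rw [lintegral_lintegral_swap (f := fun ϕ t => g (Φ (t, ϕ, z))) hsw.aemeasurable]
        exact (lintegral_torus_line_le (w₁ := w₁ z) hgz hz.1 hT (c₁ z : S1) (c₂ z : S1)).trans (mul_le_mul_left hz.2 _)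
    _ = C * ∫⁻ y, (∫⁻ q : S1 × S1, g (q.1, q.2, y)) ∂(ρ.map J) := by
        rw [lintegral_map' hgi.aemeasurable hJ, lintegral_const_mul'' _
          (by exact hgi.comp_aemeasurable hJ)]
    _ ≤ C * ∫⁻ y, (∫⁻ q : S1 × S1, g (q.1, q.2, y)) ∂(C' • ν) := by
        gcongr
    _ = C * C' * (volume : Measure S1).prod ((volume : Measure S1).prod ν) G := by
        rw [lintegral_smul_measure, smul_eq_mul, mul_assoc]
        congr 2
        have hmp := (measurePreserving_prodAssoc (volume : Measure S1) (volume : Measure S1)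
          ν).lintegral_comp hgm
        rw [← lintegral_indicator_one hG, ← hg, ← hmp]
        exact (lintegral_prod_symm' _ hassoc).symm

/-! ### The angle variables and their offsets -/

/-- The sign of `p_r` enters linearly, so continuity has to be proved for one branch only and the
sign contributes just a measurable factor. -/
theorem dJ0_radialAction (r σ m E L : ℝ) : dJ0 M a (radialAction M a r σ) m E L =
    σ * dJ0 M a (radialAction M a r 1) m E L := by
  simp only [dJ0, radialAction, one_mul, deriv_const_mul_field]
  ring

theorem dJ1_radialAction (r σ m E L : ℝ) : dJ1 M a (radialAction M a r σ) m E L =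
    σ * dJ1 M a (radialAction M a r 1) m E L := by
  simp only [dJ1, radialAction, one_mul, deriv_const_mul_field]
  ring

theorem dJ2_radialAction (r σ m E L : ℝ) : dJ2 M a (radialAction M a r σ) m E L =
    σ * dJ2 M a (radialAction M a r 1) m E L := by
  simp only [dJ2, radialAction, one_mul, deriv_const_mul_field]
  ring

theorem continuousOn_deriv_radialAction (ha : |a| ≤ M) :
    ContinuousOn (fun x : ℝ × ℝ × ℝ × ℝ =>
      deriv (fun m' => radialAction M a x.1 1 m' x.2.2.1 x.2.2.2) x.2.1) (radialSet M a) ∧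
    ContinuousOn (fun x : ℝ × ℝ × ℝ × ℝ =>
      deriv (fun E' => radialAction M a x.1 1 x.2.1 E' x.2.2.2) x.2.2.1) (radialSet M a) ∧
    ContinuousOn (fun x : ℝ × ℝ × ℝ × ℝ =>
      deriv (fun L' => radialAction M a x.1 1 x.2.1 x.2.2.1 L') x.2.2.2) (radialSet M a) := by
  have h := contDiffOn_radialAction ha 1
  refine ⟨?_, ?_, ?_⟩
  · exact (contDiffOn_fderiv_apply isOpen_radialSet h (0, 1, 0, 0)).continuousOn.congr fun x hx =>
      (deriv_comp_line isOpen_radialSet h (s := x.2.1) hx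
        ((hasDerivAt_const _ x.1).prodMk (hasDerivAt_line_m x.2))).deriv
  · exact (contDiffOn_fderiv_apply isOpen_radialSet h (0, 0, 1, 0)).continuousOn.congr fun x hx =>
      (deriv_comp_line isOpen_radialSet h (s := x.2.2.1) hx
        ((hasDerivAt_const _ x.1).prodMk (hasDerivAt_line_E x.2))).deriv
  · exact (contDiffOn_fderiv_apply isOpen_radialSet h (0, 0, 0, 1)).continuousOn.congr fun x hx =>
      (deriv_comp_line isOpen_radialSet h (s := x.2.2.2) hx
        ((hasDerivAt_const _ x.1).prodMk (hasDerivAt_line_L x.2))).deriv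

theorem continuousOn_dJ_radialAction (hM : 0 < M) (ha : |a| ≤ M) :
    ContinuousOn (fun x : ℝ × ℝ × ℝ × ℝ =>
      dJ0 M a (radialAction M a x.1 1) x.2.1 x.2.2.1 x.2.2.2) (radialSet M a) ∧
    ContinuousOn (fun x : ℝ × ℝ × ℝ × ℝ =>
      dJ1 M a (radialAction M a x.1 1) x.2.1 x.2.2.1 x.2.2.2) (radialSet M a) ∧
    ContinuousOn (fun x : ℝ × ℝ × ℝ × ℝ =>
      dJ2 M a (radialAction M a x.1 1) x.2.1 x.2.2.1 x.2.2.2) (radialSet M a) := by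
  obtain ⟨hm, hE, hL⟩ := continuousOn_deriv_radialAction (M := M) ha
  have hmaps : MapsTo (Prod.snd : ℝ × ℝ × ℝ × ℝ → _) (radialSet M a) (boundSet M a) :=
    fun y hy => hy.1
  have hAm := (contDiffOn_areaM ha).continuousOn.comp continuousOn_snd hmaps
  have hAE := (contDiffOn_areaE ha).continuousOn.comp continuousOn_snd hmaps
  have hAL := (contDiffOn_areaL ha).continuousOn.comp continuousOn_snd hmaps
  have h0 : ∀ x ∈ radialSet M a, areaM M a x.2 ≠ 0 := fun x hx => (areaM_neg hM ha hx.1).ne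
  exact ⟨hE.sub ((hAE.div hAm h0).mul hm), hL.sub ((hAL.div hAm h0).mul hm),
    (continuousOn_const.div hAm h0).mul hm⟩

/-- The offset of `Q¹ - ω¹ Q⁰` from `φ + ω¹ t`. -/
noncomputable def offset1 (M a : ℝ) (y : ℝ × ℝ × ℝ × ℝ) : ℝ :=
  let p := constants M a y
  dJ1 M a (radialAction M a y.1 (Real.sign y.2.2.2)) p.1 p.2.1 p.2.2 -
    omega1 M a p.1 p.2.1 p.2.2 *
      dJ0 M a (radialAction M a y.1 (Real.sign y.2.2.2)) p.1 p.2.1 p.2.2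

/-- The offset of `Q² - ω² Q⁰` from `ω² t`. -/
noncomputable def offset2 (M a : ℝ) (y : ℝ × ℝ × ℝ × ℝ) : ℝ :=
  let p := constants M a y
  dJ2 M a (radialAction M a y.1 (Real.sign y.2.2.2)) p.1 p.2.1 p.2.2 -
    omega2 M a p.1 p.2.1 p.2.2 *
      dJ0 M a (radialAction M a y.1 (Real.sign y.2.2.2)) p.1 p.2.1 p.2.2

/-- The term `-t` in `Q⁰` makes the arguments of `F` affine in `t`, with slopes `ω¹` and `ω²`;
everything else is an offset depending only on the radius and the momenta. -/
theorem distribution_eq (F : AngleAction → ℝ) (z : Phase) :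
    distribution M a F z =
      F (z.2.1 + ((omega1 M a (constants M a z.2.2).1 (constants M a z.2.2).2.1
          (constants M a z.2.2).2.2 * z.1 : ℝ) : S1) + ((offset1 M a z.2.2 : ℝ) : S1),
        ((omega2 M a (constants M a z.2.2).1 (constants M a z.2.2).2.1
          (constants M a z.2.2).2.2 * z.1 : ℝ) : S1) + ((offset2 M a z.2.2 : ℝ) : S1),
        actions M a (constants M a z.2.2)) := by
  obtain ⟨t, ϕ, r, pt, pphi, pr⟩ := z
  simp only [distribution, Q0, Q1, Q2, offset1, offset2, constants, actions]
  congr 1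
  refine Prod.ext ?_ (Prod.ext ?_ rfl)
  · simp only
    rw [add_assoc, add_sub_assoc, ← AddCircle.coe_sub, ← AddCircle.coe_add]
    congr 2
    ring
  · simp only
    rw [← AddCircle.coe_sub, ← AddCircle.coe_add]
    congr 1
    ring

theorem continuousOn_omega (hM : 0 < M) (ha : |a| ≤ M) :
    ContinuousOn (fun p : ℝ × ℝ × ℝ => omega1 M a p.1 p.2.1 p.2.2) (boundSet M a) ∧
    ContinuousOn (fun p : ℝ × ℝ × ℝ => omega2 M a p.1 p.2.1 p.2.2) (boundSet M a) := by
  have h0 : ∀ p ∈ boundSet M a, areaE M a p ≠ 0 := fun p hp => (areaE_pos hM ha hp).ne'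
  exact ⟨((contDiffOn_areaL ha).continuousOn.div (contDiffOn_areaE ha).continuousOn h0).congr
      fun p hp => omega1_eq hM ha hp,
    (continuousOn_const.div (contDiffOn_areaE ha).continuousOn h0).congr
      fun p hp => omega2_eq hM ha hp⟩

theorem measurable_sign : Measurable Real.sign := by
  unfold Real.sign
  exact Measurable.ite measurableSet_Iio measurable_const
    (Measurable.ite measurableSet_Ioi measurable_const measurable_const)

theorem aemeasurable_omega_constants (hM : 0 < M) (ha : |a| ≤ M) {K : Set (ℝ × ℝ × ℝ)}
    (hK : IsClosed K) :
    AEMeasurable (fun y => omega1 M a (constants M a y).1 (constants M a y).2.1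
      (constants M a y).2.2) (volume.restrict (reducedGammaOver M a K)) ∧
    AEMeasurable (fun y => omega2 M a (constants M a y).1 (constants M a y).2.1
      (constants M a y).2.2) (volume.restrict (reducedGammaOver M a K)) := by
  have hms := measurableSet_reducedGammaOver hM ha hK
  have hc : ContinuousOn (constants M a) (reducedGammaOver M a K) :=
    (continuousOn_constants hM ha).mono fun _ hy => hy.1.1.1
  have hmaps : MapsTo (constants M a) (reducedGammaOver M a K) (boundSet M a) :=
    fun y hy => hy.1.2.1
  obtain ⟨h1, h2⟩ := continuousOn_omega hM ha
  exact ⟨(h1.comp hc hmaps).aemeasurable hms, (h2.comp hc hmaps).aemeasurable hms⟩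

theorem aemeasurable_offset (hM : 0 < M) (ha : |a| ≤ M) {K : Set (ℝ × ℝ × ℝ)}
    (hK : IsClosed K) :
    AEMeasurable (offset1 M a) (volume.restrict (reducedGammaOver M a K)) ∧
    AEMeasurable (offset2 M a) (volume.restrict (reducedGammaOver M a K)) := by
  have hms := measurableSet_reducedGammaOver hM ha hK
  have hc : ContinuousOn (fun y => (y.1, constants M a y)) (reducedGammaOver M a K) :=
    (continuousOn_prod_constants hM ha).mono fun _ hy => hy.1.1
  have hmaps : MapsTo (fun y => (y.1, constants M a y)) (reducedGammaOver M a K)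
      (radialSet M a) := fun y hy => hy.1.2
  obtain ⟨h0, h1, h2⟩ := continuousOn_dJ_radialAction hM ha
  obtain ⟨o1, o2⟩ := aemeasurable_omega_constants hM ha hK
  have hs : AEMeasurable (fun y : ℝ × ℝ × ℝ × ℝ => Real.sign y.2.2.2)
      (volume.restrict (reducedGammaOver M a K)) :=
    (measurable_sign.comp (by fun_prop)).aemeasurable
  have m0 := (h0.comp hc hmaps).aemeasurable (μ := volume) hms
  have m1 := (h1.comp hc hmaps).aemeasurable (μ := volume) hms
  have m2 := (h2.comp hc hmaps).aemeasurable (μ := volume) hms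
  constructor
  · unfold offset1
    simp_rw [dJ0_radialAction _ (Real.sign _), dJ1_radialAction _ (Real.sign _)]
    exact (hs.mul m1).sub (o1.mul (hs.mul m0))
  · unfold offset2
    simp_rw [dJ0_radialAction _ (Real.sign _), dJ2_radialAction _ (Real.sign _)]
    exact (hs.mul m2).sub (o2.mul (hs.mul m0))

/-! ### The bound region as a torus flow -/

theorem mem_GammaBound {z : Phase} : z ∈ GammaBound M a ↔
    z.2.2 ∈ timelikeSet M a ∧ constants M a z.2.2 ∈ boundSet M a ∧
      z.2.2.1 ∈ Icc (rIn M a (constants M a z.2.2).1 (constants M a z.2.2).2.1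
        (constants M a z.2.2).2.2) (rOut M a (constants M a z.2.2).1 (constants M a z.2.2).2.1
        (constants M a z.2.2).2.2) :=
  ⟨fun h => ⟨⟨h.1, h.2.1⟩, h.2.2.1, h.2.2.2⟩, fun h => ⟨h.1.1, h.1.2, h.2.1, h.2.2⟩⟩

theorem mem_reducedGamma_of_mem_GammaBound (hM : 0 < M) (ha : |a| ≤ M) {z : Phase}
    (hz : z ∈ GammaBound M a) (hpr : z.2.2.2.2.2 ≠ 0) : z.2.2 ∈ reducedGamma M a := by
  obtain ⟨ht, hB, hr⟩ := mem_GammaBound.1 hz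
  refine ⟨ht, hB, mem_Ioo_of_R_pos hB ?_ ?_⟩
  · obtain ⟨-, -, -, h01, -⟩ := IsBound.spec hB
    exact h01.trans_le hr.1
  · have := R_mass_eq hM ha ht.1 ht.2
    simp only [constants]
    rw [this]
    have := Del_pos ha ht.1
    positivity

theorem volume_turning_eq_zero : volume {z : Phase | z.2.2.2.2.2 = 0} = 0 := by
  have h : Measure.QuasiMeasurePreserving (fun z : Phase => z.2.2.2.2.2) volume volume :=
    Measure.quasiMeasurePreserving_snd.comp (Measure.quasiMeasurePreserving_snd.comp
      (Measure.quasiMeasurePreserving_snd.comp (Measure.quasiMeasurePreserving_snd.comp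
        Measure.quasiMeasurePreserving_snd)))
  exact h.preimage_null (measure_singleton (0 : ℝ))

/-- The constants of motion occurring on a set of phase space. -/
def constantsOn (M a : ℝ) (K : Set Phase) : Set (ℝ × ℝ × ℝ) :=
  (fun z : Phase => constants M a z.2.2) '' K

theorem isCompact_constantsOn (hM : 0 < M) (ha : |a| ≤ M) {K : Set Phase} (hK : IsCompact K)
    (hKΓ : K ⊆ GammaBound M a) : IsCompact (constantsOn M a K) :=
  hK.image_of_continuousOn ((continuousOn_constants hM ha).comp (by fun_prop)
    fun _ hz => (hKΓ hz).1)

theorem constantsOn_subset {K : Set Phase} (hKΓ : K ⊆ GammaBound M a) :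
    constantsOn M a K ⊆ boundSet M a := by
  rintro _ ⟨z, hz, rfl⟩
  exact (mem_GammaBound.1 (hKΓ hz)).2.1

/-- Compactness bounds `t`, the circle is taken whole, and the turning points `p_r = 0` are a null
set. Thus the measure on `K` lies below a product to which `map_angles_le` applies. -/
theorem exists_restrict_le (hM : 0 < M) (ha : |a| ≤ M) {K : Set Phase} (hK : IsCompact K)
    (hKΓ : K ⊆ GammaBound M a) : ∃ T : ℝ, 0 ≤ T ∧ (volume : Measure Phase).restrict K ≤
      (volume.restrict (Icc (-T) T)).prod ((volume : Measure S1).prod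
        (volume.restrict (reducedGammaOver M a (constantsOn M a K)))) := by
  obtain ⟨T, hT⟩ := hK.exists_bound_of_continuousOn (f := fun z : Phase => z.1) (by fun_prop)
  refine ⟨|T|, abs_nonneg _, ?_⟩
  have h1 : (volume : Measure S1).prod
      (volume.restrict (reducedGammaOver M a (constantsOn M a K))) =
      (volume : Measure (S1 × ℝ × ℝ × ℝ × ℝ)).restrict
        (univ ×ˢ reducedGammaOver M a (constantsOn M a K)) := by
    rw [Measure.volume_eq_prod S1, ← Measure.prod_restrict, Measure.restrict_univ]
  rw [h1, Measure.prod_restrict]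
  refine Measure.restrict_mono_ae ?_
  have h2 : ∀ᵐ z : Phase, z.2.2.2.2.2 ≠ 0 :=
    measure_eq_zero_iff_ae_notMem.1 volume_turning_eq_zero
  filter_upwards [h2] with z hz hzK
  have h3 := (hT z hzK).trans (le_abs_self T)
  rw [Real.norm_eq_abs, abs_le] at h3
  exact ⟨h3, mem_univ _, mem_reducedGamma_of_mem_GammaBound hM ha (hKΓ hzK) hz,
    mem_image_of_mem _ hzK⟩

/-- The covering of the circle by the line is an open quotient map, and so is its product with
identities; continuity of the lift therefore descends. -/
theorem IsTestFunction.continuous {φ : Phase → ℝ} (hφ : IsTestFunction M a φ) : Continuous φ := by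
  have hq : IsOpenQuotientMap (fun y : ℝ × ℝ × ℝ × ℝ × ℝ × ℝ => ((y.1, (y.2.1 : S1), y.2.2) : Phase)) :=
    IsOpenQuotientMap.id.prodMap
      ((QuotientAddGroup.isOpenQuotientMap_mk (G := ℝ)).prodMap IsOpenQuotientMap.id)
  exact hq.isQuotientMap.continuous_iff.2 hφ.1.continuous

theorem map_resonance_ac (hM : 0 < M) (ha : |a| ≤ M) {k l : ℝ} (Ω : ℝ) (hkl : k ≠ 0 ∨ l ≠ 0)
    {K : Set (ℝ × ℝ × ℝ)} (hK : IsCompact K) (hKB : K ⊆ boundSet M a)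
    (hdet : ∀ p ∈ K, (areaHessian M a p.1 p.2.1 p.2.2).det ≠ 0) {N : Set ℝ} (hN : volume N = 0) :
    volume.restrict (reducedGammaOver M a K) ((fun y =>
      k * (omega1 M a (constants M a y).1 (constants M a y).2.1 (constants M a y).2.2 + Ω) +
      l * omega2 M a (constants M a y).1 (constants M a y).2.1 (constants M a y).2.2) ⁻¹' N) = 0 := by
  obtain ⟨C, hC, hle⟩ := map_constants_le hM ha hK hKB
  have hms := measurableSet_reducedGammaOver hM ha hK.isClosed
  have h1 : volume.restrict (reducedGammaOver M a K)
      (constants M a ⁻¹' (K ∩ resonance M a k l Ω ⁻¹' N)) = 0 := by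
    refine le_antisymm ?_ zero_le
    refine (Measure.le_map_apply (aemeasurable_constants hM ha hK.isClosed) _).trans ?_
    refine (hle _).trans_eq ?_
    have h0 : volume.restrict K (K ∩ resonance M a k l Ω ⁻¹' N) = 0 :=
      le_antisymm ((Measure.restrict_apply_le _ _).trans_eq
        (volume_resonance_eq_zero hM ha Ω hkl hK hKB hdet hN)) zero_le
    rw [Measure.smul_apply, h0, smul_zero]
  refine (measure_congr ?_).trans h1
  filter_upwards [ae_restrict_mem hms] with y hy
  have hB := hKB hy.2
  apply propext
  change _ + _ ∈ N ↔ constants M a y ∈ K ∧ resonance M a k l Ω (constants M a y) ∈ N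
  rw [omega1_eq hM ha hB, omega2_eq hM ha hB]
  exact ⟨fun h => ⟨hy.2, h⟩, fun h => h.2⟩

theorem exists_omega2_bound (hM : 0 < M) (ha : |a| ≤ M) {K : Set (ℝ × ℝ × ℝ)} (hK : IsCompact K)
    (hKB : K ⊆ boundSet M a) (T : ℝ) : ∃ C : ENNReal, C ≠ ⊤ ∧ ∀ p ∈ K,
      omega2 M a p.1 p.2.1 p.2.2 ≠ 0 ∧
        ENNReal.ofReal (T / Real.pi + 1 / |omega2 M a p.1 p.2.1 p.2.2|) ≤ C := by
  obtain ⟨B, hB⟩ := hK.exists_bound_of_continuousOn ((contDiffOn_areaE ha).continuousOn.mono hKB)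
  refine ⟨ENNReal.ofReal (T / Real.pi + B / (2 * Real.pi)), ENNReal.ofReal_ne_top,
    fun p hp => ?_⟩
  have h0 := areaE_pos hM ha (hKB hp)
  have hpi := Real.pi_pos
  rw [omega2_eq hM ha (hKB hp)]
  refine ⟨div_ne_zero (by linarith) h0.ne', ?_⟩
  rw [abs_div, abs_neg, abs_of_pos h0, abs_of_pos (by positivity : 0 < 2 * Real.pi),
    one_div_div]
  gcongr
  exact (le_abs_self _).trans (hB p hp)

/-- The motion of the angles under the flow of `∂_t + Ω ∂_φ` is a torus flow. -/
theorem exists_torusFlow (hM : 0 < M) (ha : |a| ≤ M) {K : Set Phase} (hK : IsCompact K)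
    (hKΓ : K ⊆ GammaBound M a) (hdet : ∀ z ∈ K, NonDegenerateAt M a z) {φ : Phase → ℝ}
    (hφ : Continuous φ) {D : ℝ} (hD : ∀ z, |φ z| ≤ D) (Ω : ℝ) :
    ∃ 𝒯 : TorusFlow ((volume : Measure Phase).restrict K)
        (volume.restrict (actions M a '' constantsOn M a K)),
      (∀ (G : AngleAction → ℝ) s z, distribution M a G (timeFlow Ω s z) = G (𝒯.flow s z)) ∧
      ∀ z, 𝒯.h z = (φ z : ℂ) := by
  have hKc := isCompact_constantsOn hM ha hK hKΓ
  have hKB := constantsOn_subset hKΓ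
  have hms := measurableSet_reducedGammaOver hM ha hKc.isClosed
  obtain ⟨T, hT, hμ⟩ := exists_restrict_le hM ha hK hKΓ
  obtain ⟨C, hC, hω⟩ := exists_omega2_bound hM ha hKc hKB T
  obtain ⟨C₁, hC₁, hle₁⟩ := map_constants_le hM ha hKc hKB
  obtain ⟨C₂, hC₂, hle₂⟩ := map_actions_le hM ha hKc hKB
  obtain ⟨o1, o2⟩ := aemeasurable_omega_constants hM ha hKc.isClosed
  obtain ⟨m1, m2⟩ := aemeasurable_offset hM ha hKc.isClosed
  set ρ := (volume : Measure (ℝ × ℝ × ℝ × ℝ)).restrict (reducedGammaOver M a (constantsOn M a K))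
    with hρ
  set κ := (volume.restrict (Icc (-T) T)).prod ((volume : Measure S1).prod ρ) with hκ
  have hcon : AEMeasurable (constants M a) ρ := aemeasurable_constants hM ha hKc.isClosed
  have hact : AEMeasurable (actions M a) (volume.restrict (constantsOn M a K)) :=
    ((continuousOn_actions ha).mono hKB).aemeasurable hKc.measurableSet
  have hacρ : ρ.map (constants M a) ≪ volume.restrict (constantsOn M a K) :=
    (Measure.absolutelyContinuous_of_le hle₁).trans Measure.smul_absolutelyContinuous
  have hJ : AEMeasurable (fun y => actions M a (constants M a y)) ρ :=
    (hact.mono_ac hacρ).comp_aemeasurable hcon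
  have hJν : ρ.map (fun y => actions M a (constants M a y)) ≤
      (C₁ * C₂) • volume.restrict (actions M a '' constantsOn M a K) := by
    have h1 : ρ.map (fun y => actions M a (constants M a y)) =
        (ρ.map (constants M a)).map (actions M a) :=
      (AEMeasurable.map_map_of_aemeasurable (hact.mono_ac hacρ) hcon).symm
    rw [h1]
    refine (Measure.map_mono_of_aemeasurable hle₁ (hact.smul_measure _)).trans ?_
    rw [Measure.map_smul, mul_smul]
    exact Measure.le_iff.2 fun G _ => mul_le_mul_right (hle₂ G) C₁
  have hω' : ∀ᵐ y ∂ρ, omega2 M a (constants M a y).1 (constants M a y).2.1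
      (constants M a y).2.2 ≠ 0 ∧ ENNReal.ofReal (T / Real.pi + 1 / |omega2 M a
        (constants M a y).1 (constants M a y).2.1 (constants M a y).2.2|) ≤ C := by
    filter_upwards [ae_restrict_mem hms] with y hy
    exact hω _ hy.2
  -- Time `s` only adds `s(ω¹+Ω)` and `sω²` to the offsets, which the domination does not see. Hence
  -- the constant is the same for all `s`.
  have key := fun s : ℝ => map_angles_le o1 o2 (m1.add ((o1.add_const Ω).const_mul s))
    (m2.add (o2.const_mul s)) hJ hT hω' hJν
  have hq : Measure.QuasiMeasurePreserving (fun x : Phase => x.2.2) κ ρ :=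
    Measure.quasiMeasurePreserving_snd.comp Measure.quasiMeasurePreserving_snd
  have k0 := (map_angles_le o1 o2 m1 m2 hJ hT hω' hJν).1.mono_measure hμ
  refine ⟨{
    q₁ := fun z => z.2.1 + ((omega1 M a (constants M a z.2.2).1 (constants M a z.2.2).2.1
        (constants M a z.2.2).2.2 * z.1 : ℝ) : S1) + ((offset1 M a z.2.2 : ℝ) : S1)
    q₂ := fun z => ((omega2 M a (constants M a z.2.2).1 (constants M a z.2.2).2.1
        (constants M a z.2.2).2.2 * z.1 : ℝ) : S1) + ((offset2 M a z.2.2 : ℝ) : S1)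
    J := fun z => actions M a (constants M a z.2.2)
    -- The flow shifts `t` by `s`, which moves the first angle by `ω¹s`, and shifts `φ` by `Ωs`; the
    -- second angle moves by `ω²s` alone.
    w₁ := fun z => omega1 M a (constants M a z.2.2).1 (constants M a z.2.2).2.1
        (constants M a z.2.2).2.2 + Ω
    w₂ := fun z => omega2 M a (constants M a z.2.2).1 (constants M a z.2.2).2.1
        (constants M a z.2.2).2.2
    h := fun z => (φ z : ℂ)
    D := D
    C := C * (C₁ * C₂)
    aem_q₁ := k0.fst
    aem_q₂ := k0.snd.fst
    aem_J := k0.snd.snd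
    aem_w₁ := ((o1.add_const Ω).comp_quasiMeasurePreserving hq).mono_measure hμ
    aem_w₂ := (o2.comp_quasiMeasurePreserving hq).mono_measure hμ
    aem_h := (Complex.continuous_ofReal.comp hφ).measurable.aemeasurable
    norm_h_le := fun z => by rw [Complex.norm_real]; exact hD z
    C_ne_top := by finiteness
    map_le := ?_
    map_ac := ?_ }, ?_, fun _ => rfl⟩
  · intro s
    refine le_trans (le_of_eq ?_) ((Measure.map_mono_of_aemeasurable hμ (key s).1).trans (key s).2)
    congr 1
    ext1 z
    refine Prod.ext ?_ (Prod.ext ?_ rfl)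
    · simp only [Pi.add_apply, AddCircle.coe_add]
      abel
    · simp only [Pi.add_apply, AddCircle.coe_add]
      abel
  · intro k l hkl
    refine Measure.AbsolutelyContinuous.mk fun N hN hN0 => ?_
    have hθ : AEMeasurable (fun y =>
        (k : ℝ) * (omega1 M a (constants M a y).1 (constants M a y).2.1 (constants M a y).2.2 + Ω) +
        (l : ℝ) * omega2 M a (constants M a y).1 (constants M a y).2.1 (constants M a y).2.2) ρ :=
      ((o1.add_const Ω).const_mul _).add (o2.const_mul _)
    refine (Measure.map_apply_of_aemeasurable
      ((hθ.comp_quasiMeasurePreserving hq).mono_measure hμ) hN).trans ?_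
    refine le_antisymm ((hμ _).trans_eq ?_) zero_le
    refine hq.preimage_null (map_resonance_ac hM ha Ω (by exact_mod_cast hkl) hKc hKB ?_ hN0)
    rintro _ ⟨z, hz, rfl⟩
    exact hdet z hz
  · intro G s z
    rw [distribution_eq]
    obtain ⟨t, ϕ, y⟩ := z
    simp only [TorusFlow.flow, timeFlow]
    congr 1
    refine Prod.ext ?_ (Prod.ext ?_ rfl)
    · simp only [mul_add, AddCircle.coe_add]
      rw [mul_comm s Ω, mul_comm s]
      abel
    · simp only [mul_add, AddCircle.coe_add]
      rw [mul_comm s]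
      abel

/-! ### Conclusion -/

theorem measurePreserving_timeFlow (Ω s : ℝ) : MeasurePreserving (timeFlow Ω s) := by
  have h := (measurePreserving_add_right (volume : Measure ℝ) s).prod
    ((measurePreserving_add_right (volume : Measure S1) ((Ω * s : ℝ) : S1)).prod
      (MeasurePreserving.id (volume : Measure (ℝ × ℝ × ℝ × ℝ))))
  exact h

theorem timeFlow_timeFlow_neg (Ω s : ℝ) (z : Phase) : timeFlow Ω s (timeFlow Ω (-s) z) = z := by
  obtain ⟨t, ϕ, y⟩ := z
  simp [timeFlow, add_assoc]

theorem timeFlow_zero (Ω : ℝ) (z : Phase) : timeFlow Ω 0 z = z := by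
  obtain ⟨t, ϕ, y⟩ := z
  simp [timeFlow]

theorem timeFlow_mem_GammaBound {Ω s : ℝ} {z : Phase} :
    timeFlow Ω s z ∈ GammaBound M a ↔ z ∈ GammaBound M a := Iff.rfl

theorem actions_mem_of_mem_boundSet (ha : |a| ≤ M) {p : ℝ × ℝ × ℝ} (hp : p ∈ boundSet M a) :
    0 < (actions M a p).2.2 :=
  div_pos (area_pos ha hp) Real.two_pi_pos

theorem integrable_torusProd_of_integrableOn {F : AngleAction → ℝ}
    (hF : IntegrableOn F angleActionDomain) {S : Set (ℝ × ℝ × ℝ)} (hS : ∀ y ∈ S, 0 < y.2.2) :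
    Integrable (fun z => (F z : ℂ)) (torusProd (volume.restrict S)) := by
  have h1 : torusProd (volume.restrict S) =
      (volume : Measure AngleAction).restrict (univ ×ˢ (univ ×ˢ S)) := by
    rw [Measure.volume_eq_prod S1, ← Measure.prod_restrict, Measure.volume_eq_prod S1,
      ← Measure.prod_restrict, Measure.restrict_univ]
  rw [h1]
  exact (hF.mono_set fun z hz => hS _ hz.2.2).ofReal

/-- The average is an integral over the torus on one side and an iterated integral on the other.
They agree wherever the slice of `F` is integrable, that is for almost every action. -/
theorem torusAverage_ofReal_ae {F : AngleAction → ℝ} {ν : Measure (ℝ × ℝ × ℝ)} [SFinite ν]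
    (hF : Integrable (fun z => (F z : ℂ)) (torusProd ν)) :
    ∀ᵐ y ∂ν, ∀ q₁ q₂ : S1, torusAverage (fun z => (F z : ℂ)) y = (angleAverage F (q₁, q₂, y) : ℂ) := by
  have hmp := measurePreserving_prodAssoc (volume : Measure S1) (volume : Measure S1) ν
  have h1 : Integrable (fun z : (S1 × S1) × (ℝ × ℝ × ℝ) => (F (z.1.1, z.1.2, z.2) : ℂ))
      ((volume : Measure (S1 × S1)).prod ν) := hmp.integrable_comp_of_integrable hF
  filter_upwards [h1.prod_left_ae] with y hy q₁ q₂
  have h2 : Integrable (fun q : S1 × S1 => F (q.1, q.2, y)) := hy.re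
  rw [torusAverage, integral_complex_ofReal, ← Complex.ofReal_mul]
  congr 2
  rw [Measure.volume_eq_prod] at h2 ⊢
  exact integral_prod _ h2

/-- Relaxation of the collisionless gas: observables converge to those of the angle average. -/
theorem tendsto_observable (M a : ℝ) (hM : 0 < M) (ha : |a| ≤ M)
    (F : AngleAction → ℝ)
    (hF : IntegrableOn F angleActionDomain)
    (φ : Phase → ℝ) (hφ : IsTestFunction M a φ)
    (hdet : ∀ z ∈ tsupport φ, NonDegenerateAt M a z)
    (Ω : ℝ) :
    (∀ s : ℝ, IntegrableOn
      (fun z => distribution M a F z * timeTranslate Ω s φ z)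
      (GammaBound M a)) ∧
    IntegrableOn
      (fun z => distribution M a (angleAverage F) z * φ z)
      (GammaBound M a) ∧
    Tendsto
      (fun s : ℝ => observable M a (distribution M a F)
        (timeTranslate Ω s φ))
      atTop
      (𝓝 (observable M a
        (distribution M a (angleAverage F)) φ)) := by
  have hK : IsCompact (tsupport φ) := hφ.2.1
  have hKΓ : tsupport φ ⊆ GammaBound M a := hφ.2.2
  have hφc := hφ.continuous
  obtain ⟨D, hD⟩ := hφ.2.1.exists_bound_of_continuous hφc
  have hKc := isCompact_constantsOn hM ha hK hKΓ
  have hKB := constantsOn_subset hKΓ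
  have hS : IsCompact (actions M a '' constantsOn M a (tsupport φ)) :=
    hKc.image_of_continuousOn ((continuousOn_actions ha).mono hKB)
  set ν := (volume : Measure (ℝ × ℝ × ℝ)).restrict
    (actions M a '' constantsOn M a (tsupport φ)) with hν
  have : IsFiniteMeasure ν := ⟨by rw [hν, Measure.restrict_apply_univ]; exact hS.measure_lt_top⟩
  have : IsFiniteMeasure ((volume : Measure Phase).restrict (tsupport φ)) :=
    ⟨by rw [Measure.restrict_apply_univ]; exact hK.measure_lt_top⟩
  have hFi : Integrable (fun z => (F z : ℂ)) (torusProd ν) := by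
    refine integrable_torusProd_of_integrableOn hF ?_
    rintro _ ⟨p, hp, rfl⟩
    exact actions_mem_of_mem_boundSet ha (hKB hp)
  obtain ⟨𝒯, hflow, hh⟩ := exists_torusFlow hM ha hK hKΓ hdet hφc hD Ω
  have hmix := 𝒯.mixes_of_integrable hFi
  have hzero : ∀ z ∉ tsupport φ, φ z = 0 := fun z hz => image_eq_zero_of_notMem_tsupport hz
  -- The flow preserves both the volume and the bound region, so `f φ_s` becomes `(f ∘ ψ^s) φ`,
  -- supported in a fixed compact set.
  set k : ℝ → Phase → ℝ := fun s z => distribution M a F (timeFlow Ω s z) * φ z with hk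
  have hkc : ∀ s z, ((k s z : ℝ) : ℂ) = (F (𝒯.flow s z) : ℂ) * 𝒯.h z := by
    intro s z
    simp only [hk, hh, ← hflow F s z, Complex.ofReal_mul]
  have hki : ∀ s, IntegrableOn (k s) (tsupport φ) := by
    intro s
    have := 𝒯.integrable_weight_mul (𝒯.integrable_comp_flow hFi s)
    simp_rw [← hkc] at this
    exact this.re
  have hkint : ∀ s, Integrable (k s) := fun s =>
    (integrableOn_iff_integrable_of_support_subset fun z hz => by
      by_contra h
      exact hz (by simp only [hk]; rw [hzero z h, mul_zero])).1 (hki s)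
  have hcomp : ∀ s, (fun z => distribution M a F z * timeTranslate Ω s φ z) =
      fun z => k s (timeFlow Ω (-s) z) := by
    intro s
    ext z
    simp only [hk, timeTranslate, timeFlow_timeFlow_neg]
  have hgint : ∀ s, Integrable (fun z => distribution M a F z * timeTranslate Ω s φ z) := by
    intro s
    rw [hcomp s]
    exact (measurePreserving_timeFlow Ω (-s)).integrable_comp_of_integrable (hkint s)
  have hobs : ∀ s, observable M a (distribution M a F) (timeTranslate Ω s φ) =
      ∫ z in tsupport φ, k s z := by
    intro s
    have hmp := measurePreserving_timeFlow Ω (-s)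
    rw [observable, setIntegral_eq_integral_of_forall_compl_eq_zero, hcomp s,
      ← integral_map hmp.measurable.aemeasurable, hmp.map_eq,
      setIntegral_eq_integral_of_forall_compl_eq_zero]
    · intro z hz
      simp only [hk, hzero z hz, mul_zero]
    · rw [hmp.map_eq]
      exact (hkint s).aestronglyMeasurable
    · intro z hz
      rw [timeTranslate, hzero _ fun h => hz (timeFlow_mem_GammaBound.1 (hKΓ h)), mul_zero]
  set g : Phase → ℝ := fun z => distribution M a (angleAverage F) z * φ z with hg
  have hgc : (fun z => torusAverage (fun x => (F x : ℂ)) (𝒯.J z) * 𝒯.h z)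
      =ᵐ[volume.restrict (tsupport φ)] fun z => ((g z : ℝ) : ℂ) := by
    filter_upwards [𝒯.aemeas_ae_J (torusAverage_ofReal_ae hFi)] with z hz
    -- The angles at time zero are inserted as dummy arguments of `angleAverage`, to match the form
    -- in which `hflow` rewrites the distribution.
    rw [hz (𝒯.flow 0 z).1 (𝒯.flow 0 z).2.1, hh, ← Complex.ofReal_mul]
    congr 2
    have := hflow (angleAverage F) 0 z
    rw [timeFlow_zero] at this
    rw [this]
    rfl
  have hgi : IntegrableOn g (tsupport φ) :=
    ((𝒯.integrable_weight_mul (𝒯.integrable_torusAverage_comp hFi)).congr hgc).re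
  have hgz : ∀ z ∉ tsupport φ, g z = 0 := fun z hz => by simp only [hg, hzero z hz, mul_zero]
  have hgI : Integrable g :=
    (integrableOn_iff_integrable_of_support_subset fun z hz => by
      by_contra h
      exact hz (hgz z h)).1 hgi
  refine ⟨fun s => (hgint s).integrableOn, hgI.integrableOn, ?_⟩
  have hlim : observable M a (distribution M a (angleAverage F)) φ = ∫ z in tsupport φ, g z := by
    rw [observable, setIntegral_eq_integral_of_forall_compl_eq_zero fun z hz =>
      hgz z fun h => hz (hKΓ h), setIntegral_eq_integral_of_forall_compl_eq_zero hgz]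
  rw [TorusFlow.Mixes, integral_congr_ae hgc, integral_complex_ofReal] at hmix
  simp_rw [← hkc, integral_complex_ofReal] at hmix
  simp_rw [hobs, hlim]
  exact (Complex.continuous_re.tendsto _).comp hmix

end KerrMixing

theorem theorem1 (M a : ℝ) (hM : 0 < M) (ha : |a| ≤ M)
    (F : KerrMixing.AngleAction → ℝ)
    (hF : MeasureTheory.IntegrableOn F KerrMixing.angleActionDomain)
    (φ : KerrMixing.Phase → ℝ) (hφ : KerrMixing.IsTestFunction M a φ)
    (hdet : ∀ z ∈ tsupport φ, KerrMixing.NonDegenerateAt M a z)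
    (Ω : ℝ) :
    (∀ s : ℝ, MeasureTheory.IntegrableOn
      (fun z => KerrMixing.distribution M a F z * KerrMixing.timeTranslate Ω s φ z)
      (KerrMixing.GammaBound M a)) ∧
    MeasureTheory.IntegrableOn
      (fun z => KerrMixing.distribution M a (KerrMixing.angleAverage F) z * φ z)
      (KerrMixing.GammaBound M a) ∧
    Filter.Tendsto
      (fun s : ℝ => KerrMixing.observable M a (KerrMixing.distribution M a F)
        (KerrMixing.timeTranslate Ω s φ))
      Filter.atTop
      (nhds (KerrMixing.observable M a
        (KerrMixing.distribution M a (KerrMixing.angleAverage F)) φ)) :=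
  KerrMixing.tendsto_observable M a hM ha F hF φ hφ hdet Ω
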